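/- **Setting.** Fix $\tau\in\mathbb C$ with $\operatorname{Im}\tau>0$ and an integer $m\ge 1$. Let $\theta(x)=\theta(x,\tau)$ be the first Jacobi theta function, normalized by $\theta'(0)=1$: with $q=e^{2\pi i\tau}$ and $(u;q)=\prod_{j\ge0}(1-uq^j)$, $$\theta(x)=-\frac{e^{-\pi i x}}{2\pi i}\,(e^{2\pi i x};q)\,(qe^{-2\pi i x};q)\,(q;q)^{-2},$$ and let $\rho=\theta'/\theta$. For $w\in\mathbb C$ let $\Lambda=\{w+a+b\tau: 0\le a,b<1\}$ and $\Lambda'=\{w+a+b\tau:0<a,b<1\}$. *Theta-polynomials.* For $A,B\in\mathbb C^\times$, $T_{k,A,B}$ is the space of entire functions $f$ with $f(x+1)=A(-1)^kf(x)$ and $f(x+\tau)=B(-1)^ke^{-\pi i k\tau-2\pi i kx}f(x)$. $P_{k,A}$ is the set of nonzero elements of $\bigcup_BT_{k,A,B}$ up to nonzero constant factors, and $P_k=\bigcup_AP_{k,A}$. Each $f\in P_k$ is uniquely of the form $e^{2\pi i\nu x}\prod_{j=1}^k\theta(x-u_j)$ with $\nu\in\mathbb C$, $(u_1,\dots,u_k)\in\Lambda^k/S_k$;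 $l(f)=\nu$ is its label. Put $\mathrm{Wr}(f,g)=fg'-f'g$. For $h\in P_{2m}-P_{2m,1}$ let $$\mathrm{Wr}_0^{-1}(h)=\{(f,g)\in P_{m,1}\times(P_m-P_{m,1}) : \mathrm{Wr}(f,g)=h,\ l(f)=0\}.$$ The group $\mathbb Z$ acts on $P_{m,1}\times(P_m-P_{m,1})$ by $k\cdot(f,g)=(e^{2\pi ikx}f,e^{2\pi ikx}g)$. The analytic involution $\iota_{\rm an}$ of the quotient sends the class of $(f,g)$ to the class of $(e^{2\pi i\nu x}g,e^{2\pi i\nu x}f)$, where $\nu$ is such that $e^{2\pi i\nu x}g\in P_{m,1}$. $\mathrm{Pairs}_m$ is the set of classes of those $(f,g)$ for which neither $f$ nor $g$ has a common zero with $\mathrm{Wr}(f,g)$. *Bethe ansatz equations.* A solution is a point $(\mu,t,z)\in\mathbb C\times\mathbb C^m/S_m\times\mathbb C^{2m}/S_{2m}$ such that no $t_i-t_j$ ($i\ne j$) and no $t_i-z_a$ lies in $\mathbb Z+\tau\mathbb Z$ and $$2\pi i\mu+2\sum_{k\ne j}\rho(t_j-t_k)-\sum_{a=1}^{2m}\rho(t_j-z_a)=0,\qquad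 j=1,\dots,m.$$ Equivalence of solutions is generated by $(\mu,t_j)\mapsto(\mu-2,t_j+\tau)$, $t_j\mapsto t_j+1$, $(\mu,z_a)\mapsto(\mu+1,z_a+\tau)$, $z_a\mapsto z_a+1$. A class with $\mu\notin\mathbb Z$ corresponds under $\beta$ to the class of $(f,g)\in P_{m,1}\times(P_m-P_{m,1})$ with $f=\prod_j\theta(x-t_j)$ and $\mathrm{Wr}(f,g)=e^{-2\pi i\mu x}\prod_a\theta(x-z_a)$ up to a constant factor. On $\mathrm{Sol}_m=\beta^{-1}(\mathrm{Pairs}_m)$ this gives the involution $\beta^{-1}\circ\iota_{\rm an}\circ\beta$. For $z\in\Lambda^{2m}/S_{2m}$ let $B(\mu,z)$ be the set of classes that have a representative $(\mu,t,z)$ with $t\in\Lambda^m/S_m$. **Theorem.** Let $z=(z_1,\dots,z_{2m})\in(\Lambda')^{2m}/S_{2m}$ have distinct coordinates. Then there exists $N>0$ such that for every $\mu\in\mathbb C$ with $|\mu|>N$ each of the sets $B(\mu,z)$ and $B(-\mu,z)$ consists of exactly $\binom{2m}{m}$ elements. Moreover, if in addition $\mu\notin\mathbb Z$, then $B(\mu,z)$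 is contained in $\mathrm{Sol}_m$, and $\beta^{-1}\circ\iota_{\rm an}\circ\beta$ restricts to a bijection $B(\mu,z)\to B(-\mu,z)$. It combines the elements of the two sets into $\binom{2m}{m}$ pairs; if $(\mu,t,z)$ and $(-\mu,s,z)$ with $t,s\in\Lambda^m/S_m$ represent the two classes of such a pair, then the corresponding points $$\Big(\prod_{j=1}^m\theta(x-t_j),\ e^{-2\pi i\mu x}\prod_{j=1}^m\theta(x-s_j)\Big)$$ list all points of $\mathrm{Wr}_0^{-1}(h)$, each exactly once, where $h=e^{-2\pi i\mu x}\prod_{a=1}^{2m}\theta(x-z_a)$. -/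

import Mathlib

namespace EllipticBethe

noncomputable section

open Complex
open scoped UpperHalfPlane

/-! ### The theta function -/

/-- The infinite product `(z; q) = ∏_{j ≥ 0} (1 - z q^j)`. -/
def qPoch (z q : ℂ) : ℂ := ∏' j : ℕ, (1 - z * q ^ j)

/-- The normalized first Jacobi theta function: with `z = exp (2πix)` and `q = exp (2πiτ)`,
`θ(x, τ) = - exp (-πix) / (2πi) * (z; q) (q/z; q) (q; q)⁻²`.
It is an odd entire function of `x` whose derivative at `0` is `1`. -/
def theta (τ : ℍ) (x : ℂ) : ℂ :=
  -(exp (-(Real.pi * I * x)) / (2 * Real.pi * I)) *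
    qPoch (exp (2 * Real.pi * I * x)) (exp (2 * Real.pi * I * τ)) *
    qPoch (exp (2 * Real.pi * I * τ) / exp (2 * Real.pi * I * x)) (exp (2 * Real.pi * I * τ)) *
    (qPoch (exp (2 * Real.pi * I * τ)) (exp (2 * Real.pi * I * τ)) ^ 2)⁻¹

/-- The logarithmic derivative `ρ = θ' / θ`. -/
def rho (τ : ℍ) (x : ℂ) : ℂ := deriv (theta τ) x / theta τ x

/-- The lattice `ℤ + τℤ`. -/
def lattice (τ : ℍ) : Set ℂ := {x | ∃ k l : ℤ, x = k + l * (τ : ℂ)}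

/-- The half-open fundamental parallelogram with vertices `w, w + 1, w + τ, w + 1 + τ`. -/
def parallelogram (τ : ℍ) (w : ℂ) : Set ℂ :=
  {x | ∃ a b : ℝ, 0 ≤ a ∧ a < 1 ∧ 0 ≤ b ∧ b < 1 ∧ x = w + a + b * (τ : ℂ)}

/-- The open parallelogram with vertices `w, w + 1, w + τ, w + 1 + τ`. -/
def openParallelogram (τ : ℍ) (w : ℂ) : Set ℂ :=
  {x | ∃ a b : ℝ, 0 < a ∧ a < 1 ∧ 0 < b ∧ b < 1 ∧ x = w + a + b * (τ : ℂ)}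

/-! ### Theta-polynomials -/

/-- The space `T_{m,A,B}` of theta-polynomials of degree `m` with multipliers `A, B`:
entire functions with `f(x+1) = A (-1)^m f(x)` and
`f(x+τ) = B (-1)^m exp(-πi m τ - 2πi m x) f(x)`. -/
def thetaSpace (τ : ℍ) (m : ℕ) (A B : ℂ) : Submodule ℂ (ℂ → ℂ) where
  carrier := {f | Differentiable ℂ f ∧ (∀ x, f (x + 1) = A * (-1) ^ m * f x) ∧
    ∀ x, f (x + τ) =
      B * (-1) ^ m * exp (-(Real.pi * I * m * τ) - 2 * Real.pi * I * m * x) * f x}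
  add_mem' := by
    rintro f g ⟨hf, hf1, hf2⟩ ⟨hg, hg1, hg2⟩
    refine ⟨hf.add hg, fun x => ?_, fun x => ?_⟩
    · simp only [Pi.add_apply, hf1, hg1]; ring
    · simp only [Pi.add_apply, hf2, hg2]; ring
  zero_mem' := ⟨differentiable_const 0, fun x => by simp, fun x => by simp⟩
  smul_mem' := by
    rintro c f ⟨hf, hf1, hf2⟩
    refine ⟨hf.const_smul c, fun x => ?_, fun x => ?_⟩
    · simp only [Pi.smul_apply, smul_eq_mul, hf1]; ring
    · simp only [Pi.smul_apply, smul_eq_mul, hf2]; ring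

/-- Nonzero functions `ℂ → ℂ` up to multiplication by a nonzero constant. -/
abbrev ProjFun : Type := Projectivization ℂ (ℂ → ℂ)

/-- `P_{m,A}`: nonzero theta-polynomials of degree `m` with first multiplier `A`, up to
multiplication by a nonzero constant. -/
def projThetaFirst (τ : ℍ) (m : ℕ) (A : ℂ) : Set ProjFun :=
  {p | ∃ B : ℂ, B ≠ 0 ∧ p.rep ∈ thetaSpace τ m A B}

/-- `P_m`: nonzero theta-polynomials of degree `m`, up to multiplication by a nonzero constant. -/
def projTheta (τ : ℍ) (m : ℕ) : Set ProjFun :=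
  {p | ∃ A : ℂ, A ≠ 0 ∧ p ∈ projThetaFirst τ m A}

/-- The function `exp (2πiνx) ∏_j θ(x - t_j, τ)`. -/
def thetaProd (τ : ℍ) (ν : ℂ) {k : ℕ} (t : Fin k → ℂ) : ℂ → ℂ :=
  fun x => exp (2 * Real.pi * I * ν * x) * ∏ j, theta τ (x - t j)

theorem norm_nome_lt_one (τ : ℍ) : ‖exp (2 * Real.pi * I * τ)‖ < 1 :=
  UpperHalfPlane.norm_exp_two_pi_I_lt_one τ

theorem qPoch_ne_zero {z q : ℂ} (hq : ‖q‖ < 1) (h : ∀ j : ℕ, z * q ^ j ≠ 1) :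
    qPoch z q ≠ 0 := by
  have := tprod_one_add_ne_zero_of_summable (f := fun j : ℕ => -(z * q ^ j))
    (fun j hj => h j (by linear_combination -hj))
    (by
      simp only [norm_neg, norm_mul, norm_pow]
      exact (summable_geometric_of_lt_one (norm_nonneg _) hq).mul_left _)
  simpa only [qPoch, sub_eq_add_neg] using this

theorem theta_ne_zero {τ : ℍ} {x : ℂ} (hx : x ∉ lattice τ) : theta τ x ≠ 0 := by
  have hq := norm_nome_lt_one τ
  have h2 : (2 * Real.pi * I : ℂ) ≠ 0 := Complex.two_pi_I_ne_zero
  have key : ∀ (y : ℂ), exp (2 * Real.pi * I * y) = 1 → ∃ n : ℤ, y = n := by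
    intro y hy
    obtain ⟨n, hn⟩ := Complex.exp_eq_one_iff.1 hy
    exact ⟨n, mul_left_cancel₀ h2 (by rw [hn]; ring)⟩
  have hz : qPoch (exp (2 * Real.pi * I * x)) (exp (2 * Real.pi * I * τ)) ≠ 0 := by
    refine qPoch_ne_zero hq fun j hj => hx ?_
    rw [← Complex.exp_nat_mul, ← Complex.exp_add] at hj
    obtain ⟨n, hn⟩ := key (x + j * τ) (by rw [← hj]; congr 1; ring)
    exact ⟨n, -(j : ℤ), by push_cast; linear_combination hn⟩
  have hz' : qPoch (exp (2 * Real.pi * I * τ) / exp (2 * Real.pi * I * x))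
      (exp (2 * Real.pi * I * τ)) ≠ 0 := by
    refine qPoch_ne_zero hq fun j hj => hx ?_
    rw [← Complex.exp_nat_mul, ← Complex.exp_sub, ← Complex.exp_add] at hj
    obtain ⟨n, hn⟩ := key (τ - x + j * τ) (by rw [← hj]; congr 1; ring)
    exact ⟨-n, (j : ℤ) + 1, by push_cast; linear_combination -hn⟩
  have hqq : qPoch (exp (2 * Real.pi * I * τ)) (exp (2 * Real.pi * I * τ)) ≠ 0 := by
    refine qPoch_ne_zero hq fun j hj => ?_
    have hn : ‖exp (2 * Real.pi * I * τ)‖ ^ (j + 1) = 1 := by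
      rw [pow_succ', ← norm_pow, ← norm_mul, hj, norm_one]
    exact (pow_lt_one₀ (norm_nonneg _) hq (Nat.succ_ne_zero j)).ne hn
  unfold theta
  exact mul_ne_zero (mul_ne_zero (mul_ne_zero
    (neg_ne_zero.2 (div_ne_zero (Complex.exp_ne_zero _) h2)) hz) hz')
    (inv_ne_zero (pow_ne_zero 2 hqq))

theorem countable_lattice (τ : ℍ) : (lattice τ).Countable := by
  have : lattice τ = Set.range (fun p : ℤ × ℤ => (p.1 : ℂ) + p.2 * (τ : ℂ)) := by
    ext x
    constructor
    · rintro ⟨k, l, h⟩; exact ⟨(k, l), h.symm⟩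
    · rintro ⟨p, h⟩; exact ⟨p.1, p.2, h.symm⟩
  rw [this]
  exact Set.countable_range _

theorem thetaProd_ne_zero (τ : ℍ) (ν : ℂ) {k : ℕ} (t : Fin k → ℂ) : thetaProd τ ν t ≠ 0 := by
  have hc : (⋃ j, (fun x => x - t j) ⁻¹' lattice τ).Countable :=
    Set.countable_iUnion fun j =>
      (countable_lattice τ).preimage (sub_left_injective (b := t j))
  obtain ⟨x, hx⟩ := (hc.dense_compl ℝ).nonempty
  intro h
  have hx0 := congrFun h x
  simp only [Set.mem_compl_iff, Set.mem_iUnion, Set.mem_preimage, not_exists] at hx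
  exact mul_ne_zero (Complex.exp_ne_zero _)
    (Finset.prod_ne_zero_iff.2 fun j _ => theta_ne_zero (hx j)) hx0

/-- The function `exp (2πiνx) ∏_j θ(x - t_j, τ)`, up to multiplication by a nonzero constant. -/
def thetaPoint (τ : ℍ) (ν : ℂ) {k : ℕ} (t : Fin k → ℂ) : ProjFun :=
  Projectivization.mk ℂ (thetaProd τ ν t) (thetaProd_ne_zero τ ν t)

/-- `p` has label `ν` relative to the fundamental parallelogram with corner `w`. -/
def HasLabel (τ : ℍ) (w : ℂ) (k : ℕ) (p : ProjFun) (ν : ℂ) : Prop :=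
  ∃ u : Fin k → ℂ, (∀ j, u j ∈ parallelogram τ w) ∧ p = thetaPoint τ ν u

/-! ### Wronskians -/

/-- The Wronskian `f g' - f' g`. -/
def wronskian (f g : ℂ → ℂ) : ℂ → ℂ := fun x => f x * deriv g x - deriv f x * g x

/-- `Wr(f, g) = h` for functions considered up to nonzero constant factors. -/
def WronskianEq (f g h : ProjFun) : Prop :=
  ∃ hW : wronskian f.rep g.rep ≠ 0, Projectivization.mk ℂ (wronskian f.rep g.rep) hW = h

/-- The space `P_{m,1} × (P_m - P_{m,1})`. -/
def pairDomain (τ : ℍ) (m : ℕ) : Set (ProjFun × ProjFun) :=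
  {P | P.1 ∈ projThetaFirst τ m 1 ∧ P.2 ∈ projTheta τ m ∧ P.2 ∉ projThetaFirst τ m 1}

/-- The labeled preimage `Wr_k⁻¹(h)` under the Wronski map
`P_{m,1} × (P_m - P_{m,1}) → P_{2m} - P_{2m,1}`. -/
def labeledPreimage (τ : ℍ) (w : ℂ) (m : ℕ) (k : ℤ) (h : ProjFun) : Set (ProjFun × ProjFun) :=
  {P | P ∈ pairDomain τ m ∧ WronskianEq P.1 P.2 h ∧ HasLabel τ w m P.1 k}

/-! ### The action of `ℂ` by exponential factors -/

/-- Multiplication of functions by `exp (2πiνx)`. -/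
def expMulLin (ν : ℂ) : (ℂ → ℂ) →ₗ[ℂ] (ℂ → ℂ) where
  toFun f := fun x => exp (2 * Real.pi * I * ν * x) * f x
  map_add' f g := by funext x; simp [mul_add]
  map_smul' c f := by funext x; simp [mul_left_comm]

theorem expMulLin_injective (ν : ℂ) : Function.Injective (expMulLin ν) := by
  intro f g h
  funext x
  exact mul_left_cancel₀ (Complex.exp_ne_zero _) (congrFun h x)

/-- The map `L_ν`, multiplication by `exp (2πiνx)`, up to constant factors. -/
def expMul (ν : ℂ) : ProjFun → ProjFun :=
  Projectivization.map (expMulLin ν) (expMulLin_injective ν)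

theorem expMul_add (ν ν' : ℂ) (p : ProjFun) : expMul (ν + ν') p = expMul ν (expMul ν' p) := by
  induction p using Projectivization.ind with
  | h v hv =>
    simp only [expMul, Projectivization.map_mk]
    congr 1
    funext x
    simp only [expMulLin, LinearMap.coe_mk, AddHom.coe_mk]
    rw [← mul_assoc, ← Complex.exp_add]
    congr 2
    ring

theorem expMul_zero (p : ProjFun) : expMul 0 p = p := by
  induction p using Projectivization.ind with
  | h v hv =>
    simp only [expMul, Projectivization.map_mk]
    congr 1
    funext x
    simp [expMulLin]

theorem mk_mem_projThetaFirst {τ : ℍ} {m : ℕ} {A : ℂ} {v : ℂ → ℂ} (hv : v ≠ 0) :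
    Projectivization.mk ℂ v hv ∈ projThetaFirst τ m A ↔
      ∃ B : ℂ, B ≠ 0 ∧ v ∈ thetaSpace τ m A B := by
  obtain ⟨a, ha⟩ := Projectivization.exists_smul_eq_mk_rep ℂ v hv
  simp only [projThetaFirst, Set.mem_ofPred_eq, ← ha]
  exact exists_congr fun B => and_congr_right fun _ =>
    Submodule.smul_mem_iff_of_isUnit (thetaSpace τ m A B) a.isUnit

theorem expMul_mem {τ : ℍ} {m : ℕ} {A : ℂ} (ν : ℂ) {p : ProjFun}
    (hp : p ∈ projThetaFirst τ m A) :
    expMul ν p ∈ projThetaFirst τ m (exp (2 * Real.pi * I * ν) * A) := by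
  induction p using Projectivization.ind with
  | h v hv =>
    obtain ⟨B, hB, hd, h1, h2⟩ := (mk_mem_projThetaFirst hv).1 hp
    simp only [expMul, Projectivization.map_mk]
    refine (mk_mem_projThetaFirst _).2
      ⟨exp (2 * Real.pi * I * ν * τ) * B, mul_ne_zero (Complex.exp_ne_zero _) hB, ?_, ?_, ?_⟩
    · simp only [expMulLin, LinearMap.coe_mk, AddHom.coe_mk]
      fun_prop
    · intro x
      simp only [expMulLin, LinearMap.coe_mk, AddHom.coe_mk, h1]
      rw [mul_add, Complex.exp_add, mul_one]
      ring
    · intro x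
      simp only [expMulLin, LinearMap.coe_mk, AddHom.coe_mk, h2]
      rw [mul_add (2 * Real.pi * I * ν), Complex.exp_add]
      ring

theorem projThetaFirst_unique {τ : ℍ} {m : ℕ} {A A' : ℂ} {p : ProjFun}
    (h : p ∈ projThetaFirst τ m A) (h' : p ∈ projThetaFirst τ m A') : A = A' := by
  obtain ⟨B, -, -, h1, -⟩ := h
  obtain ⟨B', -, -, h1', -⟩ := h'
  obtain ⟨x, hx⟩ := Function.ne_iff.1 p.rep_nonzero
  have := (h1 x).symm.trans (h1' x)
  have h3 : ((-1 : ℂ) ^ m) ≠ 0 := pow_ne_zero _ (by norm_num)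
  exact mul_right_cancel₀ h3 (mul_right_cancel₀ hx this)

theorem exp_two_pi_int (k : ℤ) : exp (2 * Real.pi * I * k) = 1 :=
  Complex.exp_eq_one_iff.2 ⟨k, by ring⟩

theorem expMul_int_mem_iff {τ : ℍ} {m : ℕ} {A : ℂ} (k : ℤ) {p : ProjFun} :
    expMul k p ∈ projThetaFirst τ m A ↔ p ∈ projThetaFirst τ m A := by
  constructor
  · intro h
    have h' := expMul_mem (-(k : ℂ)) h
    have hk := exp_two_pi_int (-k)
    push_cast at hk
    rwa [← expMul_add, neg_add_cancel, expMul_zero, hk, one_mul] at h'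
  · intro h
    simpa [exp_two_pi_int] using expMul_mem (k : ℂ) h

/-! ### The quotient by `ℤ` and the analytic involution -/

/-- Two points of `P_{m,1} × (P_m - P_{m,1})` are equivalent if they differ by the diagonal
action of `ℤ` through the maps `L_k × L_k`. -/
def pairSetoid (τ : ℍ) (m : ℕ) : Setoid (pairDomain τ m) where
  r P Q := ∃ k : ℤ, Q.1.1 = expMul k P.1.1 ∧ Q.1.2 = expMul k P.1.2
  iseqv :=
    { refl := fun P => ⟨0, by simp [expMul_zero], by simp [expMul_zero]⟩
      symm := by
        rintro P Q ⟨k, h1, h2⟩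
        refine ⟨-k, ?_, ?_⟩
        · rw [h1, ← expMul_add]; simp [expMul_zero]
        · rw [h2, ← expMul_add]; simp [expMul_zero]
      trans := by
        rintro P Q R ⟨k, h1, h2⟩ ⟨l, h3, h4⟩
        refine ⟨l + k, ?_, ?_⟩
        · rw [h3, h1, ← expMul_add]; push_cast; rfl
        · rw [h4, h2, ← expMul_add]; push_cast; rfl }

/-- The space `(P_{m,1} × (P_m - P_{m,1})) / ℤ`. -/
def PairQuot (τ : ℍ) (m : ℕ) : Type := Quotient (pairSetoid τ m)

theorem exists_shift {τ : ℍ} {m : ℕ} {g : ProjFun} (hg : g ∈ projTheta τ m) :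
    ∃ ν : ℂ, expMul ν g ∈ projThetaFirst τ m 1 := by
  obtain ⟨A, hA, hgA⟩ := hg
  refine ⟨-(Complex.log A / (2 * Real.pi * I)), ?_⟩
  have h := expMul_mem (-(Complex.log A / (2 * Real.pi * I))) hgA
  have e : exp (2 * Real.pi * I * -(Complex.log A / (2 * Real.pi * I))) * A = 1 := by
    rw [mul_neg, mul_div_cancel₀ _ Complex.two_pi_I_ne_zero, Complex.exp_neg,
      Complex.exp_log hA, inv_mul_cancel₀ hA]
  rwa [e] at h

theorem swap_mem {τ : ℍ} {m : ℕ} {P : ProjFun × ProjFun} (hP : P ∈ pairDomain τ m) {ν : ℂ}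
    (hν : expMul ν P.2 ∈ projThetaFirst τ m 1) :
    (expMul ν P.2, expMul ν P.1) ∈ pairDomain τ m := by
  obtain ⟨h1, h2, h3⟩ := hP
  have h4 := expMul_mem ν h1
  rw [mul_one] at h4
  refine ⟨hν, ⟨_, Complex.exp_ne_zero _, h4⟩, fun h5 => h3 ?_⟩
  have e := projThetaFirst_unique h4 h5
  obtain ⟨A, hA, hgA⟩ := h2
  have h6 := projThetaFirst_unique (expMul_mem ν hgA) hν
  rw [e, one_mul] at h6
  rwa [h6] at hgA

/-- `(f, g) ↦ (exp (2πiνx) g, exp (2πiνx) f)`, where `ν` is such that `exp (2πiνx) g` has first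
multiplier `1`. -/
def swapPair {τ : ℍ} {m : ℕ} (P : pairDomain τ m) : pairDomain τ m :=
  ⟨_, swap_mem P.2 (exists_shift P.2.2.1).choose_spec⟩

theorem swapPair_eq {τ : ℍ} {m : ℕ} (P : pairDomain τ m) {ν : ℂ}
    (hν : expMul ν P.1.2 ∈ projThetaFirst τ m 1) :
    pairSetoid τ m (swapPair P) ⟨_, swap_mem P.2 hν⟩ := by
  set c := (exists_shift P.2.2.1).choose with hc
  have hcs : expMul c P.1.2 ∈ projThetaFirst τ m 1 := (exists_shift P.2.2.1).choose_spec
  have h := expMul_mem (ν - c) hcs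
  rw [← expMul_add, sub_add_cancel] at h
  have e := projThetaFirst_unique h hν
  rw [mul_one] at e
  obtain ⟨k, hk⟩ := Complex.exp_eq_one_iff.1 e
  have hk' : ν - c = k :=
    mul_left_cancel₀ Complex.two_pi_I_ne_zero (by rw [hk]; ring)
  have hν' : ν = k + c := by rw [← hk']; ring
  refine ⟨k, ?_, ?_⟩
  · change expMul ν P.1.2 = expMul k (expMul c P.1.2)
    rw [← expMul_add, hν']
  · change expMul ν P.1.1 = expMul k (expMul c P.1.1)
    rw [← expMul_add, hν']

/-- The analytic involution on `(P_{m,1} × (P_m - P_{m,1})) / ℤ`. -/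
def analyticInvolution {τ : ℍ} {m : ℕ} : PairQuot τ m → PairQuot τ m :=
  Quotient.map swapPair (by
    rintro P Q ⟨k, h1, h2⟩
    obtain ⟨ν, hν⟩ := exists_shift P.2.2.1
    have hQ : expMul ν Q.1.2 ∈ projThetaFirst τ m 1 := by
      rw [h2, ← expMul_add, add_comm, expMul_add]
      exact (expMul_int_mem_iff k).2 hν
    refine (pairSetoid τ m).trans (swapPair_eq P hν)
      ((pairSetoid τ m).trans ?_ ((pairSetoid τ m).symm (swapPair_eq Q hQ)))
    refine ⟨k, ?_, ?_⟩
    · change expMul ν Q.1.2 = expMul k (expMul ν P.1.2)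
      rw [h2, ← expMul_add, ← expMul_add, add_comm]
    · change expMul ν Q.1.1 = expMul k (expMul ν P.1.1)
      rw [h1, ← expMul_add, ← expMul_add, add_comm])

/-- Neither `f` nor `g` has a common zero with `Wr(f, g)`. -/
def GenericBoth (P : ProjFun × ProjFun) : Prop :=
  (∀ x, P.1.rep x = 0 → wronskian P.1.rep P.2.rep x ≠ 0) ∧
    ∀ x, P.2.rep x = 0 → wronskian P.1.rep P.2.rep x ≠ 0

/-- `Pairs_m`: the points of `(P_{m,1} × (P_m - P_{m,1})) / ℤ` with generic first and second
coordinates. -/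
def pairsGeneric (τ : ℍ) (m : ℕ) : Set (PairQuot τ m) :=
  {p | ∃ P : pairDomain τ m, GenericBoth P.1 ∧ Quotient.mk (pairSetoid τ m) P = p}

/-! ### Bethe ansatz equations -/

/-- Solutions `(μ, t, z)` of the Bethe ansatz equations
`2πiμ + 2 ∑_{k ≠ j} ρ(t_j - t_k) - ∑_a ρ(t_j - z_a) = 0`, `j = 1, …, m`, all of whose terms are
finite. -/
structure BetheSolution (τ : ℍ) (m : ℕ) where
  mu : ℂ
  t : Fin m → ℂ
  z : Fin (2 * m) → ℂ
  t_distinct : ∀ i j, i ≠ j → t i - t j ∉ lattice τ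
  t_ne_z : ∀ i a, t i - z a ∉ lattice τ
  bethe : ∀ j, 2 * Real.pi * I * mu + 2 * ∑ k ∈ Finset.univ.erase j, rho τ (t j - t k)
    - ∑ a, rho τ (t j - z a) = 0

/-- The elementary transformations of solutions: permutations of the `t_j` and of the `z_a`
(solutions are points of `ℂ × ℂ^m/S_m × ℂ^{2m}/S_{2m}`), and the shifts
`(μ, t_j) ↦ (μ - 2, t_j + τ)`, `t_j ↦ t_j + 1`, `(μ, z_a) ↦ (μ + 1, z_a + τ)`,
`z_a ↦ z_a + 1`. -/
inductive BetheMove {τ : ℍ} {m : ℕ} (S S' : BetheSolution τ m) : Prop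
  | perm (σ : Equiv.Perm (Fin m)) (π : Equiv.Perm (Fin (2 * m)))
      (hmu : S'.mu = S.mu) (ht : S'.t = S.t ∘ σ) (hz : S'.z = S.z ∘ π)
  | shift_t_tau (j : Fin m) (hmu : S'.mu = S.mu - 2)
      (ht : S'.t = Function.update S.t j (S.t j + τ)) (hz : S'.z = S.z)
  | shift_t_one (j : Fin m) (hmu : S'.mu = S.mu)
      (ht : S'.t = Function.update S.t j (S.t j + 1)) (hz : S'.z = S.z)
  | shift_z_tau (a : Fin (2 * m)) (hmu : S'.mu = S.mu + 1)
      (ht : S'.t = S.t) (hz : S'.z = Function.update S.z a (S.z a + τ))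
  | shift_z_one (a : Fin (2 * m)) (hmu : S'.mu = S.mu)
      (ht : S'.t = S.t) (hz : S'.z = Function.update S.z a (S.z a + 1))

/-- Equivalence classes of solutions, under the equivalence relation generated by the
elementary transformations. -/
def BetheClass (τ : ℍ) (m : ℕ) : Type :=
  Quotient (Relation.EqvGen.setoid (BetheMove (τ := τ) (m := m)))

/-- The class `c` contains the solution `(μ, t, z)`. -/
def BetheClass.Contains {τ : ℍ} {m : ℕ} (c : BetheClass τ m) (μ : ℂ) (t : Fin m → ℂ)
    (z : Fin (2 * m) → ℂ) : Prop :=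
  ∃ S : BetheSolution τ m, S.mu = μ ∧ S.t = t ∧ S.z = z ∧
    Quotient.mk (Relation.EqvGen.setoid (BetheMove (τ := τ) (m := m))) S = c

/-- `B(μ, z)`: the classes of solutions with a representative `(μ, t, z)` such that all
coordinates of `t` lie in the fundamental parallelogram with corner `w`. -/
def betheSet (τ : ℍ) (w : ℂ) (m : ℕ) (μ : ℂ) (z : Fin (2 * m) → ℂ) : Set (BetheClass τ m) :=
  {c | ∃ t : Fin m → ℂ, (∀ j, t j ∈ parallelogram τ w) ∧ c.Contains μ t z}

/-- The graph of the correspondence `β` between classes of solutions with `μ ∉ ℤ` and points of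
`(P_{m,1} × (P_m - P_{m,1})) / ℤ`: the class of `(μ, t, z)` corresponds to the class of `(f, g)`,
where `f = ∏_j θ(x - t_j)` and `Wr(f, g) = exp (-2πiμx) ∏_a θ(x - z_a)`. -/
def Corresponds {τ : ℍ} {m : ℕ} (c : BetheClass τ m) (p : PairQuot τ m) : Prop :=
  ∃ (μ : ℂ) (t : Fin m → ℂ) (z : Fin (2 * m) → ℂ) (P : pairDomain τ m),
    (∀ k : ℤ, μ ≠ k) ∧ c.Contains μ t z ∧ Quotient.mk (pairSetoid τ m) P = p ∧
      P.1.1 = thetaPoint τ 0 t ∧ WronskianEq P.1.1 P.1.2 (thetaPoint τ (-μ) z)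

/-- The graph of the involution `β⁻¹ ∘ ι_an ∘ β` on `Sol_m = β⁻¹(Pairs_m)`. -/
def BetheInvolution {τ : ℍ} {m : ℕ} (c c' : BetheClass τ m) : Prop :=
  ∃ p ∈ pairsGeneric τ m, Corresponds c p ∧ Corresponds c' (analyticInvolution p)

end

end EllipticBethe

namespace EllipticBethe

noncomputable section

open Complex Filter Topology
open scoped UpperHalfPlane

/-! ### Analytic properties of theta -/

/-! Write f = ∏ θ(x - t_j), g = exp (2πiνx) ∏ θ(x - s_j) and h = exp (-2πiμx) ∏ θ(x - z_a). The
equation Wr(f, g) = C h says (g / f)' = C h / f², and the Bethe ansatz equations say that h / f² has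
no residue at any t_j. A Bethe solution t should therefore be the same thing as a solution (f, g) of
the Wronskian equation. Since the Wronskian is antisymmetric, exchanging f and g after
multiplication by exp (2πiμx) turns solutions for μ into solutions for -μ. The theorem combines this
symmetry with a count.

From Bethe to Wronskian (`exists_partner`): g is found by interpolation at the t_j, so that h -
Wr(f, g) is divisible by f². The quotient has degree 0 and is then shown to vanish, or is absorbed
into g.

From Wronskian to Bethe, for large μ: quasi-periodicity gives ν = -μ + n with n bounded. Divided by
-2πiμ exp (-2πiμx), the equation becomes f g̃ + O(1/μ) = const ∏ θ(x - z_a), where g̃ = exp (2πinx)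
∏ θ(x - s_j). By compactness the zeros of f and g together are close to the z_a, each used once
(`exists_localization`). Closeness forces ν = -μ and excludes degenerate positions, so t and s solve
the Bethe equations for μ and -μ respectively (`exists_threshold`).

The count: near an m-element subset of the z_a put t_j = z_(a j) + u_j. Multiplied by u_j, the Bethe
equations read u = ε Ψ(u) with ε = 1/(2πiμ) and Ψ of class C¹ near 0, and contraction gives exactly
one small solution (`exists_unique_near`). With localization, the classes correspond to the
m-element subsets (`ncard_betheSet`).

It remains to translate between classes and functions. Equivalence of solutions is equality of theta
products up to an exponential (`eqvGen_iff_thetaEquiv`), and in a pair the second factor is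
determined by the first and the Wronskian (`pairDomain_snd_unique`). -/

theorem summable_mul_pow {q : ℂ} (hq : ‖q‖ < 1) (z : ℂ) : Summable fun j : ℕ => ‖-(z * q ^ j)‖ := by
  simp only [norm_neg, norm_mul, norm_pow]
  exact (summable_geometric_of_lt_one (norm_nonneg _) hq).mul_left _

theorem multipliable_qPoch {q : ℂ} (hq : ‖q‖ < 1) (z : ℂ) :
    Multipliable fun j : ℕ => (1 - z * q ^ j) := by
  simpa only [sub_eq_add_neg] using
    multipliable_one_add_of_summable (f := fun j : ℕ => -(z * q ^ j)) (summable_mul_pow hq z)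

theorem qPoch_eq_mul {q : ℂ} (hq : ‖q‖ < 1) (z : ℂ) : qPoch z q = (1 - z) * qPoch (z * q) q := by
  have e : (fun j : ℕ => 1 - z * q * q ^ j) = fun j => 1 - z * q ^ (j + 1) := by
    funext j; rw [pow_succ']; ring
  have h := multipliable_qPoch hq (z * q)
  rw [e] at h
  have h0 := _root_.tprod_eq_zero_mul' (f := fun j : ℕ => 1 - z * q ^ j) h
  simp only [pow_zero, mul_one] at h0
  exact h0.trans (congrArg (fun F : ℕ → ℂ => (1 - z) * ∏' j, F j) e.symm)

theorem differentiable_qPoch {q : ℂ} (hq : ‖q‖ < 1) : Differentiable ℂ fun z => qPoch z q := by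
  have h : HasProdLocallyUniformlyOn (fun (j : ℕ) z => 1 - z * q ^ j) (fun z => qPoch z q)
      (Set.univ : Set ℂ) := by
    simp_rw [qPoch, sub_eq_add_neg]
    apply hasProdLocallyUniformlyOn_of_forall_compact isOpen_univ
    intro K _ hcK
    obtain ⟨R, hR⟩ := hcK.exists_bound_of_continuousOn (f := fun z : ℂ => z) continuousOn_id
    refine ((summable_geometric_of_lt_one (norm_nonneg q) hq).mul_left
      R).hasProdUniformlyOn_nat_one_add hcK (.of_forall fun n x hx ↦ ?_) (fun _ ↦ by fun_prop)
    simpa using mul_le_mul_of_nonneg_right (hR x hx) (pow_nonneg (norm_nonneg q) n)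
  exact differentiableOn_univ.1 (h.differentiableOn
    (.of_forall fun _ ↦ by simpa [Finset.prod_fn] using
      DifferentiableOn.finsetProd (fun _ _ ↦ by fun_prop)) isOpen_univ)

/-- Isolating the one factor that vanishes at x = 0 leaves two q-products which x ↦ -x interchanges.
The simple zero, the oddness and the shift by τ are all read off from this form. -/
theorem theta_eq (τ : ℍ) (x : ℂ) : theta τ x = (1 - exp (2 * Real.pi * I * x)) *
    (-(exp (-(Real.pi * I * x)) / (2 * Real.pi * I)) *
    qPoch (exp (2 * Real.pi * I * x) * exp (2 * Real.pi * I * τ)) (exp (2 * Real.pi * I * τ)) *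
    qPoch (exp (2 * Real.pi * I * τ) * exp (-(2 * Real.pi * I * x))) (exp (2 * Real.pi * I * τ)) *
    (qPoch (exp (2 * Real.pi * I * τ)) (exp (2 * Real.pi * I * τ)) ^ 2)⁻¹) := by
  rw [theta, qPoch_eq_mul (norm_nome_lt_one τ) (exp (2 * Real.pi * I * x)), exp_neg
    (2 * Real.pi * I * x), div_eq_mul_inv (exp (2 * Real.pi * I * τ))]
  ring

theorem differentiable_theta (τ : ℍ) : Differentiable ℂ (theta τ) := by
  have h := differentiable_qPoch (norm_nome_lt_one τ)
  have e : theta τ = _ := funext (theta_eq τ)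
  rw [e]
  have h1 : Differentiable ℂ fun x : ℂ => qPoch (exp (2 * Real.pi * I * x) *
      exp (2 * Real.pi * I * τ)) (exp (2 * Real.pi * I * τ)) :=
    h.comp (g := fun z => qPoch z (exp (2 * Real.pi * I * τ))) (by fun_prop)
  have h2 : Differentiable ℂ fun x : ℂ => qPoch (exp (2 * Real.pi * I * τ) *
      exp (-(2 * Real.pi * I * x))) (exp (2 * Real.pi * I * τ)) :=
    h.comp (g := fun z => qPoch z (exp (2 * Real.pi * I * τ))) (by fun_prop)
  fun_prop

theorem exp_ne_zero_inv (x : ℂ) : exp (-(2 * Real.pi * I * x)) * exp (2 * Real.pi * I * x) = 1 := by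
  rw [← exp_add]; simp

theorem theta_neg (τ : ℍ) (x : ℂ) : theta τ (-x) = -theta τ x := by
  rw [theta_eq, theta_eq]
  have e1 : 2 * Real.pi * I * -x = -(2 * Real.pi * I * x) := by ring
  have e2 : exp (-(Real.pi * I * -x)) = exp (-(Real.pi * I * x)) * exp (2 * Real.pi * I * x) := by
    rw [← exp_add]; congr 1; ring
  rw [e1, neg_neg, e2, mul_comm (exp (2 * Real.pi * I * τ)) (exp (2 * Real.pi * I * x)),
    mul_comm (exp (2 * Real.pi * I * τ)) (exp (-(2 * Real.pi * I * x)))]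
  linear_combination (-(exp (-(Real.pi * I * x)) / (2 * Real.pi * I)) *
    qPoch (exp (2 * Real.pi * I * x) * exp (2 * Real.pi * I * τ)) (exp (2 * Real.pi * I * τ)) *
    qPoch (exp (-(2 * Real.pi * I * x)) * exp (2 * Real.pi * I * τ)) (exp (2 * Real.pi * I * τ)) *
    (qPoch (exp (2 * Real.pi * I * τ)) (exp (2 * Real.pi * I * τ)) ^ 2)⁻¹) *
      (-exp_ne_zero_inv x)

theorem theta_zero (τ : ℍ) : theta τ 0 = 0 := by simp [theta_eq]

theorem theta_add_one (τ : ℍ) (x : ℂ) : theta τ (x + 1) = -theta τ x := by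
  have e1 : exp (2 * Real.pi * I * (x + 1)) = exp (2 * Real.pi * I * x) := by
    rw [mul_add, exp_add, mul_one, exp_two_pi_mul_I, mul_one]
  have e2 : exp (-(Real.pi * I * (x + 1))) = -exp (-(Real.pi * I * x)) := by
    have : -(Real.pi * I * (x + 1)) = -(Real.pi * I * x) + -(Real.pi * I) := by ring
    rw [this, exp_add, exp_neg (Real.pi * I), exp_pi_mul_I]
    simp
  rw [theta, theta, e1, e2]
  ring

theorem theta_add_tau (τ : ℍ) (x : ℂ) :
    theta τ (x + τ) = -exp (-(Real.pi * I * τ) - 2 * Real.pi * I * x) * theta τ x := by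
  have hq := norm_nome_lt_one τ
  have e1 : exp (2 * Real.pi * I * (x + τ)) =
      exp (2 * Real.pi * I * x) * exp (2 * Real.pi * I * τ) := by
    rw [mul_add, exp_add]
  have e2 : exp (-(Real.pi * I * (x + τ))) =
      exp (-(Real.pi * I * x)) * exp (-(Real.pi * I * τ)) := by
    rw [← exp_add]; congr 1; ring
  have e3 : exp (-(Real.pi * I * τ) - 2 * Real.pi * I * x) =
      exp (-(Real.pi * I * τ)) * exp (-(2 * Real.pi * I * x)) := by
    rw [← exp_add]; congr 1
  have e4 : exp (2 * Real.pi * I * τ) / (exp (2 * Real.pi * I * x) * exp (2 * Real.pi * I * τ)) =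
      exp (-(2 * Real.pi * I * x)) := by
    rw [exp_neg]; field_simp [exp_ne_zero]
  rw [theta, theta_eq, e1, e2, e3, e4, qPoch_eq_mul hq (exp (-(2 * Real.pi * I * x))),
    mul_comm (exp (-(2 * Real.pi * I * x))) (exp (2 * Real.pi * I * τ))]
  linear_combination (-(exp (-(Real.pi * I * x)) * exp (-(Real.pi * I * τ)) / (2 * Real.pi * I)) *
    qPoch (exp (2 * Real.pi * I * x) * exp (2 * Real.pi * I * τ)) (exp (2 * Real.pi * I * τ)) *
    qPoch (exp (2 * Real.pi * I * τ) * exp (-(2 * Real.pi * I * x))) (exp (2 * Real.pi * I * τ)) *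
    (qPoch (exp (2 * Real.pi * I * τ)) (exp (2 * Real.pi * I * τ)) ^ 2)⁻¹) *
      (-exp_ne_zero_inv x)

/-- In `theta_eq` the factor 1 - exp (2πix) has derivative -2πi at its zero and the cofactor does
not vanish. Later arguments need only this, not the value 1. -/
theorem deriv_theta_zero_ne_zero (τ : ℍ) : deriv (theta τ) 0 ≠ 0 := by
  have hq := norm_nome_lt_one τ
  have hqq : qPoch (exp (2 * Real.pi * I * τ)) (exp (2 * Real.pi * I * τ)) ≠ 0 := by
    refine qPoch_ne_zero hq fun j hj => ?_
    have hn : ‖exp (2 * Real.pi * I * τ)‖ ^ (j + 1) = 1 := by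
      rw [pow_succ', ← norm_pow, ← norm_mul, hj, norm_one]
    exact (pow_lt_one₀ (norm_nonneg _) hq (Nat.succ_ne_zero j)).ne hn
  have h := differentiable_qPoch hq
  have h1 : Differentiable ℂ fun x : ℂ => qPoch (exp (2 * Real.pi * I * x) *
      exp (2 * Real.pi * I * τ)) (exp (2 * Real.pi * I * τ)) :=
    h.comp (g := fun z => qPoch z (exp (2 * Real.pi * I * τ))) (by fun_prop)
  have h2 : Differentiable ℂ fun x : ℂ => qPoch (exp (2 * Real.pi * I * τ) *
      exp (-(2 * Real.pi * I * x))) (exp (2 * Real.pi * I * τ)) :=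
    h.comp (g := fun z => qPoch z (exp (2 * Real.pi * I * τ))) (by fun_prop)
  have hE : DifferentiableAt ℂ (fun x : ℂ => (-(exp (-(Real.pi * I * x)) / (2 * Real.pi * I)) *
    qPoch (exp (2 * Real.pi * I * x) * exp (2 * Real.pi * I * τ)) (exp (2 * Real.pi * I * τ)) *
    qPoch (exp (2 * Real.pi * I * τ) * exp (-(2 * Real.pi * I * x))) (exp (2 * Real.pi * I * τ)) *
    (qPoch (exp (2 * Real.pi * I * τ)) (exp (2 * Real.pi * I * τ)) ^ 2)⁻¹)) 0 := by fun_prop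
  have hA : HasDerivAt (fun x : ℂ => 1 - exp (2 * Real.pi * I * x)) (-(2 * Real.pi * I)) 0 := by
    have := ((hasDerivAt_id (0 : ℂ)).const_mul (2 * Real.pi * I)).cexp.const_sub 1
    simpa using this
  have e : theta τ = _ := funext (theta_eq τ)
  rw [e, (hA.fun_mul hE.hasDerivAt).deriv]
  simp [hqq, I_ne_zero, Real.pi_ne_zero]

/-! ### The lattice -/

theorem zero_mem_lattice (τ : ℍ) : (0 : ℂ) ∈ lattice τ := ⟨0, 0, by simp⟩

theorem one_mem_lattice (τ : ℍ) : (1 : ℂ) ∈ lattice τ := ⟨1, 0, by simp⟩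

theorem tau_mem_lattice (τ : ℍ) : (τ : ℂ) ∈ lattice τ := ⟨0, 1, by simp⟩

theorem lattice_add {τ : ℍ} {x y : ℂ} (hx : x ∈ lattice τ) (hy : y ∈ lattice τ) :
    x + y ∈ lattice τ := by
  obtain ⟨a, b, rfl⟩ := hx
  obtain ⟨c, d, rfl⟩ := hy
  exact ⟨a + c, b + d, by push_cast; ring⟩

theorem lattice_neg {τ : ℍ} {x : ℂ} (hx : x ∈ lattice τ) : -x ∈ lattice τ := by
  obtain ⟨a, b, rfl⟩ := hx
  exact ⟨-a, -b, by push_cast; ring⟩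

theorem lattice_sub {τ : ℍ} {x y : ℂ} (hx : x ∈ lattice τ) (hy : y ∈ lattice τ) :
    x - y ∈ lattice τ := by
  rw [sub_eq_add_neg]; exact lattice_add hx (lattice_neg hy)

/-- A property of complex numbers invariant under `x ↦ x + 1` and `x ↦ x + τ` is invariant under
the lattice. -/
theorem lattice_invariant {τ : ℍ} {p : ℂ → Prop} (h1 : ∀ x, p (x + 1) ↔ p x)
    (h2 : ∀ x, p (x + τ) ↔ p x) {l : ℂ} (hl : l ∈ lattice τ) (x : ℂ) : p (x + l) ↔ p x := by
  have key : ∀ (u : ℂ), (∀ x, p (x + u) ↔ p x) → ∀ (n : ℤ) (x : ℂ), p (x + n * u) ↔ p x := by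
    intro u hu n
    induction n using Int.induction_on with
    | zero => simp
    | succ n ih =>
      intro x
      have := hu (x + n * u)
      rw [show x + ((n + 1 : ℤ) : ℂ) * u = x + n * u + u by push_cast; ring, this]
      exact ih x
    | pred n ih =>
      intro x
      have := hu (x + ((-n - 1 : ℤ) : ℂ) * u)
      rw [← this, show x + ((-n - 1 : ℤ) : ℂ) * u + u = x + ((-n : ℤ) : ℂ) * u by
        push_cast; ring]
      exact ih x
  obtain ⟨k, n, rfl⟩ := hl
  have := key 1 h1 k x
  rw [mul_one] at this
  rw [← this, ← add_assoc, key τ h2 n]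

theorem theta_eq_zero_iff {τ : ℍ} {x : ℂ} : theta τ x = 0 ↔ x ∈ lattice τ := by
  constructor
  · intro h
    by_contra hx
    exact theta_ne_zero hx h
  · intro hx
    have := lattice_invariant (p := fun y => theta τ y = 0) (fun y => by simp [theta_add_one])
      (fun y => by simp [theta_add_tau, exp_ne_zero]) hx 0
    simpa [theta_zero] using this

/-- A function with `f (x + 1) = c₁ f x` has derivative with the same property. -/
theorem deriv_add_one {f : ℂ → ℂ} {c : ℂ} (h : ∀ x, f (x + 1) = c * f x) (x : ℂ) :
    deriv f (x + 1) = c * deriv f x := by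
  rw [← deriv_comp_add_const, funext h, deriv_const_mul_field]

theorem deriv_theta_add_one (τ : ℍ) (x : ℂ) : deriv (theta τ) (x + 1) = -deriv (theta τ) x := by
  have := deriv_add_one (f := theta τ) (c := -1) (fun x => by simp [theta_add_one]) x
  simpa using this

theorem deriv_theta_add_tau (τ : ℍ) (x : ℂ) : deriv (theta τ) (x + τ) =
    -exp (-(Real.pi * I * τ) - 2 * Real.pi * I * x) *
      (deriv (theta τ) x - 2 * Real.pi * I * theta τ x) := by
  have hE : HasDerivAt (fun x : ℂ => -exp (-(Real.pi * I * τ) - 2 * Real.pi * I * x))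
      (2 * Real.pi * I * exp (-(Real.pi * I * τ) - 2 * Real.pi * I * x)) x := by
    have := (((hasDerivAt_id x).const_mul (2 * Real.pi * I)).const_sub
      (-(Real.pi * I * τ))).cexp.neg
    refine this.congr_deriv ?_
    simp
    ring
  rw [← deriv_comp_add_const, funext (theta_add_tau τ),
    (hE.fun_mul (differentiable_theta τ x).hasDerivAt).deriv]
  ring

/-- The shift by τ mixes θ' with θ, so the property carried along the lattice is the conjunction θ =
0 and θ' ≠ 0. -/
theorem deriv_theta_ne_zero {τ : ℍ} {x : ℂ} (hx : x ∈ lattice τ) : deriv (theta τ) x ≠ 0 := by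
  have key := lattice_invariant (p := fun y => theta τ y = 0 ∧ deriv (theta τ) y ≠ 0)
    (fun y => by simp [theta_add_one, deriv_theta_add_one])
    (fun y => by
      simp only [theta_add_tau, deriv_theta_add_tau, mul_eq_zero, neg_eq_zero, exp_ne_zero,
        false_or, ne_eq]
      refine and_congr_right fun h => ?_
      rw [h, mul_zero, sub_zero]) hx 0
  rw [zero_add] at key
  exact (key.2 ⟨theta_zero τ, deriv_theta_zero_ne_zero τ⟩).2

theorem rho_add_one (τ : ℍ) (x : ℂ) : rho τ (x + 1) = rho τ x := by
  rw [rho, rho, deriv_theta_add_one, theta_add_one, neg_div_neg_eq]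

theorem rho_add_tau {τ : ℍ} {x : ℂ} (hx : x ∉ lattice τ) :
    rho τ (x + τ) = rho τ x - 2 * Real.pi * I := by
  have h := theta_ne_zero hx
  rw [rho, rho, deriv_theta_add_tau, theta_add_tau,
    mul_div_mul_left _ _ (neg_ne_zero.2 (exp_ne_zero _)), sub_div, mul_div_cancel_right₀ _ h]

/-- θ is odd, hence so is θ''. This removes the self-interaction of t_j from f''(t_j) and leaves
only the terms ρ(t_j - t_k). -/
theorem deriv_deriv_theta_zero (τ : ℍ) : deriv (deriv (theta τ)) 0 = 0 := by
  have h : ∀ x, deriv (theta τ) (-x) = deriv (theta τ) x := by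
    intro x
    have h1 : (fun y => theta τ (-y)) = fun y => -theta τ y := funext (theta_neg τ)
    have h2 := congrArg (fun F => deriv F x) h1
    simp only [deriv_comp_neg, deriv.fun_neg] at h2
    exact neg_injective h2
  have h2 := congrArg (fun F => deriv F 0) (funext h)
  simp only [deriv_comp_neg, neg_zero] at h2
  exact self_eq_neg.1 h2.symm

/-! ### Entire functions -/

theorem entire_mul_eq_zero {f g : ℂ → ℂ} (hf : Differentiable ℂ f) (hg : Differentiable ℂ g)
    (h : ∀ x, f x * g x = 0) : f = 0 ∨ g = 0 := by
  have := AnalyticOnNhd.eq_zero_or_eq_zero_of_mul_eq_zero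
    (Complex.analyticOnNhd_univ_iff_differentiable.2 hf)
    (Complex.analyticOnNhd_univ_iff_differentiable.2 hg) (fun x _ => h x) isPreconnected_univ
  exact this.imp (fun h => funext fun x => h x trivial) (fun h => funext fun x => h x trivial)

theorem entire_cancel {f u v : ℂ → ℂ} (hf : Differentiable ℂ f) (hf0 : f ≠ 0)
    (hu : Differentiable ℂ u) (hv : Differentiable ℂ v) (h : ∀ x, f x * u x = f x * v x) :
    u = v := by
  have := (entire_mul_eq_zero hf (hu.sub hv)
    (fun x => by simp only [Pi.sub_apply, mul_sub, h x, sub_self])).resolve_left hf0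
  exact sub_eq_zero.1 this

/-- An entire function vanishing at all zeros of an entire function with simple zeros is divisible
by it. -/
theorem entire_dvd {F R : ℂ → ℂ} (hF : Differentiable ℂ F) (hR : Differentiable ℂ R)
    (h : ∀ x, F x = 0 → deriv F x ≠ 0 ∧ R x = 0) :
    ∃ k : ℂ → ℂ, Differentiable ℂ k ∧ ∀ x, R x = F x * k x := by
  classical
  -- The value at a zero of F is the one given by L'Hôpital's rule. Near such a point k is the
  -- quotient of the two difference quotients, whose denominator does not vanish there.
  let k : ℂ → ℂ := fun x => if F x = 0 then deriv R x / deriv F x else R x / F x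
  refine ⟨k, fun p => ?_, fun x => ?_⟩
  · by_cases hp : F p = 0
    · obtain ⟨hd, hRp⟩ := h p hp
      have d1 : Differentiable ℂ (dslope R p) :=
        differentiableOn_univ.1 ((Complex.differentiableOn_dslope univ_mem).2 hR.differentiableOn)
      have d2 : Differentiable ℂ (dslope F p) :=
        differentiableOn_univ.1 ((Complex.differentiableOn_dslope univ_mem).2 hF.differentiableOn)
      have hne : dslope F p p ≠ 0 := by rwa [dslope_same]
      have hq : DifferentiableAt ℂ (fun x => dslope R p x / dslope F p x) p :=
        (d1 p).fun_div (d2 p) hne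
      refine hq.congr_of_eventuallyEq ?_
      filter_upwards [(d2 p).continuousAt.eventually_ne hne] with x hx
      by_cases hxp : x = p
      · subst hxp
        simp [k, hp]
      · have e1 : R x = (x - p) * dslope R p x := by
          have := sub_smul_dslope R p x
          rw [smul_eq_mul, hRp, sub_zero] at this
          exact this.symm
        have e2 : F x = (x - p) * dslope F p x := by
          have := sub_smul_dslope F p x
          rw [smul_eq_mul, hp, sub_zero] at this
          exact this.symm
        have hxp' : x - p ≠ 0 := sub_ne_zero.2 hxp
        have hFx : F x ≠ 0 := by rw [e2]; exact mul_ne_zero hxp' hx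
        simp only [k, if_neg hFx]
        rw [e1, e2, mul_div_mul_left _ _ hxp']
    · have hq : DifferentiableAt ℂ (fun x => R x / F x) p := (hR p).fun_div (hF p) hp
      refine hq.congr_of_eventuallyEq ?_
      filter_upwards [(hF p).continuousAt.eventually_ne hp] with x hx
      simp [k, hx]
  · by_cases hx : F x = 0
    · rw [hx, zero_mul, (h x hx).2]
    · simp only [k, if_neg hx]
      rw [mul_div_cancel₀ _ hx]

/-! ### Parallelograms -/

theorem exists_lattice_add_mem_parallelogram (τ : ℍ) (w x : ℂ) :
    ∃ l ∈ lattice τ, x + l ∈ parallelogram τ w := by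
  have hτ : τ.im ≠ 0 := τ.im_pos.ne'
  set b : ℝ := (x - w).im / τ.im with hb
  set a : ℝ := (x - w).re - b * τ.re with ha
  have hx : x - w = a + b * (τ : ℂ) := by
    apply Complex.ext
    · simp [ha]
    · simp [hb, hτ]
  refine ⟨((-⌊a⌋ : ℤ) : ℂ) + ((-⌊b⌋ : ℤ) : ℂ) * τ, ⟨_, _, rfl⟩, Int.fract a, Int.fract b,
    Int.fract_nonneg a, Int.fract_lt_one a, Int.fract_nonneg b, Int.fract_lt_one b, ?_⟩
  rw [← Int.self_sub_floor, ← Int.self_sub_floor]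
  push_cast
  linear_combination hx

theorem real_add_mul_tau_inj {τ : ℍ} {a b c d : ℝ} (h : (a : ℂ) + b * τ = c + d * τ) :
    a = c ∧ b = d := by
  have hτ : τ.im ≠ 0 := τ.im_pos.ne'
  have h1 := congrArg Complex.im h
  simp [hτ] at h1
  subst h1
  have h2 := add_right_cancel h
  exact ⟨by exact_mod_cast h2, rfl⟩

theorem eq_of_mem_parallelogram {τ : ℍ} {w x y : ℂ} (hx : x ∈ parallelogram τ w)
    (hy : y ∈ parallelogram τ w) (h : x - y ∈ lattice τ) : x = y := by
  obtain ⟨a, b, ha, ha', hb, hb', rfl⟩ := hx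
  obtain ⟨c, d, hc, hc', hd, hd', rfl⟩ := hy
  obtain ⟨k, l, h⟩ := h
  obtain ⟨h1, h2⟩ := real_add_mul_tau_inj (τ := τ) (a := a - c) (b := b - d) (c := k) (d := l)
    (by push_cast; linear_combination h)
  have e1 : k = 0 := by
    have u1 : (k : ℝ) < 1 := by linarith
    have u2 : (-1 : ℝ) < k := by linarith
    have : k < 1 := by exact_mod_cast u1
    have : -1 < k := by exact_mod_cast u2
    omega
  have e2 : l = 0 := by
    have u1 : (l : ℝ) < 1 := by linarith
    have u2 : (-1 : ℝ) < l := by linarith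
    have : l < 1 := by exact_mod_cast u1
    have : -1 < l := by exact_mod_cast u2
    omega
  subst e1 e2
  have := sub_eq_zero.1 (h1.trans Int.cast_zero)
  have := sub_eq_zero.1 (h2.trans Int.cast_zero)
  subst_vars
  rfl

/-- The closed parallelogram with vertices `w, w + 1, w + τ, w + 1 + τ`. -/
def closedParallelogram (τ : ℍ) (w : ℂ) : Set ℂ :=
  (fun p : ℝ × ℝ => w + p.1 + p.2 * (τ : ℂ)) '' (Set.Icc 0 1 ×ˢ Set.Icc 0 1)

theorem isCompact_closedParallelogram (τ : ℍ) (w : ℂ) : IsCompact (closedParallelogram τ w) :=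
  (isCompact_Icc.prod isCompact_Icc).image (by fun_prop)

theorem parallelogram_subset_closed (τ : ℍ) (w : ℂ) :
    parallelogram τ w ⊆ closedParallelogram τ w := by
  rintro x ⟨a, b, ha, ha', hb, hb', rfl⟩
  exact ⟨(a, b), ⟨⟨ha, ha'.le⟩, ⟨hb, hb'.le⟩⟩, rfl⟩

theorem openParallelogram_subset (τ : ℍ) (w : ℂ) :
    openParallelogram τ w ⊆ parallelogram τ w := by
  rintro x ⟨a, b, ha, ha', hb, hb', rfl⟩
  exact ⟨a, b, ha.le, ha', hb.le, hb', rfl⟩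

/-- The real coordinates differ by integers of absolute value less than 1, one point being interior.
This is where the z_a must avoid the boundary: limits of the t_j and s_j are only known to lie in
the closed parallelogram. -/
theorem eq_of_mem_closed_of_mem_open {τ : ℍ} {w x y : ℂ} (hx : x ∈ closedParallelogram τ w)
    (hy : y ∈ openParallelogram τ w) (h : x - y ∈ lattice τ) : x = y := by
  obtain ⟨⟨a, b⟩, ⟨⟨ha, ha'⟩, ⟨hb, hb'⟩⟩, rfl⟩ := hx
  obtain ⟨c, d, hc, hc', hd, hd', rfl⟩ := hy
  obtain ⟨k, l, h⟩ := h
  simp only at ha ha' hb hb' h ⊢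
  obtain ⟨h1, h2⟩ := real_add_mul_tau_inj (τ := τ) (a := a - c) (b := b - d) (c := k) (d := l)
    (by push_cast; linear_combination h)
  have e1 : k = 0 := by
    have u1 : (k : ℝ) < 1 := by linarith
    have u2 : (-1 : ℝ) < k := by linarith
    have : k < 1 := by exact_mod_cast u1
    have : -1 < k := by exact_mod_cast u2
    omega
  have e2 : l = 0 := by
    have u1 : (l : ℝ) < 1 := by linarith
    have u2 : (-1 : ℝ) < l := by linarith
    have : l < 1 := by exact_mod_cast u1
    have : -1 < l := by exact_mod_cast u2
    omega
  subst e1 e2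
  have := sub_eq_zero.1 (h1.trans Int.cast_zero)
  have := sub_eq_zero.1 (h2.trans Int.cast_zero)
  subst_vars
  rfl

/-- The open parallelogram is open. -/
theorem isOpen_openParallelogram (τ : ℍ) (w : ℂ) : IsOpen (openParallelogram τ w) := by
  have hτ : τ.im ≠ 0 := τ.im_pos.ne'
  have : openParallelogram τ w = {x : ℂ | 0 < (x - w).re - (x - w).im / τ.im * τ.re} ∩
      {x | (x - w).re - (x - w).im / τ.im * τ.re < 1} ∩ {x | 0 < (x - w).im / τ.im} ∩
      {x | (x - w).im / τ.im < 1} := by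
    ext x
    constructor
    · rintro ⟨a, b, ha, ha', hb, hb', rfl⟩
      have e1 : (w + a + b * (τ : ℂ) - w).im / τ.im = b := by simp [hτ]
      have e2 : (w + a + b * (τ : ℂ) - w).re = a + b * τ.re := by simp; ring
      simp only [Set.mem_inter_iff, Set.mem_ofPred_eq, e1, e2, add_sub_cancel_right]
      exact ⟨⟨⟨ha, ha'⟩, hb⟩, hb'⟩
    · rintro ⟨⟨⟨h1, h2⟩, h3⟩, h4⟩
      refine ⟨_, _, h1, h2, h3, h4, ?_⟩
      apply Complex.ext
      · simp; ring
      · simp [hτ]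
  rw [this]
  refine (((isOpen_lt ?_ ?_).inter (isOpen_lt ?_ ?_)).inter (isOpen_lt ?_ ?_)).inter
    (isOpen_lt ?_ ?_) <;> fun_prop

/-! ### Entire functions with lattice (quasi-)periods -/

/-- f is bounded by its maximum over one compact parallelogram, so Liouville applies. Only the
modulus has to be periodic, which admits multipliers of modulus 1. -/
theorem entire_const_of_norm_periodic {τ : ℍ} {f : ℂ → ℂ} (hf : Differentiable ℂ f)
    (h1 : ∀ x, ‖f (x + 1)‖ = ‖f x‖) (h2 : ∀ x, ‖f (x + τ)‖ = ‖f x‖) (x : ℂ) : f x = f 0 := by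
  obtain ⟨R, hR⟩ := (isCompact_closedParallelogram τ 0).exists_bound_of_continuousOn
    hf.continuous.continuousOn
  refine hf.apply_eq_apply_of_bounded ?_ x 0
  refine (Metric.isBounded_closedBall (x := (0 : ℂ)) (r := R)).subset ?_
  rintro _ ⟨y, rfl⟩
  rw [mem_closedBall_zero_iff]
  obtain ⟨l, hl, hy⟩ := exists_lattice_add_mem_parallelogram τ 0 y
  have := lattice_invariant (p := fun x => ‖f x‖ = ‖f y‖) (fun x => by rw [h1])
    (fun x => by rw [h2]) hl y
  rw [← this.2 rfl]
  exact hR _ (parallelogram_subset_closed τ 0 hy)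

/-- k' is doubly periodic, hence constant, and the two increments of a linear function are
proportional to the periods. The relation b = a τ is the obstruction exploited below. -/
theorem entire_affine {τ : ℍ} {k : ℂ → ℂ} (hk : Differentiable ℂ k) {a b : ℂ}
    (h1 : ∀ x, k (x + 1) = k x + a) (h2 : ∀ x, k (x + τ) = k x + b) :
    b = a * τ ∧ ∀ x, k x = a * x + k 0 := by
  have hd : ∀ x, deriv k x = deriv k 0 := by
    refine entire_const_of_norm_periodic (τ := τ) (hk.contDiff.differentiable_deriv_two)
      (fun x => ?_) (fun x => ?_)
    · rw [← deriv_comp_add_const, funext h1, deriv_add_const]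
    · rw [← deriv_comp_add_const, funext h2, deriv_add_const]
  have hlin : ∀ x, k x = deriv k 0 * x + k 0 := by
    intro x
    have hz : ∀ y, deriv (fun y => k y - deriv k 0 * y) y = 0 := by
      intro y
      have := ((hk y).hasDerivAt.sub ((hasDerivAt_id y).const_mul (deriv k 0))).deriv
      simp only [id, mul_one, hd y, sub_self] at this
      exact this
    have := is_const_of_deriv_eq_zero (f := fun y => k y - deriv k 0 * y) (by fun_prop) hz x 0
    simp only [mul_zero, sub_zero] at this
    linear_combination this
  have e1 := h1 0
  have e2 := h2 0
  rw [hlin, hlin 0] at e1 e2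
  have ea : deriv k 0 = a := by linear_combination e1
  rw [ea] at e2 hlin
  exact ⟨by linear_combination -e2, hlin⟩

/-! ### Theta-polynomials: products, quotients, factorization -/

theorem differentiable_thetaProd (τ : ℍ) (ν : ℂ) {k : ℕ} (t : Fin k → ℂ) :
    Differentiable ℂ (thetaProd τ ν t) := by
  have h := differentiable_theta τ
  have : ∀ j, Differentiable ℂ fun x => theta τ (x - t j) := fun j => by fun_prop
  unfold thetaProd
  exact Differentiable.mul (by fun_prop) (Differentiable.fun_finsetProd fun j _ => this j)

theorem thetaProd_mem (τ : ℍ) (ν : ℂ) {k : ℕ} (t : Fin k → ℂ) :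
    thetaProd τ ν t ∈ thetaSpace τ k (exp (2 * Real.pi * I * ν))
      (exp (2 * Real.pi * I * (ν * τ + ∑ j, t j))) := by
  refine ⟨differentiable_thetaProd τ ν t, fun x => ?_, fun x => ?_⟩
  · have e : ∀ j, theta τ (x + 1 - t j) = -1 * theta τ (x - t j) := fun j => by
      rw [show x + 1 - t j = x - t j + 1 by ring, theta_add_one]; ring
    simp only [thetaProd, e, Finset.prod_mul_distrib, Finset.prod_const, Finset.card_univ,
      Fintype.card_fin, mul_add, exp_add, mul_one]
    ring
  · have e : ∀ j, theta τ (x + τ - t j) = -1 * exp (-(Real.pi * I * τ) - 2 * Real.pi * I * x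
        + 2 * Real.pi * I * t j) * theta τ (x - t j) := fun j => by
      rw [show x + τ - t j = x - t j + τ by ring, theta_add_tau,
        show -(Real.pi * I * τ) - 2 * Real.pi * I * (x - t j) =
          -(Real.pi * I * τ) - 2 * Real.pi * I * x + 2 * Real.pi * I * t j by ring]
      ring
    simp only [thetaProd, e, Finset.prod_mul_distrib, Finset.prod_const, Finset.card_univ,
      Fintype.card_fin, ← exp_sum, Finset.sum_add_distrib, Finset.sum_const, nsmul_eq_mul,
      ← Finset.mul_sum]
    have e2 : exp (2 * Real.pi * I * ν * (x + τ)) * exp (k * (-(Real.pi * I * τ) -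
        2 * Real.pi * I * x) + 2 * Real.pi * I * ∑ j, t j) =
        exp (2 * Real.pi * I * (ν * τ + ∑ j, t j)) *
        exp (-(Real.pi * I * k * τ) - 2 * Real.pi * I * k * x) * exp (2 * Real.pi * I * ν * x) := by
      rw [← exp_add, ← exp_add, ← exp_add]; congr 1; ring
    linear_combination (-1) ^ k * (∏ j, theta τ (x - t j)) * e2

theorem thetaSpace_mul {τ : ℍ} {m n : ℕ} {A B A' B' : ℂ} {f g : ℂ → ℂ}
    (hf : f ∈ thetaSpace τ m A B) (hg : g ∈ thetaSpace τ n A' B') :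
    (fun x => f x * g x) ∈ thetaSpace τ (m + n) (A * A') (B * B') := by
  refine ⟨hf.1.mul hg.1, fun x => ?_, fun x => ?_⟩
  · simp only [hf.2.1, hg.2.1, pow_add]; ring
  · have e : exp (-(Real.pi * I * (m + n : ℕ) * τ) - 2 * Real.pi * I * (m + n : ℕ) * x) =
        exp (-(Real.pi * I * m * τ) - 2 * Real.pi * I * m * x) *
        exp (-(Real.pi * I * n * τ) - 2 * Real.pi * I * n * x) := by
      rw [← exp_add]; push_cast; congr 1; ring
    simp only [hf.2.2, hg.2.2, pow_add, e]; ring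

theorem thetaSpace_quot {τ : ℍ} {m n : ℕ} {A B A' B' : ℂ} {f k R : ℂ → ℂ}
    (hf : f ∈ thetaSpace τ m A B) (hf0 : f ≠ 0) (hA : A ≠ 0) (hB : B ≠ 0)
    (hR : R ∈ thetaSpace τ (m + n) (A * A') (B * B'))
    (hk : Differentiable ℂ k) (h : ∀ x, R x = f x * k x) : k ∈ thetaSpace τ n A' B' := by
  have h1 : ((-1 : ℂ) ^ m) ≠ 0 := pow_ne_zero _ (by norm_num)
  refine ⟨hk, fun x => ?_, fun x => ?_⟩
  · refine congrFun (entire_cancel (u := fun x => k (x + 1)) (v := fun x => A' * (-1) ^ n * k x)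
      hf.1 hf0 (by fun_prop) (by fun_prop) fun x => ?_) x
    have := hR.2.1 x
    rw [h, h, hf.2.1] at this
    refine mul_left_cancel₀ (mul_ne_zero hA h1) ?_
    rw [pow_add] at this
    linear_combination this
  · refine congrFun (entire_cancel (u := fun x => k (x + τ)) (v := fun x => B' * (-1) ^ n *
      exp (-(Real.pi * I * n * τ) - 2 * Real.pi * I * n * x) * k x)
      hf.1 hf0 (by fun_prop) (by fun_prop) fun x => ?_) x
    have := hR.2.2 x
    have e : exp (-(Real.pi * I * (m + n : ℕ) * τ) - 2 * Real.pi * I * (m + n : ℕ) * x) =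
        exp (-(Real.pi * I * m * τ) - 2 * Real.pi * I * m * x) *
        exp (-(Real.pi * I * n * τ) - 2 * Real.pi * I * n * x) := by
      rw [← exp_add]; push_cast; congr 1; ring
    rw [h, h, hf.2.2, e, pow_add] at this
    refine mul_left_cancel₀ (mul_ne_zero (mul_ne_zero hB h1)
      (exp_ne_zero (-(Real.pi * I * m * τ) - 2 * Real.pi * I * m * x))) ?_
    linear_combination this

theorem thetaSpace_unique {τ : ℍ} {m : ℕ} {A B A' B' : ℂ} {f : ℂ → ℂ} (hf0 : f ≠ 0)
    (h : f ∈ thetaSpace τ m A B) (h' : f ∈ thetaSpace τ m A' B') : A = A' ∧ B = B' := by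
  obtain ⟨x, hx⟩ := Function.ne_iff.1 hf0
  have h3 : ((-1 : ℂ) ^ m) ≠ 0 := pow_ne_zero _ (by norm_num)
  refine ⟨mul_right_cancel₀ h3 (mul_right_cancel₀ hx ((h.2.1 x).symm.trans (h'.2.1 x))), ?_⟩
  exact mul_right_cancel₀ h3 (mul_right_cancel₀ (exp_ne_zero _) (mul_right_cancel₀ hx
    ((h.2.2 x).symm.trans (h'.2.2 x))))

theorem thetaSpace_zero_iff {τ : ℍ} {m : ℕ} {A B : ℂ} (hA : A ≠ 0) (hB : B ≠ 0) {f : ℂ → ℂ}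
    (hf : f ∈ thetaSpace τ m A B) {l : ℂ} (hl : l ∈ lattice τ) (x : ℂ) :
    f (x + l) = 0 ↔ f x = 0 :=
  lattice_invariant (p := fun x => f x = 0) (fun x => by simp [hf.2.1, hA])
    (fun x => by simp [hf.2.2, hB, exp_ne_zero]) hl x

theorem thetaSpace_degree_zero {τ : ℍ} {A B : ℂ} (hA : A ≠ 0) (hB : B ≠ 0) {f : ℂ → ℂ}
    (hf : f ∈ thetaSpace τ 0 A B) :
    ∃ ν C : ℂ, ∀ x, f x = C * exp (2 * Real.pi * I * ν * x) := by
  have hτ : τ.im ≠ 0 := τ.im_pos.ne'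
  have hpi : Real.pi ≠ 0 := Real.pi_ne_zero
  obtain ⟨hd, h1, h2⟩ := hf
  simp only [pow_zero, mul_one, Nat.cast_zero, mul_zero, zero_mul, sub_zero, neg_zero,
    exp_zero] at h1 h2
  -- ν is chosen with Im ν = p and Im (ντ) = q, so that exp (2πiνx) has multipliers of the same
  -- moduli as f. The quotient then has periodic modulus and is constant.
  set p : ℝ := -Real.log ‖A‖ / (2 * Real.pi) with hp
  set q : ℝ := -Real.log ‖B‖ / (2 * Real.pi) with hq
  set ν : ℂ := ⟨(q - p * τ.re) / τ.im, p⟩ with hν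
  have n1 : ‖exp (2 * Real.pi * I * ν)‖ = ‖A‖ := by
    rw [norm_exp, ← Real.exp_log (norm_pos_iff.2 hA)]
    congr 1
    simp [hν, hp]
    field_simp
  have n2 : ‖exp (2 * Real.pi * I * ν * τ)‖ = ‖B‖ := by
    rw [norm_exp, ← Real.exp_log (norm_pos_iff.2 hB)]
    congr 1
    simp [hν, hp, hq]
    field_simp
    ring
  have key := entire_const_of_norm_periodic (τ := τ)
    (f := fun x => exp (-(2 * Real.pi * I * ν * x)) * f x) (by fun_prop) (fun x => ?_) (fun x => ?_)
  · refine ⟨ν, f 0, fun x => ?_⟩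
    have := key x
    simp only [mul_zero, neg_zero, exp_zero, one_mul] at this
    rw [← this, exp_neg]
    field_simp [exp_ne_zero]
  · simp only [h1]
    rw [show -(2 * Real.pi * I * ν * (x + 1)) = -(2 * Real.pi * I * ν * x) +
      -(2 * Real.pi * I * ν) by ring, exp_add, exp_neg (2 * Real.pi * I * ν)]
    simp only [norm_mul, norm_inv, n1]
    have : ‖A‖ ≠ 0 := norm_ne_zero_iff.2 hA
    field_simp
  · simp only [h2]
    rw [show -(2 * Real.pi * I * ν * (x + τ)) = -(2 * Real.pi * I * ν * x) +
      -(2 * Real.pi * I * ν * τ) by ring, exp_add, exp_neg (2 * Real.pi * I * ν * τ)]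
    simp only [norm_mul, norm_inv, n2]
    have : ‖B‖ ≠ 0 := norm_ne_zero_iff.2 hB
    field_simp

/-- The derivative of a theta-polynomial under the shift by `τ`. -/
theorem deriv_thetaSpace_add_tau {τ : ℍ} {m : ℕ} {A B : ℂ} {f : ℂ → ℂ}
    (hf : f ∈ thetaSpace τ m A B) (x : ℂ) :
    deriv f (x + τ) = B * (-1) ^ m * exp (-(Real.pi * I * m * τ) - 2 * Real.pi * I * m * x) *
      (deriv f x - 2 * Real.pi * I * m * f x) := by
  have hE : HasDerivAt (fun x : ℂ => B * (-1) ^ m *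
      exp (-(Real.pi * I * m * τ) - 2 * Real.pi * I * m * x))
      (B * (-1) ^ m * (exp (-(Real.pi * I * m * τ) - 2 * Real.pi * I * m * x) *
        -(2 * Real.pi * I * m))) x := by
    have := (((hasDerivAt_id x).const_mul (2 * Real.pi * I * m)).const_sub
      (-(Real.pi * I * m * τ))).cexp.const_mul (B * (-1) ^ m)
    simpa using this
  rw [← deriv_comp_add_const, funext hf.2.2, (hE.fun_mul (hf.1 x).hasDerivAt).deriv]
  ring

theorem deriv_thetaSpace_add_one {τ : ℍ} {m : ℕ} {A B : ℂ} {f : ℂ → ℂ}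
    (hf : f ∈ thetaSpace τ m A B) (x : ℂ) : deriv f (x + 1) = A * (-1) ^ m * deriv f x :=
  deriv_add_one hf.2.1 x

/-- Without zeros, f'/f would be entire with increments 0 under 1 and -2πi(m+1) under τ,
contradicting `entire_affine`. -/
theorem exists_zero_of_thetaSpace {τ : ℍ} {m : ℕ} {A B : ℂ} (hA : A ≠ 0) (hB : B ≠ 0)
    {f : ℂ → ℂ} (hf : f ∈ thetaSpace τ (m + 1) A B) : ∃ x, f x = 0 := by
  by_contra! hne
  have h3 : ∀ n, ((-1 : ℂ) ^ n) ≠ 0 := fun n => pow_ne_zero _ (by norm_num)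
  have hd : Differentiable ℂ fun x => deriv f x / f x :=
    hf.1.contDiff.differentiable_deriv_two.div hf.1 hne
  have := entire_affine (τ := τ) hd (a := 0) (b := -(2 * Real.pi * I * (m + 1 : ℕ))) (fun x => ?_)
    (fun x => ?_)
  · have h := this.1
    rw [zero_mul, neg_eq_zero] at h
    exact mul_ne_zero Complex.two_pi_I_ne_zero (Nat.cast_ne_zero.2 (Nat.succ_ne_zero m)) h
  · simp only [deriv_thetaSpace_add_one hf, hf.2.1]
    rw [mul_div_mul_left _ _ (mul_ne_zero hA (h3 _)), add_zero]
  · simp only [deriv_thetaSpace_add_tau hf, hf.2.2]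
    rw [mul_div_mul_left _ _ (mul_ne_zero (mul_ne_zero hB (h3 _)) (exp_ne_zero _)), sub_div,
      mul_div_cancel_right₀ _ (hne x), sub_eq_add_neg]

/-- Every nonzero theta-polynomial is a constant multiple of some
`exp (2πiνx) ∏_j θ(x - s_j)` with all `s_j` in a given parallelogram. -/
theorem thetaSpace_factor {τ : ℍ} (w : ℂ) {m : ℕ} {A B : ℂ} (hA : A ≠ 0) (hB : B ≠ 0) {f : ℂ → ℂ}
    (hf : f ∈ thetaSpace τ m A B) (hf0 : f ≠ 0) :
    ∃ (C ν : ℂ) (s : Fin m → ℂ), C ≠ 0 ∧ (∀ j, s j ∈ parallelogram τ w) ∧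
      f = C • thetaProd τ ν s := by
  induction m generalizing A B f with
  | zero =>
    obtain ⟨ν, C, h⟩ := thetaSpace_degree_zero hA hB hf
    refine ⟨C, ν, Fin.elim0, ?_, fun j => j.elim0, ?_⟩
    · rintro rfl
      exact hf0 (funext fun x => by simp [h x])
    · funext x
      simp [h x, thetaProd]
  | succ m ih =>
    obtain ⟨x₀, hx₀⟩ := exists_zero_of_thetaSpace hA hB hf
    obtain ⟨l, hl, hs⟩ := exists_lattice_add_mem_parallelogram τ w x₀
    set s₀ := x₀ + l
    have hs₀ : f s₀ = 0 := (thetaSpace_zero_iff hA hB hf hl x₀).2 hx₀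
    have hT := thetaProd_mem τ 0 (fun _ : Fin 1 => s₀)
    have hT0 := thetaProd_ne_zero τ 0 (fun _ : Fin 1 => s₀)
    have eT : thetaProd τ 0 (fun _ : Fin 1 => s₀) = fun x => theta τ (x - s₀) := by
      funext x; simp [thetaProd]
    rw [eT] at hT hT0
    -- The zeros of θ(x - s₀) are simple and are the lattice translates of s₀, at all of which f
    -- vanishes. The quotient has degree one less.
    obtain ⟨k, hk, hfk⟩ := entire_dvd (F := fun x => theta τ (x - s₀)) (R := f) hT.1 hf.1
      (fun x hx => by
        have hx' := theta_eq_zero_iff.1 hx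
        refine ⟨?_, ?_⟩
        · rw [deriv_comp_sub_const]
          exact deriv_theta_ne_zero hx'
        · have := thetaSpace_zero_iff hA hB hf hx' s₀
          rw [add_sub_cancel] at this
          exact this.2 hs₀)
    have hk' := thetaSpace_quot (τ := τ) (m := 1) (n := m) (f := fun x => theta τ (x - s₀)) (k := k)
      (R := f) (A' := (exp (2 * Real.pi * I * 0))⁻¹ * A)
      (B' := (exp (2 * Real.pi * I * (0 * τ + ∑ j : Fin 1, s₀)))⁻¹ * B) hT hT0 (exp_ne_zero _)
      (exp_ne_zero _) (by
        rw [mul_inv_cancel_left₀ (exp_ne_zero _), mul_inv_cancel_left₀ (exp_ne_zero _), add_comm]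
        exact hf) hk hfk
    obtain ⟨C, ν, s, hC, hs', e⟩ := ih (mul_ne_zero (inv_ne_zero (exp_ne_zero _)) hA)
      (mul_ne_zero (inv_ne_zero (exp_ne_zero _)) hB) hk' (by
        rintro rfl
        exact hf0 (funext fun x => by simp [hfk x]))
    refine ⟨C, ν, Fin.cons s₀ s, hC, fun j => ?_, ?_⟩
    · refine Fin.cases ?_ (fun j => ?_) j
      · simpa using hs
      · simpa using hs' j
    · funext x
      rw [hfk x, e]
      simp only [Pi.smul_apply, smul_eq_mul, thetaProd, Fin.prod_univ_succ, Fin.cons_zero,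
        Fin.cons_succ]
      ring

/-! ### Divisors of theta products -/

theorem analyticOrderAt_theta_sub (τ : ℍ) (a p : ℂ) :
    analyticOrderAt (fun x => theta τ (x - a)) p = open Classical in
      if p - a ∈ lattice τ then 1 else 0 := by
  have hd : Differentiable ℂ fun x => theta τ (x - a) := by
    have := differentiable_theta τ
    fun_prop
  split_ifs with h
  · have h0 : theta τ (p - a) = 0 := theta_eq_zero_iff.2 h
    have := AnalyticAt.analyticOrderAt_sub_eq_one_of_deriv_ne_zero (f := fun x => theta τ (x - a))
      (hd.analyticAt p) (by rw [deriv_comp_sub_const]; exact deriv_theta_ne_zero h)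
    simpa [h0] using this
  · exact (hd.analyticAt p).analyticOrderAt_eq_zero.2 (theta_ne_zero h)

theorem analyticOrderAt_thetaProd (τ : ℍ) (ν : ℂ) {k : ℕ} (t : Fin k → ℂ) (p : ℂ) :
    analyticOrderAt (thetaProd τ ν t) p = open Classical in
      (Fintype.card {j // p - t j ∈ lattice τ} : ℕ∞) := by
  classical
  have hd : ∀ j, AnalyticAt ℂ (fun x => theta τ (x - t j)) p := fun j => by
    have : Differentiable ℂ fun x => theta τ (x - t j) := by
      have := differentiable_theta τ
      fun_prop
    exact this.analyticAt p
  have he : AnalyticAt ℂ (fun x => exp (2 * Real.pi * I * ν * x)) p :=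
    Differentiable.analyticAt (by fun_prop) p
  have hprod : ∀ s : Finset (Fin k), analyticOrderAt (∏ j ∈ s, fun x => theta τ (x - t j)) p =
      ∑ j ∈ s, if p - t j ∈ lattice τ then (1 : ℕ∞) else 0 := by
    intro s
    induction s using Finset.induction_on with
    | empty =>
      simp only [Finset.prod_empty, Finset.sum_empty]
      exact (analyticAt_const (v := (1 : ℂ))).analyticOrderAt_eq_zero.2 one_ne_zero
    | insert j s hj ih =>
      rw [Finset.prod_insert hj, Finset.sum_insert hj, analyticOrderAt_mul (hd j)
        (Finset.analyticAt_prod _ fun j _ => hd j), ih, analyticOrderAt_theta_sub]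
  have e : thetaProd τ ν t = (fun x => exp (2 * Real.pi * I * ν * x)) *
      ∏ j, fun x => theta τ (x - t j) := by
    funext x
    simp [thetaProd]
  rw [e, analyticOrderAt_mul he (Finset.analyticAt_prod _ fun j _ => hd j), hprod,
    he.analyticOrderAt_eq_zero.2 (exp_ne_zero _), zero_add, Fintype.card_subtype,
    Finset.sum_boole]

/-- Theta products that agree up to a constant have the same zeros modulo the lattice. -/
theorem exists_equiv_of_thetaProd_eq {τ : ℍ} {ν ν' C : ℂ} (hC : C ≠ 0) {k k' : ℕ} {a : Fin k → ℂ}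
    {b : Fin k' → ℂ} (h : thetaProd τ ν a = C • thetaProd τ ν' b) :
    ∃ σ : Fin k ≃ Fin k', ∀ i, a i - b (σ i) ∈ lattice τ := by
  classical
  have hord : ∀ p, Fintype.card {j // p - a j ∈ lattice τ} =
      Fintype.card {j // p - b j ∈ lattice τ} := by
    intro p
    have h1 := analyticOrderAt_thetaProd τ ν a p
    have h2 : analyticOrderAt (C • thetaProd τ ν' b) p = analyticOrderAt (thetaProd τ ν' b) p := by
      have e : C • thetaProd τ ν' b = (fun _ => C) * thetaProd τ ν' b := by
        funext x; simp
      rw [e, analyticOrderAt_mul analyticAt_const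
        ((differentiable_thetaProd τ ν' b).analyticAt p),
        (analyticAt_const (v := C)).analyticOrderAt_eq_zero.2 hC, zero_add]
    rw [h, h2, analyticOrderAt_thetaProd] at h1
    exact_mod_cast h1.symm
  let Λ : AddSubgroup ℂ :=
    { carrier := lattice τ
      add_mem' := lattice_add
      zero_mem' := zero_mem_lattice τ
      neg_mem' := lattice_neg }
  let q : ℂ → ℂ ⧸ Λ := QuotientAddGroup.mk
  have hq : ∀ x y, q x = q y ↔ y - x ∈ lattice τ := fun x y => by
    rw [show y - x = -x + y by ring]
    exact QuotientAddGroup.eq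
  -- The order of vanishing at p counts the indices whose zero is congruent to p. Both families thus
  -- meet each class of ℂ/Λ equally often, and bijections between the fibres glue.
  have hf : ∀ c : ℂ ⧸ Λ, Nonempty ({i // q (a i) = c} ≃ {j // q (b j) = c}) := by
    intro c
    obtain ⟨p, rfl⟩ := QuotientAddGroup.mk_surjective c
    refine Fintype.card_eq.1 ?_
    convert hord p using 1
    · exact Fintype.card_congr (Equiv.subtypeEquivRight fun i => hq (a i) p)
    · exact Fintype.card_congr (Equiv.subtypeEquivRight fun i => hq (b i) p)
  refine ⟨Equiv.ofFiberEquiv (f := fun i => q (a i)) (g := fun j => q (b j))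
    fun c => (hf c).some, fun i => ?_⟩
  exact (hq _ _).1 (Equiv.ofFiberEquiv_map (f := fun i => q (a i)) (g := fun j => q (b j))
    (fun c => (hf c).some) i)

/-! ### Wronskians -/

theorem differentiable_deriv {f : ℂ → ℂ} (hf : Differentiable ℂ f) : Differentiable ℂ (deriv f) :=
  hf.contDiff.differentiable_deriv_two

theorem differentiable_wronskian {f g : ℂ → ℂ} (hf : Differentiable ℂ f)
    (hg : Differentiable ℂ g) : Differentiable ℂ (wronskian f g) :=
  (hf.mul (differentiable_deriv hg)).sub ((differentiable_deriv hf).mul hg)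

theorem wronskian_smul (a b : ℂ) (f g : ℂ → ℂ) :
    wronskian (a • f) (b • g) = (a * b) • wronskian f g := by
  funext x
  have h1 : deriv (a • f) x = a * deriv f x := by
    rw [show a • f = fun y => a * f y from rfl, deriv_const_mul_field]
  have h2 : deriv (b • g) x = b * deriv g x := by
    rw [show b • g = fun y => b * g y from rfl, deriv_const_mul_field]
  simp only [wronskian, h1, h2, Pi.smul_apply, smul_eq_mul]
  ring

theorem wronskian_swap (f g : ℂ → ℂ) : wronskian g f = (-1 : ℂ) • wronskian f g := by
  funext x
  simp only [wronskian, Pi.smul_apply, smul_eq_mul]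
  ring

theorem wronskian_add_right {f g g' : ℂ → ℂ} (hg : Differentiable ℂ g) (hg' : Differentiable ℂ g')
    (x : ℂ) : wronskian f (g + g') x = wronskian f g x + wronskian f g' x := by
  simp only [wronskian, deriv_add (hg x) (hg' x), Pi.add_apply]
  ring

theorem hasDerivAt_exp_mul {ν : ℂ} {f : ℂ → ℂ} {f' x : ℂ} (hf : HasDerivAt f f' x) :
    HasDerivAt (fun x => exp (2 * Real.pi * I * ν * x) * f x)
      (exp (2 * Real.pi * I * ν * x) * (2 * Real.pi * I * ν * f x + f')) x := by
  have := ((hasDerivAt_id x).const_mul (2 * Real.pi * I * ν)).cexp.fun_mul hf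
  refine this.congr_deriv ?_
  simp only [id, mul_one]
  ring

theorem wronskian_exp_mul {f g : ℂ → ℂ} (hf : Differentiable ℂ f) (hg : Differentiable ℂ g)
    (ν : ℂ) : wronskian (fun x => exp (2 * Real.pi * I * ν * x) * f x)
      (fun x => exp (2 * Real.pi * I * ν * x) * g x) =
      fun x => exp (2 * Real.pi * I * (2 * ν) * x) * wronskian f g x := by
  funext x
  have e : exp (2 * Real.pi * I * (2 * ν) * x) =
      exp (2 * Real.pi * I * ν * x) * exp (2 * Real.pi * I * ν * x) := by
    rw [← exp_add]; congr 1; ring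
  simp only [wronskian, (hasDerivAt_exp_mul (hf x).hasDerivAt).deriv,
    (hasDerivAt_exp_mul (hg x).hasDerivAt).deriv, e]
  ring

theorem hasDerivAt_wronskian {f g : ℂ → ℂ} (hf : Differentiable ℂ f) (hg : Differentiable ℂ g)
    (x : ℂ) : HasDerivAt (wronskian f g)
      (f x * deriv (deriv g) x - deriv (deriv f) x * g x) x := by
  have h1 := (hf x).hasDerivAt.fun_mul (differentiable_deriv hg x).hasDerivAt
  have h2 := (differentiable_deriv hf x).hasDerivAt.fun_mul (hg x).hasDerivAt
  exact (h1.fun_sub h2).congr_deriv (by ring)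

theorem wronskian_mem {τ : ℍ} {m : ℕ} {A B A' B' : ℂ} {f g : ℂ → ℂ}
    (hf : f ∈ thetaSpace τ m A B) (hg : g ∈ thetaSpace τ m A' B') :
    wronskian f g ∈ thetaSpace τ (2 * m) (A * A') (B * B') := by
  refine ⟨differentiable_wronskian hf.1 hg.1, fun x => ?_, fun x => ?_⟩
  · simp only [wronskian, hf.2.1, hg.2.1, deriv_thetaSpace_add_one hf,
      deriv_thetaSpace_add_one hg, two_mul m, pow_add]
    ring
  · have e : exp (-(Real.pi * I * (2 * m : ℕ) * τ) - 2 * Real.pi * I * (2 * m : ℕ) * x) =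
        exp (-(Real.pi * I * m * τ) - 2 * Real.pi * I * m * x) *
        exp (-(Real.pi * I * m * τ) - 2 * Real.pi * I * m * x) := by
      rw [← exp_add]; push_cast; congr 1; ring
    simp only [wronskian, hf.2.2, hg.2.2, deriv_thetaSpace_add_tau hf,
      deriv_thetaSpace_add_tau hg, e]
    rw [two_mul m, pow_add]
    ring

/-- If `Wr(f, G) = 0` then `G` is proportional to `f`. -/
theorem eq_smul_of_wronskian_eq_zero {f G : ℂ → ℂ} (hf : Differentiable ℂ f)
    (hG : Differentiable ℂ G) (hf0 : f ≠ 0) (h : wronskian f G = 0) : ∃ κ : ℂ, G = κ • f := by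
  obtain ⟨x₀, hx₀⟩ := Function.ne_iff.1 hf0
  have hx₀' : f x₀ ≠ 0 := hx₀
  refine ⟨G x₀ / f x₀, ?_⟩
  obtain ⟨r, hr, hball⟩ := Metric.eventually_nhds_iff_ball.1
    ((hf x₀).continuousAt.eventually_ne hx₀')
  -- The vanishing Wronskian makes G / f constant on a ball where f has no zero; the identity
  -- theorem extends the proportionality to ℂ.
  have hd : DifferentiableOn ℂ (fun x => G x / f x) (Metric.ball x₀ r) := fun x hx =>
    ((hG x).fun_div (hf x) (hball x hx)).differentiableWithinAt
  have hd0 : Set.EqOn (deriv fun x => G x / f x) 0 (Metric.ball x₀ r) := by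
    intro x hx
    have h1 := ((hG x).hasDerivAt.fun_div (hf x).hasDerivAt (hball x hx)).deriv
    have h2 := congrFun h x
    simp only [wronskian, Pi.zero_apply] at h2
    rw [h1, Pi.zero_apply, div_eq_zero_iff]
    left
    linear_combination h2
  have := AnalyticOnNhd.eq_of_eventuallyEq (Complex.analyticOnNhd_univ_iff_differentiable.2 hG)
    (Complex.analyticOnNhd_univ_iff_differentiable.2 (hf.const_smul (G x₀ / f x₀))) (z₀ := x₀)
    (Metric.eventually_nhds_iff_ball.2 ⟨r, hr, fun x hx => by
      have := Metric.isOpen_ball.is_const_of_deriv_eq_zero (convex_ball x₀ r).isPreconnected hd hd0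
        hx (Metric.mem_ball_self hr)
      rw [Pi.smul_apply, smul_eq_mul, ← this, div_mul_cancel₀ _ (hball x hx)]⟩)
  exact this

/-! ### Logarithmic derivatives and the Bethe ansatz equations -/

theorem hasDerivAt_exp_prod_theta (τ : ℍ) (ν : ℂ) {ι : Type*} (S : Finset ι) (t : ι → ℂ) {x : ℂ}
    (hx : ∀ j ∈ S, x - t j ∉ lattice τ) :
    HasDerivAt (fun x => exp (2 * Real.pi * I * ν * x) * ∏ j ∈ S, theta τ (x - t j))
      ((exp (2 * Real.pi * I * ν * x) * ∏ j ∈ S, theta τ (x - t j)) *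
        (2 * Real.pi * I * ν + ∑ j ∈ S, rho τ (x - t j))) x := by
  classical
  have hprod : HasDerivAt (fun x => ∏ j ∈ S, theta τ (x - t j))
      ((∏ j ∈ S, theta τ (x - t j)) * ∑ j ∈ S, rho τ (x - t j)) x := by
    induction S using Finset.induction_on with
    | empty => simpa using hasDerivAt_const x (1 : ℂ)
    | insert j S hj ih =>
      have h1 : HasDerivAt (fun x => theta τ (x - t j)) (deriv (theta τ) (x - t j)) x :=
        (differentiable_theta τ (x - t j)).hasDerivAt.comp_sub_const x (t j)
      have h2 := h1.fun_mul (ih fun i hi => hx i (Finset.mem_insert_of_mem hi))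
      simp only [Finset.prod_insert hj, Finset.sum_insert hj]
      refine h2.congr_deriv ?_
      have h0 := theta_ne_zero (hx j (Finset.mem_insert_self j S))
      have e : deriv (theta τ) (x - t j) = theta τ (x - t j) * rho τ (x - t j) := by
        rw [rho, mul_div_cancel₀ _ h0]
      rw [e]
      ring
  exact (hasDerivAt_exp_mul hprod).congr_deriv (by ring)

/-- The product of all theta factors except the `j`-th. -/
def thetaCofactor (τ : ℍ) {k : ℕ} (t : Fin k → ℂ) (j : Fin k) : ℂ → ℂ :=
  fun x => ∏ i ∈ Finset.univ.erase j, theta τ (x - t i)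

theorem differentiable_thetaCofactor (τ : ℍ) {k : ℕ} (t : Fin k → ℂ) (j : Fin k) :
    Differentiable ℂ (thetaCofactor τ t j) := by
  have h := differentiable_theta τ
  have : ∀ j, Differentiable ℂ fun x => theta τ (x - t j) := fun j => by fun_prop
  exact Differentiable.fun_finsetProd fun j _ => this j

theorem thetaProd_zero_eq (τ : ℍ) {k : ℕ} (t : Fin k → ℂ) (j : Fin k) :
    thetaProd τ 0 t = fun x => theta τ (x - t j) * thetaCofactor τ t j x := by
  funext x
  have := Finset.mul_prod_erase Finset.univ (fun i => theta τ (x - t i)) (Finset.mem_univ j)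
  simp only [thetaProd, thetaCofactor, this, mul_zero, zero_mul, exp_zero, one_mul]

theorem thetaProd_eq_zero_iff {τ : ℍ} {ν : ℂ} {k : ℕ} {t : Fin k → ℂ} {x : ℂ} :
    thetaProd τ ν t x = 0 ↔ ∃ j, x - t j ∈ lattice τ := by
  simp [thetaProd, exp_ne_zero, Finset.prod_eq_zero_iff, theta_eq_zero_iff]

theorem thetaCofactor_ne_zero {τ : ℍ} {k : ℕ} {t : Fin k → ℂ}
    (ht : ∀ i j, i ≠ j → t i - t j ∉ lattice τ) (j : Fin k) {x : ℂ} (hx : x - t j ∈ lattice τ) :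
    thetaCofactor τ t j x ≠ 0 := by
  refine Finset.prod_ne_zero_iff.2 fun i hi => theta_ne_zero fun h => ?_
  refine ht i j (Finset.ne_of_mem_erase hi) ?_
  have := lattice_sub hx h
  rwa [sub_sub_sub_cancel_left] at this

theorem deriv_thetaProd (τ : ℍ) {k : ℕ} (t : Fin k → ℂ) (j : Fin k) :
    deriv (thetaProd τ 0 t) = fun x => deriv (theta τ) (x - t j) * thetaCofactor τ t j x +
      theta τ (x - t j) * deriv (thetaCofactor τ t j) x := by
  funext x
  rw [thetaProd_zero_eq τ t j]
  exact (((differentiable_theta τ (x - t j)).hasDerivAt.comp_sub_const x (t j)).fun_mul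
    (differentiable_thetaCofactor τ t j x).hasDerivAt).deriv

theorem deriv_thetaProd_zero (τ : ℍ) {k : ℕ} (t : Fin k → ℂ) (j : Fin k) :
    deriv (thetaProd τ 0 t) (t j) = deriv (theta τ) 0 * thetaCofactor τ t j (t j) := by
  rw [deriv_thetaProd τ t j]
  simp [theta_zero]

theorem deriv_deriv_thetaProd_zero {τ : ℍ} {k : ℕ} {t : Fin k → ℂ}
    (ht : ∀ i j, i ≠ j → t i - t j ∉ lattice τ) (j : Fin k) :
    deriv (deriv (thetaProd τ 0 t)) (t j) = 2 * (deriv (theta τ) 0 * thetaCofactor τ t j (t j)) *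
      ∑ i ∈ Finset.univ.erase j, rho τ (t j - t i) := by
  have hc : deriv (thetaCofactor τ t j) (t j) =
      thetaCofactor τ t j (t j) * ∑ i ∈ Finset.univ.erase j, rho τ (t j - t i) := by
    have := (hasDerivAt_exp_prod_theta τ 0 (Finset.univ.erase j) t (x := t j)
      fun i hi => ht j i (Finset.ne_of_mem_erase hi).symm).deriv
    simp only [mul_zero, zero_mul, exp_zero, one_mul, zero_add] at this
    exact this
  have h1 := ((differentiable_deriv (differentiable_theta τ) (t j - t j)).hasDerivAt.comp_sub_const
    (t j) (t j)).fun_mul (differentiable_thetaCofactor τ t j (t j)).hasDerivAt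
  have h2 := ((differentiable_theta τ (t j - t j)).hasDerivAt.comp_sub_const
    (t j) (t j)).fun_mul
      (differentiable_deriv (differentiable_thetaCofactor τ t j) (t j)).hasDerivAt
  rw [deriv_thetaProd τ t j, (h1.fun_add h2).deriv]
  simp only [sub_self, deriv_deriv_theta_zero, theta_zero, hc]
  ring

theorem thetaProd_deriv_ne_zero {τ : ℍ} {k : ℕ} {t : Fin k → ℂ}
    (ht : ∀ i j, i ≠ j → t i - t j ∉ lattice τ) {x : ℂ} (hx : thetaProd τ 0 t x = 0) :
    deriv (thetaProd τ 0 t) x ≠ 0 := by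
  obtain ⟨j, hj⟩ := thetaProd_eq_zero_iff.1 hx
  rw [deriv_thetaProd τ t j]
  simp only [theta_eq_zero_iff.2 hj, zero_mul, add_zero]
  exact mul_ne_zero (deriv_theta_ne_zero hj) (thetaCofactor_ne_zero ht j hj)

/-- At t_j one has f''/f' = 2 ∑ ρ(t_j - t_k) and h'/h = -2πiμ + ∑ ρ(t_j - z_a). The Bethe equation
is f''/f' = h'/h with denominators cleared, that is, the vanishing of the residue of h / f² at t_j.
-/
theorem bethe_iff {τ : ℍ} {m n : ℕ} {μ : ℂ} {t : Fin m → ℂ} {z : Fin n → ℂ}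
    (ht : ∀ i j, i ≠ j → t i - t j ∉ lattice τ) (htz : ∀ i a, t i - z a ∉ lattice τ) (j : Fin m) :
    2 * Real.pi * I * μ + 2 * ∑ k ∈ Finset.univ.erase j, rho τ (t j - t k)
      - ∑ a, rho τ (t j - z a) = 0 ↔
    deriv (deriv (thetaProd τ 0 t)) (t j) * thetaProd τ (-μ) z (t j) =
      deriv (thetaProd τ 0 t) (t j) * deriv (thetaProd τ (-μ) z) (t j) := by
  have hh : deriv (thetaProd τ (-μ) z) (t j) = thetaProd τ (-μ) z (t j) *
      (2 * Real.pi * I * (-μ) + ∑ a, rho τ (t j - z a)) :=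
    (hasDerivAt_exp_prod_theta τ (-μ) Finset.univ z (fun a _ => htz j a)).deriv
  have h0 : thetaProd τ (-μ) z (t j) ≠ 0 := fun h => by
    obtain ⟨a, ha⟩ := thetaProd_eq_zero_iff.1 h
    exact htz j a ha
  have h1 : deriv (theta τ) 0 * thetaCofactor τ t j (t j) ≠ 0 :=
    mul_ne_zero (deriv_theta_zero_ne_zero τ)
      (thetaCofactor_ne_zero ht j (by simpa using zero_mem_lattice τ))
  rw [deriv_deriv_thetaProd_zero ht, deriv_thetaProd_zero, hh]
  constructor
  · intro h
    linear_combination (deriv (theta τ) 0 * thetaCofactor τ t j (t j)) *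
      thetaProd τ (-μ) z (t j) * h
  · intro h
    refine mul_left_cancel₀ (mul_ne_zero h1 h0) ?_
    linear_combination h

/-- If `Wr(∏_j θ(x - t_j), g)` is a nonzero multiple of `exp (-2πiμx) ∏_a θ(x - z_a)`, then `t`
satisfies the Bethe ansatz equations. -/
theorem bethe_of_wronskian {τ : ℍ} {m n : ℕ} {μ C : ℂ} {t : Fin m → ℂ} {z : Fin n → ℂ}
    {g : ℂ → ℂ} (hC : C ≠ 0) (ht : ∀ i j, i ≠ j → t i - t j ∉ lattice τ)
    (htz : ∀ i a, t i - z a ∉ lattice τ) (hg : Differentiable ℂ g)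
    (h : wronskian (thetaProd τ 0 t) g = C • thetaProd τ (-μ) z) (j : Fin m) :
    2 * Real.pi * I * μ + 2 * ∑ k ∈ Finset.univ.erase j, rho τ (t j - t k)
      - ∑ a, rho τ (t j - z a) = 0 := by
  rw [bethe_iff ht htz j]
  have h0 : thetaProd τ 0 t (t j) = 0 :=
    thetaProd_eq_zero_iff.2 ⟨j, by simpa using zero_mem_lattice τ⟩
  have h1 := congrFun h (t j)
  have h2 := (hasDerivAt_wronskian (differentiable_thetaProd τ 0 t) hg (t j)).deriv
  rw [h, show C • thetaProd τ (-μ) z = fun y => C * thetaProd τ (-μ) z y from rfl,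
    deriv_const_mul_field] at h2
  simp only [wronskian, h0, Pi.smul_apply, smul_eq_mul, zero_mul, zero_sub] at h1 h2
  -- Since f(t_j) = 0, the Wronskian equation and its derivative read -f'g = C h and -f''g = C h' at
  -- t_j; eliminating g gives f''h = f'h'.
  refine mul_left_cancel₀ hC ?_
  linear_combination -(deriv (deriv (thetaProd τ 0 t)) (t j)) * h1 -
    deriv (thetaProd τ 0 t) (t j) * h2

/-! ### Existence of the second solution -/

theorem exp_eq_exp_int {a b : ℂ} (h : exp (2 * Real.pi * I * a) = exp (2 * Real.pi * I * b)) :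
    ∃ n : ℤ, a = b + n := by
  obtain ⟨n, hn⟩ := Complex.exp_eq_exp_iff_exists_int.1 h
  exact ⟨n, mul_left_cancel₀ Complex.two_pi_I_ne_zero (by rw [hn]; ring)⟩

theorem exp_add_int (a : ℂ) (n : ℤ) :
    exp (2 * Real.pi * I * (a + n)) = exp (2 * Real.pi * I * a) := by
  rw [mul_add, exp_add, exp_two_pi_int, mul_one]

/-- Divisibility by the square of a theta product with simple zeros. -/
theorem exists_eq_sq_mul {τ : ℍ} {m : ℕ} {t : Fin m → ℂ} {a : ℂ} {M D R : ℂ → ℂ}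
    (ht : ∀ i j, i ≠ j → t i - t j ∉ lattice τ) (ha : a ≠ 0) (hR : Differentiable ℂ R)
    (hM : Differentiable ℂ M) (hD : Differentiable ℂ D) (hM0 : ∀ x, M x ≠ 0)
    (h1 : ∀ x, R (x + 1) = a * R x)
    (h2 : ∀ x, R (x + τ) = M x * (R x + D x * thetaProd τ 0 t x ^ 2))
    (h3 : ∀ j, R (t j) = 0 ∧ deriv R (t j) = 0) :
    ∃ k : ℂ → ℂ, Differentiable ℂ k ∧ ∀ x, R x = thetaProd τ 0 t x ^ 2 * k x := by
  set f := thetaProd τ 0 t with hf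
  have hfd : Differentiable ℂ f := differentiable_thetaProd τ 0 t
  have hfT := thetaProd_mem τ 0 t
  have hz1 : ∀ x, f (x + 1) = 0 ↔ f x = 0 :=
    thetaSpace_zero_iff (exp_ne_zero _) (exp_ne_zero _) hfT (one_mem_lattice τ)
  have hz2 : ∀ x, f (x + τ) = 0 ↔ f x = 0 :=
    thetaSpace_zero_iff (exp_ne_zero _) (exp_ne_zero _) hfT (tau_mem_lattice τ)
  -- The defect term D f² vanishes doubly at the zeros of f, so it contributes to neither R nor R'
  -- there. The double zeros at the t_j therefore propagate to all lattice translates.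
  have hd2 : ∀ x, f x = 0 → deriv R (x + τ) = deriv M x * R x + M x * deriv R x := by
    intro x hx
    have h := (hM x).hasDerivAt.fun_mul ((hR x).hasDerivAt.fun_add
      ((hD x).hasDerivAt.fun_mul ((hfd x).hasDerivAt.fun_pow 2)))
    rw [← deriv_comp_add_const, funext h2, h.deriv, hx]
    simp
  have hzero : ∀ x, f x = 0 → R x = 0 ∧ deriv R x = 0 := by
    intro x hx
    obtain ⟨j, hj⟩ := thetaProd_eq_zero_iff.1 hx
    have := lattice_invariant (p := fun x => f x = 0 ∧ R x = 0 ∧ deriv R x = 0)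
      (fun x => by simp only [hz1, h1, deriv_add_one h1, mul_eq_zero, ha, false_or])
      (fun x => by
        simp only [hz2]
        refine and_congr_right fun hx => ?_
        rw [h2, hx, hd2 x hx]
        simp only [ne_eq, OfNat.ofNat_ne_zero, not_false_eq_true, zero_pow, mul_zero, add_zero,
          mul_eq_zero, hM0 x, false_or]
        refine and_congr_right fun hR0 => ?_
        rw [hR0, mul_zero, zero_add, mul_eq_zero]
        simp [hM0 x]) hj (t j)
    rw [add_sub_cancel] at this
    exact (this.2 ⟨thetaProd_eq_zero_iff.2 ⟨j, by simpa using zero_mem_lattice τ⟩, h3 j⟩).2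
  obtain ⟨k₁, hk₁, e₁⟩ := entire_dvd hfd hR fun x hx =>
    ⟨thetaProd_deriv_ne_zero ht hx, (hzero x hx).1⟩
  obtain ⟨k₂, hk₂, e₂⟩ := entire_dvd hfd hk₁ fun x hx => by
    refine ⟨thetaProd_deriv_ne_zero ht hx, ?_⟩
    have h := ((hfd x).hasDerivAt.fun_mul (hk₁ x).hasDerivAt).deriv
    rw [← funext e₁, (hzero x hx).2, hx, zero_mul, add_zero] at h
    exact (mul_eq_zero.1 h.symm).resolve_left (thetaProd_deriv_ne_zero ht hx)
  exact ⟨k₂, hk₂, fun x => by rw [e₁, e₂]; ring⟩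

/-- Data shared by both constructions of the second solution: a function `g` with prescribed values
at the `t_j` makes `Wr(f, g) - h` vanish to second order there. -/
theorem wronskian_sub_double_zero {τ : ℍ} {m n : ℕ} {μ : ℂ} {t : Fin m → ℂ} {z : Fin n → ℂ}
    (ht : ∀ i j, i ≠ j → t i - t j ∉ lattice τ) (htz : ∀ i a, t i - z a ∉ lattice τ)
    {g : ℂ → ℂ} (hg : Differentiable ℂ g) (j : Fin m)
    (hb : 2 * Real.pi * I * μ + 2 * ∑ k ∈ Finset.univ.erase j, rho τ (t j - t k)
      - ∑ a, rho τ (t j - z a) = 0)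
    (hv : deriv (thetaProd τ 0 t) (t j) * g (t j) = -thetaProd τ (-μ) z (t j)) :
    (thetaProd τ (-μ) z - wronskian (thetaProd τ 0 t) g) (t j) = 0 ∧
      deriv (thetaProd τ (-μ) z - wronskian (thetaProd τ 0 t) g) (t j) = 0 := by
  have hfd := differentiable_thetaProd τ 0 t
  have h0 : thetaProd τ 0 t (t j) = 0 :=
    thetaProd_eq_zero_iff.2 ⟨j, by simpa using zero_mem_lattice τ⟩
  have hd0 := thetaProd_deriv_ne_zero ht h0
  rw [bethe_iff ht htz j] at hb
  refine ⟨?_, ?_⟩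
  · simp only [Pi.sub_apply, wronskian, h0]
    linear_combination hv
  · have := (differentiable_thetaProd τ (-μ) z (t j)).hasDerivAt.sub
      (hasDerivAt_wronskian hfd hg (t j))
    rw [this.deriv, h0]
    -- The derivative is h' + f''g. Multiplied by f', and with f'g = -h, it becomes f'h' - f''h,
    -- which the Bethe equation kills.
    refine mul_left_cancel₀ hd0 ?_
    linear_combination -hb + deriv (deriv (thetaProd τ 0 t)) (t j) * hv

/-- Interpolation makes h - Wr(f, g) equal to f² k with k of degree 0. The multipliers of k are
those of an exponential only if 2 ∑ t_j - ∑ z_a is in the lattice, so here k = 0. -/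
theorem exists_partner_generic {τ : ℍ} {m : ℕ} {μ : ℂ} {t : Fin m → ℂ} {z : Fin (2 * m) → ℂ}
    (ht : ∀ i j, i ≠ j → t i - t j ∉ lattice τ) (htz : ∀ i a, t i - z a ∉ lattice τ)
    (hb : ∀ j, 2 * Real.pi * I * μ + 2 * ∑ k ∈ Finset.univ.erase j, rho τ (t j - t k)
      - ∑ a, rho τ (t j - z a) = 0)
    (hs : 2 * ∑ j, t j - ∑ a, z a ∉ lattice τ) :
    ∃ g : ℂ → ℂ, (∃ A B : ℂ, A ≠ 0 ∧ B ≠ 0 ∧ g ∈ thetaSpace τ m A B) ∧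
      wronskian (thetaProd τ 0 t) g = thetaProd τ (-μ) z := by
  set s := 2 * ∑ j, t j - ∑ a, z a with hsdef
  set f := thetaProd τ 0 t with hf
  set h := thetaProd τ (-μ) z with hh
  -- Lagrange basis: `e j` vanishes at the other t_i, and not at t_j because s is not in the
  -- lattice. Moving the zero t_j to t_j - s gives all `e j` the zero sum ∑ z_a - ∑ t_i, hence the
  -- multipliers that a partner must have.
  let e : Fin m → ℂ → ℂ := fun j => thetaProd τ (-μ) (Function.update t j (t j - s))
  have hsum : ∀ j, ∑ i, Function.update t j (t j - s) i = ∑ a, z a - ∑ i, t i := by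
    intro j
    rw [Finset.sum_update_of_mem (Finset.mem_univ j), Finset.sdiff_singleton_eq_erase]
    have := Finset.add_sum_erase Finset.univ t (Finset.mem_univ j)
    linear_combination this - hsdef
  have heT : ∀ j, e j ∈ thetaSpace τ m (exp (2 * Real.pi * I * (-μ)))
      (exp (2 * Real.pi * I * (-μ * τ + (∑ a, z a - ∑ i, t i)))) := fun j => by
    have := thetaProd_mem τ (-μ) (Function.update t j (t j - s))
    rwa [hsum j] at this
  have he0 : ∀ j, e j (t j) ≠ 0 := by
    intro j h0
    obtain ⟨i, hi⟩ := thetaProd_eq_zero_iff.1 h0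
    by_cases hij : i = j
    · subst hij
      simp only [Function.update_self, sub_sub_cancel] at hi
      exact hs hi
    · rw [Function.update_of_ne hij] at hi
      exact ht j i (Ne.symm hij) hi
  have he1 : ∀ i j, i ≠ j → e i (t j) = 0 := fun i j hij => thetaProd_eq_zero_iff.2
    ⟨j, by rw [Function.update_of_ne (Ne.symm hij), sub_self]; exact zero_mem_lattice τ⟩
  have h0 : ∀ j, f (t j) = 0 := fun j =>
    thetaProd_eq_zero_iff.2 ⟨j, by simpa using zero_mem_lattice τ⟩
  have hd0 : ∀ j, deriv f (t j) ≠ 0 := fun j => thetaProd_deriv_ne_zero ht (h0 j)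
  let g : ℂ → ℂ := ∑ j, (-h (t j) / (deriv f (t j) * e j (t j))) • e j
  have hgT : g ∈ thetaSpace τ m (exp (2 * Real.pi * I * (-μ)))
      (exp (2 * Real.pi * I * (-μ * τ + (∑ a, z a - ∑ i, t i)))) :=
    Submodule.sum_mem _ fun j _ => Submodule.smul_mem _ _ (heT j)
  have hgv : ∀ j, deriv f (t j) * g (t j) = -h (t j) := by
    intro j
    have : g (t j) = (-h (t j) / (deriv f (t j) * e j (t j))) * e j (t j) := by
      simp only [g, Finset.sum_apply, Pi.smul_apply, smul_eq_mul]
      refine Finset.sum_eq_single j (fun i _ hij => ?_) (fun hj => absurd (Finset.mem_univ j) hj)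
      rw [he1 i j hij, mul_zero]
    rw [this]
    have := hd0 j
    have := he0 j
    field_simp
  refine ⟨g, ⟨_, _, exp_ne_zero _, exp_ne_zero _, hgT⟩, ?_⟩
  have hfT := thetaProd_mem τ 0 t
  have hRT : h - wronskian f g ∈ thetaSpace τ (2 * m) (exp (2 * Real.pi * I * (-μ)))
      (exp (2 * Real.pi * I * (-μ * τ + ∑ a, z a))) := by
    refine Submodule.sub_mem _ (thetaProd_mem τ (-μ) z) ?_
    have := wronskian_mem hfT hgT
    rw [← exp_add, ← exp_add] at this
    convert this using 3 <;> ring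
  obtain ⟨k, hk, hRk⟩ := exists_eq_sq_mul (R := h - wronskian f g) (D := fun _ => 0)
    (M := fun x => exp (2 * Real.pi * I * (-μ * τ + ∑ a, z a)) * (-1) ^ (2 * m) *
      exp (-(Real.pi * I * (2 * m : ℕ) * τ) - 2 * Real.pi * I * (2 * m : ℕ) * x)) ht
    (mul_ne_zero (exp_ne_zero (2 * Real.pi * I * (-μ))) (pow_ne_zero (2 * m) (neg_ne_zero.2 (one_ne_zero (α := ℂ)))))
    hRT.1 (by fun_prop) (by fun_prop)
    (fun x => mul_ne_zero (mul_ne_zero (exp_ne_zero _)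
      (pow_ne_zero _ (neg_ne_zero.2 one_ne_zero))) (exp_ne_zero _))
    hRT.2.1 (fun x => by rw [hRT.2.2, zero_mul, add_zero])
    (fun j => wronskian_sub_double_zero ht htz hgT.1 j (hb j) (hgv j))
  have hsq := thetaSpace_mul hfT hfT
  have hkT := thetaSpace_quot (τ := τ) (m := m + m) (n := 0) (f := fun x => f x * f x)
    (R := h - wronskian f g) (k := k) (A' := exp (2 * Real.pi * I * (-μ)))
    (B' := exp (2 * Real.pi * I * (-μ * τ - s))) hsq
    (by
      intro h0
      rcases entire_mul_eq_zero hfT.1 hfT.1 (congrFun h0) with h | h <;>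
      exact thetaProd_ne_zero τ 0 t h)
    (mul_ne_zero (exp_ne_zero _) (exp_ne_zero _)) (mul_ne_zero (exp_ne_zero _) (exp_ne_zero _))
    (by
      rw [← exp_add, ← exp_add, ← exp_add, ← exp_add]
      convert hRT using 2
      · ring
      · congr 1; ring
      · congr 1; rw [hsdef]; ring) hk (fun x => by rw [hRk x]; ring)
  obtain ⟨ν, C, hC⟩ := thetaSpace_degree_zero (exp_ne_zero _) (exp_ne_zero _) hkT
  by_cases hC0 : C = 0
  · funext x
    have := hRk x
    rw [hC x, hC0, zero_mul, mul_zero] at this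
    exact (sub_eq_zero.1 this).symm
  -- A nonzero k is C exp (2πiνx). Comparing its two multipliers with the prescribed ones expresses
  -- s as an integer combination of 1 and τ.
  · exfalso
    have hkp : k = C • thetaProd τ ν (Fin.elim0 : Fin 0 → ℂ) := by
      funext x; simp [hC x, thetaProd]
    have hk0 : k ≠ 0 := by
      rw [hkp]; exact smul_ne_zero hC0 (thetaProd_ne_zero τ ν _)
    have hkT' := Submodule.smul_mem _ C (thetaProd_mem τ ν (Fin.elim0 : Fin 0 → ℂ))
    rw [← hkp] at hkT'
    obtain ⟨hA, hB⟩ := thetaSpace_unique hk0 hkT hkT'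
    obtain ⟨n, hn⟩ := exp_eq_exp_int hA
    obtain ⟨n', hn'⟩ := exp_eq_exp_int hB
    refine hs ⟨-n', n, ?_⟩
    simp only [Finset.univ_eq_empty, Finset.sum_empty] at hn'
    push_cast
    linear_combination hn * τ - hn'

theorem prod_multiplier (τ : ℍ) {m : ℕ} (t : Fin m → ℂ) (x : ℂ) :
    ∏ j, (-exp (-(Real.pi * I * τ) - 2 * Real.pi * I * (x - t j))) =
      exp (2 * Real.pi * I * ∑ j, t j) * (-1) ^ m *
        exp (-(Real.pi * I * m * τ) - 2 * Real.pi * I * m * x) := by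
  rw [Finset.prod_neg, ← exp_sum, Finset.sum_sub_distrib, ← Finset.mul_sum,
    Finset.sum_sub_distrib]
  simp only [Finset.sum_const, Finset.card_univ, Fintype.card_fin, nsmul_eq_mul]
  rw [mul_comm (exp (2 * Real.pi * I * ∑ j, t j)) ((-1) ^ m), mul_assoc ((-1) ^ m), ← exp_add]
  congr 2
  ring

/-- When 2 ∑ t_j - ∑ z_a is in the lattice, the previous interpolation basis breaks down. Replacing
θ by θ' in one factor gives functions quasi-periodic only up to multiples of F = exp (2πiνx) f; the
total defect is shown to vanish afterwards. -/
theorem exists_partner_degenerate {τ : ℍ} {m : ℕ} {μ : ℂ} {t : Fin m → ℂ} {z : Fin (2 * m) → ℂ}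
    (ht : ∀ i j, i ≠ j → t i - t j ∉ lattice τ) (htz : ∀ i a, t i - z a ∉ lattice τ)
    (hb : ∀ j, 2 * Real.pi * I * μ + 2 * ∑ k ∈ Finset.univ.erase j, rho τ (t j - t k)
      - ∑ a, rho τ (t j - z a) = 0)
    {p l : ℤ} (hs : 2 * ∑ j, t j - ∑ a, z a = p + l * (τ : ℂ)) (hl : μ ≠ -l) :
    ∃ g : ℂ → ℂ, (∃ A B : ℂ, A ≠ 0 ∧ B ≠ 0 ∧ g ∈ thetaSpace τ m A B) ∧
      wronskian (thetaProd τ 0 t) g = thetaProd τ (-μ) z := by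
  set f := thetaProd τ 0 t with hf
  set h := thetaProd τ (-μ) z with hh
  -- With this ν, h has the same multipliers as exp (2πiνx) f². The excluded value μ = -l is ν = 0,
  -- where f and F would coincide.
  set ν : ℂ := -μ - l with hν
  have hν0 : ν ≠ 0 := fun h0 => hl (by linear_combination -h0)
  have hfd : Differentiable ℂ f := differentiable_thetaProd τ 0 t
  let E : ℂ → ℂ := fun x => exp (2 * Real.pi * I * ν * x)
  have hE : Differentiable ℂ E := by fun_prop
  -- At t_j the factor θ' is θ'(0) ≠ 0, and at the other t_i the cofactor vanishes. Under τ the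
  -- factor θ' produces an extra term proportional to E f, the same for every j.
  let e : Fin m → ℂ → ℂ := fun j x =>
    E x * (deriv (theta τ) (x - t j) * thetaCofactor τ t j x)
  have hdθ := differentiable_deriv (differentiable_theta τ)
  have hed : ∀ j, Differentiable ℂ (e j) := fun j => by
    have := differentiable_thetaCofactor τ t j
    fun_prop
  let Mf : ℂ → ℂ := fun x => exp (2 * Real.pi * I * ∑ j, t j) * (-1) ^ m *
    exp (-(Real.pi * I * m * τ) - 2 * Real.pi * I * m * x)
  have hMf0 : ∀ x, Mf x ≠ 0 := fun x => mul_ne_zero (mul_ne_zero (exp_ne_zero _)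
      (pow_ne_zero _ (neg_ne_zero.2 one_ne_zero))) (exp_ne_zero _)
  have hMfd : Differentiable ℂ Mf := by fun_prop
  have hMf' : ∀ x, deriv Mf x = -(2 * Real.pi * I * m) * Mf x := by
    intro x
    have := (((hasDerivAt_id x).const_mul (2 * Real.pi * I * m)).const_sub
      (-(Real.pi * I * m * τ))).cexp.const_mul (exp (2 * Real.pi * I * ∑ j, t j) * (-1) ^ m)
    refine this.deriv.trans ?_
    simp only [id, mul_one, Mf]
    ring
  have hfT := thetaProd_mem τ 0 t
  have hf1 : ∀ x, f (x + 1) = (-1) ^ m * f x := fun x => by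
    have := hfT.2.1 x
    simpa using this
  have hf2 : ∀ x, f (x + τ) = Mf x * f x := fun x => by
    have := hfT.2.2 x
    simpa [Mf] using this
  have hE1 : ∀ x, E (x + 1) = exp (2 * Real.pi * I * ν) * E x := fun x => by
    simp only [E, mul_add, exp_add, mul_one]; ring
  have hE2 : ∀ x, E (x + τ) = exp (2 * Real.pi * I * ν * τ) * E x := fun x => by
    simp only [E, mul_add, exp_add]; ring
  have he1 : ∀ j x, e j (x + 1) = exp (2 * Real.pi * I * ν) * (-1) ^ m * e j x := by
    intro j x
    have hc : -thetaCofactor τ t j (x + 1) = (-1) ^ m * thetaCofactor τ t j x := by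
      have e0 : ∀ i, theta τ (x + 1 - t i) = -1 * theta τ (x - t i) := fun i => by
        rw [show x + 1 - t i = x - t i + 1 by ring, theta_add_one]; ring
      have := Finset.mul_prod_erase Finset.univ (fun _ : Fin m => (-1 : ℂ)) (Finset.mem_univ j)
      simp only [Finset.prod_const (s := Finset.univ), Finset.card_univ, Fintype.card_fin] at this
      simp only [thetaCofactor, e0, Finset.prod_mul_distrib]
      rw [← this]; ring
    simp only [e, hE1, show x + 1 - t j = x - t j + 1 by ring, deriv_theta_add_one]
    linear_combination exp (2 * Real.pi * I * ν) * E x * deriv (theta τ) (x - t j) * hc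
  have he2 : ∀ j x, e j (x + τ) = exp (2 * Real.pi * I * ν * τ) * Mf x *
      (e j x - 2 * Real.pi * I * (E x * f x)) := by
    intro j x
    have hc : -exp (-(Real.pi * I * τ) - 2 * Real.pi * I * (x - t j)) *
        thetaCofactor τ t j (x + τ) = Mf x * thetaCofactor τ t j x := by
      have e0 : ∀ i, theta τ (x + τ - t i) =
          -exp (-(Real.pi * I * τ) - 2 * Real.pi * I * (x - t i)) * theta τ (x - t i) :=
        fun i => by rw [show x + τ - t i = x - t i + τ by ring, theta_add_tau]
      have := Finset.mul_prod_erase Finset.univ (fun i : Fin m =>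
        -exp (-(Real.pi * I * τ) - 2 * Real.pi * I * (x - t i))) (Finset.mem_univ j)
      rw [prod_multiplier] at this
      simp only [thetaCofactor, e0, Finset.prod_mul_distrib, Mf]
      rw [← this]; ring
    have hff : f x = theta τ (x - t j) * thetaCofactor τ t j x :=
      congrFun (thetaProd_zero_eq τ t j) x
    simp only [e, hE2, show x + τ - t j = x - t j + τ by ring, deriv_theta_add_tau, hff]
    linear_combination exp (2 * Real.pi * I * ν * τ) * E x * (deriv (theta τ) (x - t j) -
      2 * Real.pi * I * theta τ (x - t j)) * hc
  have hp0 : ∀ j, e j (t j) ≠ 0 := fun j => mul_ne_zero (exp_ne_zero _)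
    (mul_ne_zero (deriv_theta_ne_zero (by simpa using zero_mem_lattice τ))
      (thetaCofactor_ne_zero ht j (by simpa using zero_mem_lattice τ)))
  have hp1 : ∀ i j, i ≠ j → e i (t j) = 0 := fun i j hij => by
    have : thetaCofactor τ t i (t j) = 0 :=
      Finset.prod_eq_zero (Finset.mem_erase.2 ⟨Ne.symm hij, Finset.mem_univ j⟩)
        (by rw [sub_self, theta_zero])
    simp [e, this]
  have h0 : ∀ j, f (t j) = 0 := fun j =>
    thetaProd_eq_zero_iff.2 ⟨j, by simpa using zero_mem_lattice τ⟩
  have hd0 : ∀ j, deriv f (t j) ≠ 0 := fun j => thetaProd_deriv_ne_zero ht (h0 j)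
  let c : Fin m → ℂ := fun j => -h (t j) / (deriv f (t j) * e j (t j))
  let g : ℂ → ℂ := fun x => ∑ j, c j * e j x
  have hgd : Differentiable ℂ g := by
    have : ∀ j, Differentiable ℂ fun x => c j * e j x := fun j => (hed j).const_mul (c j)
    exact Differentiable.fun_sum fun j _ => this j
  have hgv : ∀ j, deriv f (t j) * g (t j) = -h (t j) := by
    intro j
    have : g (t j) = c j * e j (t j) := by
      refine Finset.sum_eq_single j (fun i _ hij => ?_) (fun hj => absurd (Finset.mem_univ j) hj)
      rw [hp1 i j hij, mul_zero]
    rw [this]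
    have := hd0 j
    have := hp0 j
    simp only [c]
    field_simp
  have hg1 : ∀ x, g (x + 1) = exp (2 * Real.pi * I * ν) * (-1) ^ m * g x := fun x => by
    simp only [g, he1, Finset.mul_sum]
    exact Finset.sum_congr rfl fun j _ => by ring
  set F : ℂ → ℂ := fun x => E x * f x with hF
  have hFd : Differentiable ℂ F := hE.mul hfd
  set c₀ := ∑ j, c j with hc₀
  have hg2 : ∀ x, g (x + τ) = exp (2 * Real.pi * I * ν * τ) * Mf x *
      (g x - 2 * Real.pi * I * c₀ * F x) := fun x => by
    simp only [g, he2, hc₀, Finset.mul_sum, Finset.sum_mul, ← Finset.sum_sub_distrib]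
    exact Finset.sum_congr rfl fun j _ => by simp only [hF]; ring
  have hW : ∀ x, wronskian f F x = 2 * Real.pi * I * ν * (E x * f x ^ 2) := by
    intro x
    simp only [wronskian, hF, E]
    rw [(hasDerivAt_exp_mul (hfd x).hasDerivAt).deriv]
    ring
  have hdf2 : ∀ x, deriv f (x + τ) = deriv Mf x * f x + Mf x * deriv f x := by
    intro x
    rw [← deriv_comp_add_const, funext hf2]
    exact ((hMfd x).hasDerivAt.fun_mul (hfd x).hasDerivAt).deriv
  have hdg2 : ∀ x, deriv g (x + τ) = exp (2 * Real.pi * I * ν * τ) * (deriv Mf x *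
      (g x - 2 * Real.pi * I * c₀ * F x) +
        Mf x * (deriv g x - 2 * Real.pi * I * c₀ * deriv F x)) := by
    intro x
    rw [← deriv_comp_add_const, funext hg2]
    have := ((hMfd x).hasDerivAt.const_mul (exp (2 * Real.pi * I * ν * τ))).fun_mul
      ((hgd x).hasDerivAt.fun_sub ((hFd x).hasDerivAt.const_mul (2 * Real.pi * I * c₀)))
    rw [this.deriv]
    ring
  have hW2 : ∀ x, wronskian f g (x + τ) = exp (2 * Real.pi * I * ν * τ) * Mf x ^ 2 *
      (wronskian f g x - 2 * Real.pi * I * c₀ * (2 * Real.pi * I * ν * (E x * f x ^ 2))) := by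
    intro x
    rw [← hW]
    simp only [wronskian, hf2, hdf2, hg2, hdg2]
    ring
  have hW1 : ∀ x, wronskian f g (x + 1) = exp (2 * Real.pi * I * ν) * wronskian f g x := by
    intro x
    have e1 : ((-1 : ℂ) ^ m) * (-1) ^ m = 1 := by rw [← mul_pow]; simp
    simp only [wronskian, hf1, hg1, deriv_add_one hf1, deriv_add_one hg1]
    linear_combination exp (2 * Real.pi * I * ν) * (f x * deriv g x - deriv f x * g x) * e1
  have hh1 : ∀ x, h (x + 1) = exp (2 * Real.pi * I * ν) * h x := by
    intro x
    have := (thetaProd_mem τ (-μ) z).2.1 x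
    rw [pow_mul, neg_one_sq, one_pow, mul_one] at this
    rw [hh, this, ← exp_add_int ν l, hν, sub_add_cancel]
  have hh2 : ∀ x, h (x + τ) = exp (2 * Real.pi * I * ν * τ) * Mf x ^ 2 * h x := by
    intro x
    have := (thetaProd_mem τ (-μ) z).2.2 x
    rw [pow_mul, neg_one_sq, one_pow, mul_one] at this
    have e1 : exp (2 * Real.pi * I * (-μ * τ + ∑ a, z a)) =
        exp (2 * Real.pi * I * ν * τ) * exp (2 * Real.pi * I * ∑ j, t j) ^ 2 := by
      rw [← exp_nat_mul, ← exp_add, ← exp_add_int (-μ * τ + ∑ a, z a) p]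
      congr 1
      push_cast
      linear_combination 2 * Real.pi * I * (-hs)
    have e2 : exp (-(Real.pi * I * (2 * m : ℕ) * τ) - 2 * Real.pi * I * (2 * m : ℕ) * x) =
        exp (-(Real.pi * I * m * τ) - 2 * Real.pi * I * m * x) ^ 2 := by
      rw [← exp_nat_mul]; push_cast; congr 1; ring
    have e3 : ((-1 : ℂ) ^ m) ^ 2 = 1 := by rw [← pow_mul, mul_comm, pow_mul]; simp
    rw [hh, this, e1, e2]
    simp only [Mf, mul_pow, e3]
    ring
  set D₀ : ℂ := 2 * Real.pi * I * c₀ * (2 * Real.pi * I * ν) with hD₀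
  have hR1 : ∀ x, (h - wronskian f g) (x + 1) = exp (2 * Real.pi * I * ν) *
      (h - wronskian f g) x := fun x => by
    simp only [Pi.sub_apply, hh1, hW1]; ring
  have hR2 : ∀ x, (h - wronskian f g) (x + τ) = exp (2 * Real.pi * I * ν * τ) * Mf x ^ 2 *
      ((h - wronskian f g) x + D₀ * E x * f x ^ 2) := fun x => by
    simp only [Pi.sub_apply, hh2, hW2, hD₀]; ring
  obtain ⟨k, hk, hRk⟩ := exists_eq_sq_mul (R := h - wronskian f g) (D := fun x => D₀ * E x)
    (M := fun x => exp (2 * Real.pi * I * ν * τ) * Mf x ^ 2) ht (exp_ne_zero _)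
    ((differentiable_thetaProd τ (-μ) z).sub (differentiable_wronskian hfd hgd)) (by fun_prop)
    (by fun_prop) (fun x => mul_ne_zero (exp_ne_zero _) (pow_ne_zero 2 (hMf0 x))) hR1 hR2
    (fun j => wronskian_sub_double_zero ht htz hgd j (hb j) (hgv j))
  have hf0 : f ≠ 0 := thetaProd_ne_zero τ 0 t
  have hff0 : (fun x => f x ^ 2) ≠ 0 := fun h0 => hf0 (funext fun x => by
    simpa using congrFun h0 x)
  have hk1 : (fun x => k (x + 1)) = fun x => exp (2 * Real.pi * I * ν) * k x := by
    refine entire_cancel (hfd.pow 2) hff0 (by fun_prop) (by fun_prop) fun x => ?_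
    have := hR1 x
    have e1 : ((-1 : ℂ) ^ m) ^ 2 = 1 := by rw [← pow_mul, mul_comm, pow_mul]; simp
    rw [hRk, hRk] at this
    rw [← hf, hf1, mul_pow, e1, one_mul] at this
    simp only [Pi.pow_apply]
    linear_combination this
  have hk2 : (fun x => k (x + τ)) = fun x => exp (2 * Real.pi * I * ν * τ) *
      (k x + D₀ * E x) := by
    refine entire_cancel (hfd.pow 2) hff0 (by fun_prop) (by fun_prop) fun x => ?_
    have := hR2 x
    rw [hRk, hRk, ← hf, hf2, mul_pow] at this
    simp only [Pi.pow_apply]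
    refine mul_left_cancel₀ (pow_ne_zero 2 (hMf0 x)) ?_
    linear_combination this
  have hE0 : ∀ x, E x ≠ 0 := fun x => exp_ne_zero _
  obtain ⟨hD0, hkc⟩ := entire_affine (τ := τ) (k := fun x => k x / E x) (hk.div hE hE0) (a := 0)
    (b := D₀) (fun x => by
      rw [congrFun hk1 x, hE1, mul_div_mul_left _ _ (exp_ne_zero _), add_zero]) (fun x => by
      rw [congrFun hk2 x, hE2, mul_div_mul_left _ _ (exp_ne_zero _), add_div,
        mul_div_cancel_right₀ _ (hE0 x)])
  -- k / E is unchanged by the shift by 1 and gains D₀ under τ, so `entire_affine` gives D₀ = 0. As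
  -- ν ≠ 0, the defect c₀ of g vanishes and g is a genuine theta-polynomial.
  have hc0 : c₀ = 0 := by
    rw [zero_mul, hD₀] at hD0
    have h2 := Complex.two_pi_I_ne_zero
    simpa [hν0, I_ne_zero, Real.pi_ne_zero] using hD0
  simp only [zero_mul, zero_add] at hkc
  set β := k 0 / E 0 with hβ
  have hgT : g ∈ thetaSpace τ m (exp (2 * Real.pi * I * ν))
      (exp (2 * Real.pi * I * (ν * τ + ∑ j, t j))) := by
    refine ⟨hgd, hg1, fun x => ?_⟩
    rw [hg2, hc0, mul_add, exp_add]
    simp only [Mf]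
    ring_nf
  have hFT : F ∈ thetaSpace τ m (exp (2 * Real.pi * I * ν))
      (exp (2 * Real.pi * I * (ν * τ + ∑ j, t j))) := by
    have := thetaProd_mem τ ν t
    have e1 : thetaProd τ ν t = F := by
      funext x
      simp [thetaProd, hF, E, hf]
    rwa [e1] at this
  -- What remains is h - Wr(f, g) = β E f², while Wr(f, F) = 2πiν E f². Adding this multiple of F to
  -- g absorbs the remainder.
  refine ⟨g + (β / (2 * Real.pi * I * ν)) • F, ⟨_, _, exp_ne_zero _, exp_ne_zero _,
    Submodule.add_mem _ hgT (Submodule.smul_mem _ _ hFT)⟩, ?_⟩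
  funext x
  rw [wronskian_add_right hgd (hFd.const_smul _)]
  have e1 : wronskian f ((β / (2 * Real.pi * I * ν)) • F) x =
      (β / (2 * Real.pi * I * ν)) * wronskian f F x := by
    have := wronskian_smul 1 (β / (2 * Real.pi * I * ν)) f F
    rw [one_smul, one_mul] at this
    rw [this]; rfl
  have e2 : k x = β * E x := by
    rw [← hkc x, div_mul_cancel₀ _ (hE0 x)]
  have e3 := hRk x
  rw [e2] at e3
  simp only [Pi.sub_apply] at e3
  rw [e1, hW]
  have e4 : β / (2 * Real.pi * I * ν) * (2 * Real.pi * I * ν * (E x * f x ^ 2)) =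
      β * (E x * f x ^ 2) := by
    have h2 := Complex.two_pi_I_ne_zero
    rw [← mul_assoc, div_mul_cancel₀ _ (mul_ne_zero h2 hν0)]
  rw [e4]
  linear_combination -e3

/-- A solution of the Bethe ansatz equations gives a theta-polynomial whose Wronskian with
`∏_j θ(x - t_j)` is `exp (-2πiμx) ∏_a θ(x - z_a)`. -/
theorem exists_partner {τ : ℍ} {m : ℕ} {μ : ℂ} {t : Fin m → ℂ} {z : Fin (2 * m) → ℂ}
    (ht : ∀ i j, i ≠ j → t i - t j ∉ lattice τ) (htz : ∀ i a, t i - z a ∉ lattice τ)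
    (hb : ∀ j, 2 * Real.pi * I * μ + 2 * ∑ k ∈ Finset.univ.erase j, rho τ (t j - t k)
      - ∑ a, rho τ (t j - z a) = 0)
    (hl : ∀ p l : ℤ, 2 * ∑ j, t j - ∑ a, z a = p + l * (τ : ℂ) → μ ≠ -l) :
    ∃ g : ℂ → ℂ, (∃ A B : ℂ, A ≠ 0 ∧ B ≠ 0 ∧ g ∈ thetaSpace τ m A B) ∧
      wronskian (thetaProd τ 0 t) g = thetaProd τ (-μ) z := by
  by_cases hs : 2 * ∑ j, t j - ∑ a, z a ∈ lattice τ
  · obtain ⟨p, l, hs⟩ := hs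
    exact exists_partner_degenerate ht htz hb hs (hl p l hs)
  · exact exists_partner_generic ht htz hb hs

/-! ### Localization for large `μ` -/

theorem deriv_thetaProd_eq (τ : ℍ) (ν : ℂ) {k : ℕ} (t : Fin k → ℂ) (x : ℂ) :
    deriv (thetaProd τ ν t) x = exp (2 * Real.pi * I * ν * x) *
      (2 * Real.pi * I * ν * ∏ j, theta τ (x - t j) +
        ∑ j, (∏ i ∈ Finset.univ.erase j, theta τ (x - t i)) * deriv (theta τ) (x - t j)) := by
  have h : HasDerivAt (fun x => ∏ j, theta τ (x - t j))
      (∑ j, (∏ i ∈ Finset.univ.erase j, theta τ (x - t i)) • deriv (theta τ) (x - t j)) x :=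
    HasDerivAt.fun_finsetProd fun j _ =>
      (differentiable_theta τ (x - t j)).hasDerivAt.comp_sub_const x (t j)
  exact (hasDerivAt_exp_mul h).deriv

theorem continuous_thetaProd_param (τ : ℍ) {k : ℕ} (x : ℂ) :
    Continuous fun p : ℂ × (Fin k → ℂ) => thetaProd τ p.1 p.2 x := by
  have h := (differentiable_theta τ).continuous
  unfold thetaProd
  fun_prop

theorem continuous_deriv_thetaProd_param (τ : ℍ) {k : ℕ} (x : ℂ) :
    Continuous fun p : ℂ × (Fin k → ℂ) => deriv (thetaProd τ p.1 p.2) x := by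
  have h := (differentiable_theta τ).continuous
  have h' := (differentiable_deriv (differentiable_theta τ)).continuous
  simp only [deriv_thetaProd_eq]
  fun_prop

theorem thetaProd_add (τ : ℍ) (ν κ : ℂ) {k : ℕ} (t : Fin k → ℂ) :
    thetaProd τ (ν + κ) t = fun x => exp (2 * Real.pi * I * ν * x) * thetaProd τ κ t x := by
  funext x
  simp only [thetaProd]
  rw [← mul_assoc, ← exp_add]
  congr 2
  ring

theorem thetaProd_append (τ : ℍ) (κ : ℂ) {m n : ℕ} (t : Fin m → ℂ) (s : Fin n → ℂ) (x : ℂ) :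
    thetaProd τ 0 t x * thetaProd τ κ s x = thetaProd τ κ (Fin.append t s) x := by
  simp only [thetaProd, Fin.prod_univ_add, Fin.append_left, Fin.append_right]
  simp
  ring

/-- The multiplier relations between the data of a Wronskian equation. -/
theorem wronskian_multipliers {τ : ℍ} {m : ℕ} {μ ν C : ℂ} {t s : Fin m → ℂ}
    {z : Fin (2 * m) → ℂ} (hC : C ≠ 0)
    (h : wronskian (thetaProd τ 0 t) (thetaProd τ ν s) = C • thetaProd τ (-μ) z) :
    ∃ n l : ℤ, ν = -μ + n ∧ n * (τ : ℂ) + l = ∑ a, z a - ∑ j, t j - ∑ j, s j := by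
  have h1 := wronskian_mem (thetaProd_mem τ 0 t) (thetaProd_mem τ ν s)
  have h2 := Submodule.smul_mem _ C (thetaProd_mem τ (-μ) z)
  rw [h] at h1
  obtain ⟨hA, hB⟩ := thetaSpace_unique (smul_ne_zero hC (thetaProd_ne_zero τ (-μ) z)) h1 h2
  rw [← exp_add, ← mul_add] at hA hB
  obtain ⟨n, hn⟩ := exp_eq_exp_int hA
  obtain ⟨l, hl⟩ := exp_eq_exp_int hB
  refine ⟨n, -l, by linear_combination hn, ?_⟩
  push_cast
  linear_combination hl - hn * τ

theorem norm_mem_parallelogram_bound (τ : ℍ) (w : ℂ) :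
    ∃ R : ℝ, ∀ x ∈ closedParallelogram τ w, ‖x‖ ≤ R :=
  (isCompact_closedParallelogram τ w).exists_bound_of_continuousOn continuousOn_id

/-- Imaginary parts isolate the coefficient of τ. This bounds the integers in the multiplier
relations by the size of the parallelogram, independently of μ. -/
theorem norm_int_le_of_eq {τ : ℍ} {n l : ℤ} {v : ℂ} (h : n * (τ : ℂ) + l = v) :
    ‖(n : ℂ)‖ ≤ ‖v‖ / τ.im := by
  have h1 := congrArg Complex.im h
  simp at h1
  rw [le_div_iff₀ τ.im_pos, norm_intCast]
  calc |(n : ℝ)| * τ.im = |(n : ℝ) * τ.im| := by rw [abs_mul, abs_of_pos τ.im_pos]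
    _ = |v.im| := by rw [h1]
    _ ≤ ‖v‖ := Complex.abs_im_le_norm v

/-- Otherwise there are counterexamples with |μ| → ∞. Along a subsequence t, s and the bounded
integer ν + μ converge, and the rescaled Wronskian equation becomes f₀ g₀ = const ∏ θ(x - z_a) in
the limit; comparing zeros contradicts the choice of the sequence. -/
theorem exists_localization (τ : ℍ) (w : ℂ) (m : ℕ) (z : Fin (2 * m) → ℂ)
    (hz : ∀ a, z a ∈ openParallelogram τ w) {δ : ℝ} (hδ : 0 < δ) :
    ∃ N : ℝ, ∀ μ : ℂ, N < ‖μ‖ → ∀ (t s : Fin m → ℂ) (ν C : ℂ),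
      (∀ j, t j ∈ parallelogram τ w) → (∀ j, s j ∈ parallelogram τ w) → C ≠ 0 →
      wronskian (thetaProd τ 0 t) (thetaProd τ ν s) = C • thetaProd τ (-μ) z →
      ∃ σ : Fin m ⊕ Fin m ≃ Fin (2 * m), (∀ j, ‖t j - z (σ (.inl j))‖ < δ) ∧
        ∀ j, ‖s j - z (σ (.inr j))‖ < δ := by
  by_contra! hcon
  have hcon' : ∀ n : ℕ, ∃ (μ : ℂ) (t s : Fin m → ℂ) (ν C : ℂ), (n : ℝ) < ‖μ‖ ∧
      (∀ j, t j ∈ parallelogram τ w) ∧ (∀ j, s j ∈ parallelogram τ w) ∧ C ≠ 0 ∧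
      wronskian (thetaProd τ 0 t) (thetaProd τ ν s) = C • thetaProd τ (-μ) z ∧
      ∀ σ : Fin m ⊕ Fin m ≃ Fin (2 * m), (∀ j, ‖t j - z (σ (.inl j))‖ < δ) →
        ∃ j, δ ≤ ‖s j - z (σ (.inr j))‖ := by
    intro n
    obtain ⟨μ, hμ, t, s, ν, C, h1, h2, h3, h4, h5⟩ := hcon n
    exact ⟨μ, t, s, ν, C, hμ, h1, h2, h3, h4, h5⟩
  choose μ t s ν C hμ ht hs hC hW hnot using hcon'
  choose n l hn hl using fun i => wronskian_multipliers (hC i) (hW i)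
  obtain ⟨R, hR⟩ := norm_mem_parallelogram_bound τ w
  set K : ℝ := (∑ _a : Fin (2 * m), R + ∑ _j : Fin m, R + ∑ _j : Fin m, R) / τ.im with hK
  have hnK : ∀ i, ‖(n i : ℂ)‖ ≤ K := by
    intro i
    refine (norm_int_le_of_eq (hl i)).trans (div_le_div_of_nonneg_right ?_ τ.im_pos.le)
    refine (norm_sub_le _ _).trans (add_le_add ((norm_sub_le _ _).trans (add_le_add ?_ ?_)) ?_)
    · exact norm_sum_le_of_le _ fun a _ =>
        hR _ (parallelogram_subset_closed τ w (openParallelogram_subset τ w (hz a)))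
    · exact norm_sum_le_of_le _ fun j _ => hR _ (parallelogram_subset_closed τ w (ht i j))
    · exact norm_sum_le_of_le _ fun j _ => hR _ (parallelogram_subset_closed τ w (hs i j))
  have hcomp : IsCompact ((Set.univ.pi fun _ : Fin m => closedParallelogram τ w) ×ˢ
      ((Set.univ.pi fun _ : Fin m => closedParallelogram τ w) ×ˢ Metric.closedBall (0 : ℂ) K)) :=
    (isCompact_univ_pi fun _ => isCompact_closedParallelogram τ w).prod
      ((isCompact_univ_pi fun _ => isCompact_closedParallelogram τ w).prod
        (isCompact_closedBall 0 K))
  obtain ⟨⟨t₀, s₀, κ⟩, ⟨ht₀, hs₀, -⟩, φ, hφ, hlim⟩ := hcomp.tendsto_subseq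
    (x := fun i => (t i, s i, (n i : ℂ))) (fun i =>
      ⟨fun j _ => parallelogram_subset_closed τ w (ht i j),
        fun j _ => parallelogram_subset_closed τ w (hs i j),
        by simpa using hnK i⟩)
  have hlt : Tendsto (fun i => t (φ i)) atTop (𝓝 t₀) :=
    (continuous_fst.tendsto _).comp hlim
  have hls : Tendsto (fun i => s (φ i)) atTop (𝓝 s₀) :=
    ((continuous_fst.comp continuous_snd).tendsto _).comp hlim
  have hlk : Tendsto (fun i => (n (φ i) : ℂ)) atTop (𝓝 κ) :=
    ((continuous_snd.comp continuous_snd).tendsto _).comp hlim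
  have hμinf : Tendsto (fun i => (2 * Real.pi * I * μ (φ i))⁻¹) atTop (𝓝 0) := by
    refine tendsto_inv₀_cobounded.comp ?_
    rw [← tendsto_norm_atTop_iff_cobounded]
    have h1 : Tendsto (fun i => ‖μ (φ i)‖) atTop atTop :=
      tendsto_atTop_mono (fun i => (hμ (φ i)).le)
        (tendsto_natCast_atTop_atTop.comp hφ.tendsto_atTop)
    have h2 := h1.const_mul_atTop (norm_pos_iff.2 Complex.two_pi_I_ne_zero)
    exact h2.congr fun i => (norm_mul _ _).symm
  -- The Wronskian equation divided by -2πiμ exp (-2πiμx). Differentiating the exponential in g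
  -- produces the product f g̃; the Wronskian of the remaining factors carries the small coefficient
  -- 1/(2πiμ).
  have heq : ∀ᶠ i in atTop, ∀ x, thetaProd τ 0 (t (φ i)) x * thetaProd τ (n (φ i)) (s (φ i)) x -
      (2 * Real.pi * I * μ (φ i))⁻¹ *
        wronskian (thetaProd τ 0 (t (φ i))) (thetaProd τ (n (φ i)) (s (φ i))) x =
      -(2 * Real.pi * I * μ (φ i))⁻¹ * C (φ i) * thetaProd τ 0 z x := by
    filter_upwards [eventually_gt_atTop 0] with i hi x
    set i' := φ i
    have hμ0 : μ i' ≠ 0 := by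
      have : (0 : ℝ) ≤ i' := Nat.cast_nonneg _
      exact norm_pos_iff.1 (this.trans_lt (hμ i'))
    have h2 : 2 * Real.pi * I * μ i' ≠ 0 := mul_ne_zero Complex.two_pi_I_ne_zero hμ0
    have h := congrFun (hW i') x
    have e1 : thetaProd τ (ν i') (s i') = fun x => exp (2 * Real.pi * I * (-μ i') * x) *
        thetaProd τ (n i') (s i') x := by
      rw [hn i', thetaProd_add]
    have e2 : thetaProd τ (-μ i') z = fun x => exp (2 * Real.pi * I * (-μ i') * x) *
        thetaProd τ 0 z x := by
      rw [← thetaProd_add, add_zero]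
    simp only [wronskian, e1, e2, Pi.smul_apply, smul_eq_mul] at h ⊢
    rw [(hasDerivAt_exp_mul (differentiable_thetaProd τ (n i') (s i') x).hasDerivAt).deriv] at h
    refine mul_left_cancel₀ (mul_ne_zero h2 (exp_ne_zero (2 * Real.pi * I * (-μ i') * x))) ?_
    have h3 := mul_inv_cancel₀ h2
    linear_combination -h + exp (2 * Real.pi * I * (-μ i') * x) *
      (C i' * thetaProd τ 0 z x - (thetaProd τ 0 (t i') x * deriv (thetaProd τ (n i') (s i')) x -
        deriv (thetaProd τ 0 (t i')) x * thetaProd τ (n i') (s i') x)) * h3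
  have hlim1 : ∀ x, Tendsto (fun i => thetaProd τ 0 (t (φ i)) x *
      thetaProd τ (n (φ i)) (s (φ i)) x - (2 * Real.pi * I * μ (φ i))⁻¹ *
        wronskian (thetaProd τ 0 (t (φ i))) (thetaProd τ (n (φ i)) (s (φ i))) x) atTop
      (𝓝 (thetaProd τ 0 t₀ x * thetaProd τ κ s₀ x)) := by
    intro x
    have p1 : Tendsto (fun i => ((0 : ℂ), t (φ i))) atTop (𝓝 (0, t₀)) :=
      tendsto_const_nhds.prodMk_nhds hlt
    have p2 : Tendsto (fun i => ((n (φ i) : ℂ), s (φ i))) atTop (𝓝 (κ, s₀)) :=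
      hlk.prodMk_nhds hls
    have a1 := ((continuous_thetaProd_param τ (k := m) x).tendsto _).comp p1
    have a2 := ((continuous_thetaProd_param τ (k := m) x).tendsto _).comp p2
    have b1 := ((continuous_deriv_thetaProd_param τ (k := m) x).tendsto _).comp p1
    have b2 := ((continuous_deriv_thetaProd_param τ (k := m) x).tendsto _).comp p2
    have := (a1.mul a2).sub (hμinf.mul ((a1.mul b2).sub (b1.mul a2)))
    rw [zero_mul, sub_zero] at this
    exact this
  have hlim2 : ∀ x, Tendsto (fun i => -(2 * Real.pi * I * μ (φ i))⁻¹ * C (φ i) *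
      thetaProd τ 0 z x) atTop (𝓝 (thetaProd τ 0 t₀ x * thetaProd τ κ s₀ x)) := fun x =>
    (hlim1 x).congr' (heq.mono fun i hi => hi x)
  obtain ⟨x₀, hx₀⟩ := Function.ne_iff.1 (thetaProd_ne_zero τ 0 z)
  have hx₀' : thetaProd τ 0 z x₀ ≠ 0 := hx₀
  set C' : ℂ := thetaProd τ 0 t₀ x₀ * thetaProd τ κ s₀ x₀ / thetaProd τ 0 z x₀
  -- Nothing is known about the constants C in advance. Evaluation at a point where ∏ θ(x - z_a) ≠ 0
  -- shows that the rescaled constants converge.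
  have hC' : Tendsto (fun i => -(2 * Real.pi * I * μ (φ i))⁻¹ * C (φ i)) atTop (𝓝 C') :=
    ((hlim2 x₀).div_const (thetaProd τ 0 z x₀)).congr fun i => mul_div_cancel_right₀ _ hx₀'
  have hfin : thetaProd τ κ (Fin.append t₀ s₀) = C' • thetaProd τ 0 z := by
    funext x
    rw [← thetaProd_append]
    exact tendsto_nhds_unique (hlim2 x) (hC'.mul_const _)
  have hC'0 : C' ≠ 0 := by
    intro h0
    rw [h0, zero_smul] at hfin
    exact thetaProd_ne_zero _ _ _ hfin
  obtain ⟨σ, hσ⟩ := exists_equiv_of_thetaProd_eq hC'0 hfin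
  have et : ∀ j, t₀ j = z (finSumFinEquiv.trans σ (.inl j)) := fun j =>
    eq_of_mem_closed_of_mem_open (ht₀ j trivial) (hz _) (by simpa using hσ (Fin.castAdd m j))
  have es : ∀ j, s₀ j = z (finSumFinEquiv.trans σ (.inr j)) := fun j =>
    eq_of_mem_closed_of_mem_open (hs₀ j trivial) (hz _) (by
      have := hσ (Fin.natAdd m j)
      rwa [Fin.append_right] at this)
  have ht1 : ∀ᶠ i in atTop, ‖t (φ i) - t₀‖ < δ := by
    simpa [dist_eq_norm] using (Metric.tendsto_nhds.1 hlt) δ hδ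
  have hs1 : ∀ᶠ i in atTop, ‖s (φ i) - s₀‖ < δ := by
    simpa [dist_eq_norm] using (Metric.tendsto_nhds.1 hls) δ hδ
  obtain ⟨i, hi1, hi2⟩ := (ht1.and hs1).exists
  obtain ⟨j, hj⟩ := hnot (φ i) (finSumFinEquiv.trans σ) fun j => by
    rw [← et]
    exact (norm_le_pi_norm (t (φ i) - t₀) j).trans_lt hi1
  rw [← es] at hj
  exact absurd ((norm_le_pi_norm (s (φ i) - s₀) j).trans_lt hi2) (not_lt.2 hj)

theorem isClosed_lattice (τ : ℍ) : IsClosed (lattice τ) := by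
  have : lattice τ = theta τ ⁻¹' {0} := by
    ext x
    exact theta_eq_zero_iff.symm
  rw [this]
  exact isClosed_singleton.preimage (differentiable_theta τ).continuous

/-- The lattice is the zero set of θ, and 0 is an isolated zero because θ'(0) ≠ 0. -/
theorem exists_pos_lattice_eq_zero (τ : ℍ) : ∃ r > 0, ∀ v ∈ lattice τ, ‖v‖ < r → v = 0 := by
  have h := (differentiable_theta τ 0).hasDerivAt.eventually_ne (c := 0)
    (deriv_theta_zero_ne_zero τ)
  rw [eventually_nhdsWithin_iff] at h
  obtain ⟨r, hr, hball⟩ := Metric.eventually_nhds_iff.1 h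
  refine ⟨r, hr, fun v hv hvr => ?_⟩
  by_contra hv0
  exact hball (by simpa using hvr) hv0 (theta_eq_zero_iff.2 hv)

/-- A radius that separates the points `z_a` modulo the lattice. -/
def IsSeparatingRadius (τ : ℍ) (w : ℂ) {n : ℕ} (z : Fin n → ℂ) (δ : ℝ) : Prop :=
  0 < δ ∧ (∀ a b, a ≠ b → ∀ x y, ‖x - z a‖ < δ → ‖y - z b‖ < δ → x - y ∉ lattice τ) ∧
    (∀ a x, ‖x - z a‖ < δ → x ∈ openParallelogram τ w) ∧
    ∀ v ∈ lattice τ, ‖v‖ ≤ n * δ → v = 0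

theorem exists_isSeparatingRadius (τ : ℍ) (w : ℂ) {n : ℕ} (z : Fin n → ℂ)
    (hz : ∀ a, z a ∈ openParallelogram τ w) (hinj : Function.Injective z) :
    ∃ δ, IsSeparatingRadius τ w z δ := by
  have h1 : ∀ a b, a ≠ b → ∀ᶠ δ in 𝓝[>] (0 : ℝ), ∀ x y, ‖x - z a‖ < δ → ‖y - z b‖ < δ →
      x - y ∉ lattice τ := by
    intro a b hab
    have hne : z a - z b ∉ lattice τ := fun h => hab (hinj (eq_of_mem_parallelogram
      (openParallelogram_subset τ w (hz a)) (openParallelogram_subset τ w (hz b)) h))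
    have hc : ContinuousAt (fun p : ℂ × ℂ => p.1 - p.2) (z a, z b) := by fun_prop
    have := hc.eventually ((isClosed_lattice τ).isOpen_compl.mem_nhds hne)
    obtain ⟨ε, hε, hball⟩ := Metric.eventually_nhds_iff.1 this
    filter_upwards [Ioo_mem_nhdsGT hε] with δ hδ x y hx hy
    exact hball (y := (x, y)) (by
      rw [Prod.dist_eq, max_lt_iff, dist_eq_norm, dist_eq_norm]
      exact ⟨hx.trans hδ.2, hy.trans hδ.2⟩)
  have h2 : ∀ a, ∀ᶠ δ in 𝓝[>] (0 : ℝ), ∀ x, ‖x - z a‖ < δ → x ∈ openParallelogram τ w := by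
    intro a
    obtain ⟨ε, hε, hball⟩ := Metric.isOpen_iff.1 (isOpen_openParallelogram τ w) _ (hz a)
    filter_upwards [Ioo_mem_nhdsGT hε] with δ hδ x hx
    exact hball (by rw [Metric.mem_ball, dist_eq_norm]; exact hx.trans hδ.2)
  have h3 : ∀ᶠ δ in 𝓝[>] (0 : ℝ), ∀ v ∈ lattice τ, ‖v‖ ≤ n * δ → v = 0 := by
    obtain ⟨r, hr, h⟩ := exists_pos_lattice_eq_zero τ
    have hc : Tendsto (fun δ : ℝ => n * δ) (𝓝[>] 0) (𝓝 0) := by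
      have : Tendsto (fun δ : ℝ => n * δ) (𝓝 0) (𝓝 (n * 0)) :=
        (continuous_const.mul continuous_id).tendsto 0
      rw [mul_zero] at this
      exact this.mono_left nhdsWithin_le_nhds
    filter_upwards [hc.eventually (gt_mem_nhds hr)] with δ hδ v hv hvn
    exact h v hv (hvn.trans_lt hδ)
  have h1' : ∀ᶠ δ in 𝓝[>] (0 : ℝ), ∀ a b, a ≠ b → ∀ x y, ‖x - z a‖ < δ → ‖y - z b‖ < δ →
      x - y ∉ lattice τ :=
    eventually_all.2 fun a => eventually_all.2 fun b => by
      by_cases hab : a = b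
      · exact Eventually.of_forall fun δ h => absurd hab h
      · exact (h1 a b hab).mono fun δ h _ => h
  obtain ⟨δ, h⟩ := ((eventually_mem_nhdsWithin (a := (0 : ℝ)) (s := Set.Ioi 0)).and
    (h1'.and ((eventually_all.2 h2).and h3))).exists
  exact ⟨δ, h⟩

/-- Exchanging the two factors of a Wronskian equation. -/
theorem wronskian_flip {τ : ℍ} {m n : ℕ} {μ C : ℂ} {t s : Fin m → ℂ} {z : Fin n → ℂ}
    (h : wronskian (thetaProd τ 0 t) (thetaProd τ (-μ) s) = C • thetaProd τ (-μ) z) :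
    wronskian (thetaProd τ 0 s) (thetaProd τ (-(-μ)) t) = (-C) • thetaProd τ (-(-μ)) z := by
  have e1 : thetaProd τ 0 s = fun x => exp (2 * Real.pi * I * μ * x) * thetaProd τ (-μ) s x := by
    rw [← thetaProd_add, add_neg_cancel]
  have e2 : thetaProd τ (-(-μ)) t = fun x => exp (2 * Real.pi * I * μ * x) * thetaProd τ 0 t x := by
    rw [← thetaProd_add, add_zero, neg_neg]
  have e3 : thetaProd τ (-(-μ)) z =
      fun x => exp (2 * Real.pi * I * (2 * μ) * x) * thetaProd τ (-μ) z x := by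
    rw [← thetaProd_add]; congr 1; ring
  rw [e1, e2, e3, wronskian_exp_mul (differentiable_thetaProd τ _ _)
    (differentiable_thetaProd τ _ _), wronskian_swap, h]
  funext x
  simp only [Pi.smul_apply, smul_eq_mul]
  ring

/-- Distinct t_i lie near distinct z_a. If t_i were congruent to its own z_a, then Wr(f, g) = -f'g
would vanish at z_a with f' ≠ 0, so some s_j would be congruent to z_a too; but the s_j are close to
other points of z. -/
theorem localized_nondegenerate {τ : ℍ} {w : ℂ} {m : ℕ} {μ C : ℂ} {t s : Fin m → ℂ}
    {z : Fin (2 * m) → ℂ} {δ : ℝ} (hδ : IsSeparatingRadius τ w z δ)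
    (h : wronskian (thetaProd τ 0 t) (thetaProd τ (-μ) s) = C • thetaProd τ (-μ) z)
    {σ : Fin m ⊕ Fin m ≃ Fin (2 * m)} (ht : ∀ j, ‖t j - z (σ (.inl j))‖ < δ)
    (hs : ∀ j, ‖s j - z (σ (.inr j))‖ < δ) :
    (∀ i j, i ≠ j → t i - t j ∉ lattice τ) ∧ ∀ i a, t i - z a ∉ lattice τ := by
  have hself : ∀ a, ‖z a - z a‖ < δ := fun a => by simpa using hδ.1
  have hdist : ∀ i j, i ≠ j → t i - t j ∉ lattice τ := fun i j hij =>
    hδ.2.1 _ _ (fun e => hij (Sum.inl_injective (σ.injective e))) _ _ (ht i) (ht j)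
  refine ⟨hdist, fun i a hia => ?_⟩
  by_cases ha : σ (.inl i) = a
  · have hf : thetaProd τ 0 t (z a) = 0 := thetaProd_eq_zero_iff.2
      ⟨i, by simpa using lattice_neg hia⟩
    have hh : thetaProd τ (-μ) z (z a) = 0 := thetaProd_eq_zero_iff.2
      ⟨a, by simpa using zero_mem_lattice τ⟩
    have hW := congrFun h (z a)
    simp only [wronskian, hf, Pi.smul_apply, hh, smul_zero, zero_mul, zero_sub, neg_eq_zero,
      mul_eq_zero] at hW
    obtain ⟨j, hj⟩ := thetaProd_eq_zero_iff.1 (hW.resolve_left (thetaProd_deriv_ne_zero hdist hf))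
    refine hδ.2.1 a (σ (.inr j)) ?_ _ _ (hself a) (hs j) hj
    rw [← ha]
    exact fun e => Sum.inl_ne_inr (σ.injective e)
  · exact hδ.2.1 _ _ ha _ _ (ht i) (hself a) hia

/-- `(μ, t, z)` is a solution of the Bethe ansatz equations all of whose terms are finite. -/
def IsBetheSolution (τ : ℍ) {m n : ℕ} (μ : ℂ) (t : Fin m → ℂ) (z : Fin n → ℂ) : Prop :=
  (∀ i j, i ≠ j → t i - t j ∉ lattice τ) ∧ (∀ i a, t i - z a ∉ lattice τ) ∧
    ∀ j, 2 * Real.pi * I * μ + 2 * ∑ k ∈ Finset.univ.erase j, rho τ (t j - t k)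
      - ∑ a, rho τ (t j - z a) = 0

/-- The coordinates of `t` and `s` are `δ`-close to those of `z`, up to a permutation. -/
def IsLocalized {m : ℕ} (z : Fin (2 * m) → ℂ) (δ : ℝ) (t s : Fin m → ℂ) : Prop :=
  ∃ σ : Fin m ⊕ Fin m ≃ Fin (2 * m), (∀ j, ‖t j - z (σ (.inl j))‖ < δ) ∧
    ∀ j, ‖s j - z (σ (.inr j))‖ < δ

theorem IsLocalized.symm {m : ℕ} {z : Fin (2 * m) → ℂ} {δ : ℝ} {t s : Fin m → ℂ}
    (h : IsLocalized z δ t s) : IsLocalized z δ s t := by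
  obtain ⟨σ, h1, h2⟩ := h
  exact ⟨(Equiv.sumComm _ _).trans σ, h2, h1⟩

/-- The lattice vector n τ + l with ν = -μ + n is a sum of 2m differences of size less than δ. A
separating radius forces it to be 0, hence n = 0. -/
theorem label_eq_of_isLocalized {τ : ℍ} {w : ℂ} {m : ℕ} {μ ν C : ℂ} {t s : Fin m → ℂ}
    {z : Fin (2 * m) → ℂ} {δ : ℝ} (hδ : IsSeparatingRadius τ w z δ) (hC : C ≠ 0)
    (h : wronskian (thetaProd τ 0 t) (thetaProd τ ν s) = C • thetaProd τ (-μ) z)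
    (hloc : IsLocalized z δ t s) : ν = -μ := by
  obtain ⟨n, l, hn, hl⟩ := wronskian_multipliers hC h
  obtain ⟨σ, ht, hs⟩ := hloc
  have hsum : ∑ a, z a = ∑ j, z (σ (.inl j)) + ∑ j, z (σ (.inr j)) := by
    rw [← Equiv.sum_comp σ, Fintype.sum_sum_type]
  have hv : n * (τ : ℂ) + l = ∑ j, (z (σ (.inl j)) - t j) + ∑ j, (z (σ (.inr j)) - s j) := by
    rw [hl, hsum, Finset.sum_sub_distrib, Finset.sum_sub_distrib]
    ring
  have hnorm : ‖n * (τ : ℂ) + l‖ ≤ (2 * m : ℕ) * δ := by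
    rw [hv]
    calc _ ≤ ∑ _j : Fin m, δ + ∑ _j : Fin m, δ :=
          (norm_add_le _ _).trans (add_le_add
            (norm_sum_le_of_le _ fun j _ => by rw [norm_sub_rev]; exact (ht j).le)
            (norm_sum_le_of_le _ fun j _ => by rw [norm_sub_rev]; exact (hs j).le))
      _ = _ := by simp; ring
  have h0 := hδ.2.2.2 _ ⟨l, n, by ring⟩ hnorm
  have := (real_add_mul_tau_inj (τ := τ) (a := l) (b := n) (c := 0) (d := 0)
    (by push_cast; linear_combination h0)).2
  have hn0 : n = 0 := by exact_mod_cast this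
  rw [hn, hn0, Int.cast_zero, add_zero]

theorem isBetheSolution_of_isLocalized {τ : ℍ} {w : ℂ} {m : ℕ} {μ C : ℂ} {t s : Fin m → ℂ}
    {z : Fin (2 * m) → ℂ} {δ : ℝ} (hδ : IsSeparatingRadius τ w z δ) (hC : C ≠ 0)
    (h : wronskian (thetaProd τ 0 t) (thetaProd τ (-μ) s) = C • thetaProd τ (-μ) z)
    (hloc : IsLocalized z δ t s) : IsBetheSolution τ μ t z := by
  obtain ⟨σ, ht, hs⟩ := hloc
  obtain ⟨h1, h2⟩ := localized_nondegenerate hδ h ht hs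
  exact ⟨h1, h2, bethe_of_wronskian hC h1 h2 (differentiable_thetaProd τ _ _) h⟩

/-- For large `μ`, solutions of the Bethe ansatz equations and solutions of the Wronskian equation
are the same, and are localized near the points `z_a`. -/
theorem exists_threshold {τ : ℍ} {w : ℂ} {m : ℕ} {z : Fin (2 * m) → ℂ}
    (hz : ∀ a, z a ∈ openParallelogram τ w) {δ : ℝ} (hδ : IsSeparatingRadius τ w z δ) :
    ∃ N : ℝ, ∀ μ : ℂ, N < ‖μ‖ →
      (∀ t : Fin m → ℂ, (∀ j, t j ∈ parallelogram τ w) → IsBetheSolution τ μ t z →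
        ∃ (s : Fin m → ℂ) (C : ℂ), (∀ j, s j ∈ parallelogram τ w) ∧ C ≠ 0 ∧
          wronskian (thetaProd τ 0 t) (thetaProd τ (-μ) s) = C • thetaProd τ (-μ) z) ∧
      ∀ (t s : Fin m → ℂ) (ν C : ℂ), (∀ j, t j ∈ parallelogram τ w) →
        (∀ j, s j ∈ parallelogram τ w) → C ≠ 0 →
        wronskian (thetaProd τ 0 t) (thetaProd τ ν s) = C • thetaProd τ (-μ) z →
        ν = -μ ∧ IsBetheSolution τ μ t z ∧ IsBetheSolution τ (-μ) s z ∧ IsLocalized z δ t s := by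
  obtain ⟨N, hN⟩ := exists_localization τ w m z hz hδ.1
  obtain ⟨R, hR⟩ := norm_mem_parallelogram_bound τ w
  -- K bounds |l| in any relation 2 ∑ t_j - ∑ z_a = p + l τ with t in the parallelogram. So |μ| > K
  -- rules out the exceptional case μ = -l of `exists_partner`.
  set K : ℝ := (2 * ∑ _j : Fin m, R + ∑ _a : Fin (2 * m), R) / τ.im with hK
  refine ⟨max N K, fun μ hμ => ?_⟩
  have hμN : N < ‖μ‖ := (le_max_left _ _).trans_lt hμ
  have hμK : K < ‖μ‖ := (le_max_right _ _).trans_lt hμ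
  have key : ∀ (t s : Fin m → ℂ) (ν C : ℂ), (∀ j, t j ∈ parallelogram τ w) →
        (∀ j, s j ∈ parallelogram τ w) → C ≠ 0 →
        wronskian (thetaProd τ 0 t) (thetaProd τ ν s) = C • thetaProd τ (-μ) z →
        ν = -μ ∧ IsBetheSolution τ μ t z ∧ IsBetheSolution τ (-μ) s z ∧ IsLocalized z δ t s := by
    intro t s ν C ht hs hC h
    have hloc : IsLocalized z δ t s := hN μ hμN t s ν C ht hs hC h
    have hν := label_eq_of_isLocalized hδ hC h hloc
    subst hν
    exact ⟨rfl, isBetheSolution_of_isLocalized hδ hC h hloc,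
      isBetheSolution_of_isLocalized hδ (neg_ne_zero.2 hC) (wronskian_flip h) hloc.symm, hloc⟩
  refine ⟨fun t ht hb => ?_, key⟩
  obtain ⟨g, ⟨A, B, hA, hB, hg⟩, hW⟩ := exists_partner hb.1 hb.2.1 hb.2.2 (fun p l hpl hμl => by
    have h1 := norm_int_le_of_eq (τ := τ) (n := l) (l := p) (v := 2 * ∑ j, t j - ∑ a, z a)
      (by rw [hpl]; ring)
    have h2 : ‖2 * ∑ j, t j - ∑ a, z a‖ ≤ 2 * ∑ _j : Fin m, R + ∑ _a : Fin (2 * m), R := by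
      refine (norm_sub_le _ _).trans (add_le_add ?_ ?_)
      · rw [norm_mul, Complex.norm_ofNat]
        exact mul_le_mul_of_nonneg_left (norm_sum_le_of_le _ fun j _ =>
          hR _ (parallelogram_subset_closed τ w (ht j))) zero_le_two
      · exact norm_sum_le_of_le _ fun a _ =>
          hR _ (parallelogram_subset_closed τ w (openParallelogram_subset τ w (hz a)))
    have h3 := h1.trans (div_le_div_of_nonneg_right h2 τ.im_pos.le)
    rw [hμl, norm_neg] at hμK
    exact absurd hμK (not_lt.2 h3))
  have hg0 : g ≠ 0 := by
    rintro rfl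
    refine thetaProd_ne_zero τ (-μ) z ?_
    rw [← hW]
    funext x
    simp [wronskian]
  obtain ⟨C, ν, s, hC, hs, hgs⟩ := thetaSpace_factor w hA hB hg hg0
  have h := wronskian_smul 1 C (thetaProd τ 0 t) (thetaProd τ ν s)
  rw [one_smul, ← hgs, hW, one_mul] at h
  have h' : wronskian (thetaProd τ 0 t) (thetaProd τ ν s) = C⁻¹ • thetaProd τ (-μ) z := by
    rw [h, smul_smul, inv_mul_cancel₀ hC, one_smul]
  have hν := (key t s ν C⁻¹ ht hs (inv_ne_zero hC) h').1
  exact ⟨s, C⁻¹, hs, inv_ne_zero hC, hν ▸ h'⟩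

/-! ### Solutions near a subset of the points `z_a` -/

/-- For small `ε`, the equation `u = ε Ψ(u)` with `Ψ` of class `C¹` has a unique small solution. -/
theorem exists_unique_small_fixedPoint {E : Type*} [NormedAddCommGroup E] [NormedSpace ℂ E]
    [CompleteSpace E] {Ψ : E → E} (h : ContDiffAt ℂ 1 Ψ 0) :
    ∃ r₀ > 0, ∀ r, 0 < r → r < r₀ → ∃ e₀ > 0, ∀ ε : ℂ, ‖ε‖ < e₀ →
      (∃ u, ‖u‖ < r ∧ u = ε • Ψ u) ∧
      ∀ u v, ‖u‖ < r → ‖v‖ < r → u = ε • Ψ u → v = ε • Ψ v → u = v := by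
  obtain ⟨K, S, hS, hK⟩ := h.exists_lipschitzOnWith
  obtain ⟨r₀, hr₀, hball⟩ := Metric.mem_nhds_iff.1 hS
  -- Only the bound on ε depends on r: the same radius can serve for localization and for
  -- uniqueness, with μ taken large afterwards.
  refine ⟨r₀, hr₀, fun r hr hrr => ?_⟩
  have hlip : ∀ u v : E, ‖u‖ < r → ‖v‖ < r → ‖Ψ u - Ψ v‖ ≤ K * ‖u - v‖ := by
    intro u v hu hv
    have := hK.dist_le_mul u (hball (by simpa using hu.trans hrr)) v
      (hball (by simpa using hv.trans hrr))
    simpa [dist_eq_norm] using this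
  set M : ℝ := ‖Ψ 0‖ + K * r + 1 with hM
  have hM0 : 0 < M := by positivity
  -- M bounds Ψ on the r-ball, so the first term makes ε Ψ map the closed r/2-ball to itself. The
  -- second gives contraction factor 1/2; K + 1 avoids division by zero.
  refine ⟨min (r / 2 / M) (1 / (2 * (K + 1))), lt_min (by positivity) (by positivity),
    fun ε hε => ?_⟩
  have h1 : ‖ε‖ * M ≤ r / 2 := by
    have := (hε.trans_le (min_le_left _ _)).le
    rwa [le_div_iff₀ hM0] at this
  have h2 : ‖ε‖ * K ≤ 1 / 2 := by
    have := (hε.trans_le (min_le_right _ _)).le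
    rw [le_div_iff₀ (by positivity)] at this
    nlinarith [norm_nonneg ε, K.2]
  have hcontr : ∀ u v : E, ‖u‖ < r → ‖v‖ < r → ‖ε • Ψ u - ε • Ψ v‖ ≤ 1 / 2 * ‖u - v‖ := by
    intro u v hu hv
    rw [← smul_sub, norm_smul]
    calc ‖ε‖ * ‖Ψ u - Ψ v‖ ≤ ‖ε‖ * (K * ‖u - v‖) :=
          mul_le_mul_of_nonneg_left (hlip u v hu hv) (norm_nonneg _)
      _ = ‖ε‖ * K * ‖u - v‖ := by ring
      _ ≤ _ := mul_le_mul_of_nonneg_right h2 (norm_nonneg _)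
  constructor
  · have hlt : ∀ u ∈ Metric.closedBall (0 : E) (r / 2), ‖u‖ < r := fun u hu =>
      (mem_closedBall_zero_iff.1 hu).trans_lt (half_lt_self hr)
    have hmaps : Set.MapsTo (fun u => ε • Ψ u) (Metric.closedBall (0 : E) (r / 2))
        (Metric.closedBall 0 (r / 2)) := by
      intro u hu
      rw [mem_closedBall_zero_iff, norm_smul]
      refine (mul_le_mul_of_nonneg_left ?_ (norm_nonneg ε)).trans h1
      have hl := hlip u 0 (hlt u hu) (by simpa using hr)
      rw [sub_zero] at hl
      calc ‖Ψ u‖ = ‖Ψ 0 + (Ψ u - Ψ 0)‖ := by rw [add_sub_cancel]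
        _ ≤ ‖Ψ 0‖ + ‖Ψ u - Ψ 0‖ := norm_add_le _ _
        _ ≤ ‖Ψ 0‖ + K * r := add_le_add le_rfl
            (hl.trans (mul_le_mul_of_nonneg_left (hlt u hu).le K.2))
        _ ≤ M := by rw [hM]; linarith
    have hc : ContractingWith (1 / 2 : NNReal) (hmaps.restrict (fun u => ε • Ψ u) _ _) := by
      refine ⟨by norm_num, LipschitzWith.of_dist_le_mul fun u v => ?_⟩
      have := hcontr u v (hlt _ u.2) (hlt _ v.2)
      simpa [Subtype.dist_eq, dist_eq_norm] using this
    obtain ⟨u, hu, hfix, -⟩ := ContractingWith.exists_fixedPoint'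
      (Metric.isClosed_closedBall.isComplete) hmaps hc (x := 0)
      (Metric.mem_closedBall_self (by positivity)) (edist_ne_top _ _)
    exact ⟨u, hlt u hu, hfix.symm⟩
  · intro u v hu hv hu' hv'
    have := hcontr u v hu hv
    rw [← hu', ← hv'] at this
    have h0 : ‖u - v‖ = 0 := le_antisymm (by linarith) (norm_nonneg _)
    exact sub_eq_zero.1 (norm_eq_zero.1 h0)

/-- The function `u ρ(u)`, extended analytically to `u = 0`. -/
def rhoMul (τ : ℍ) (u : ℂ) : ℂ := deriv (theta τ) u / dslope (theta τ) 0 u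

theorem rhoMul_zero (τ : ℍ) : rhoMul τ 0 = 1 := by
  rw [rhoMul, dslope_same, div_self (deriv_theta_zero_ne_zero τ)]

theorem rhoMul_of_ne {τ : ℍ} {u : ℂ} (hu : u ≠ 0) : rhoMul τ u = u * rho τ u := by
  rw [rhoMul, rho, dslope_of_ne _ hu, slope_def_field, theta_zero, sub_zero, sub_zero,
    div_div_eq_mul_div]
  ring

theorem contDiffAt_rho {τ : ℍ} {x : ℂ} (hx : x ∉ lattice τ) : ContDiffAt ℂ 1 (rho τ) x :=
  ((differentiable_deriv (differentiable_theta τ)).contDiff.contDiffAt).div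
    (differentiable_theta τ).contDiff.contDiffAt (theta_ne_zero hx)

theorem contDiffAt_rhoMul (τ : ℍ) : ContDiffAt ℂ 1 (rhoMul τ) 0 := by
  have hd : Differentiable ℂ (dslope (theta τ) 0) := differentiableOn_univ.1
    ((Complex.differentiableOn_dslope univ_mem).2 (differentiable_theta τ).differentiableOn)
  exact ((differentiable_deriv (differentiable_theta τ)).contDiff.contDiffAt).div
    hd.contDiff.contDiffAt (by rw [dslope_same]; exact deriv_theta_zero_ne_zero τ)

/-- The Bethe ansatz equations near `t = z ∘ a` in the form `u = ε Ψ(u)`. -/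
def betheMap (τ : ℍ) {m n : ℕ} (z : Fin n → ℂ) (a : Fin m → Fin n) (u : Fin m → ℂ) : Fin m → ℂ :=
  fun j => rhoMul τ (u j) + u j * ((∑ b ∈ Finset.univ.erase (a j), rho τ (z (a j) + u j - z b)) -
    2 * ∑ k ∈ Finset.univ.erase j, rho τ (z (a j) + u j - (z (a k) + u k)))

/-- Of all the terms only ρ(t_j - z_(a j)) = ρ(u_j) is singular at u = 0, and `rhoMul` absorbs its
simple pole. The other arguments of ρ are outside the lattice at u = 0. -/
theorem contDiffAt_betheMap {τ : ℍ} {m n : ℕ} {z : Fin n → ℂ} {a : Fin m → Fin n}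
    (ha : Function.Injective a) (hz : ∀ b c, b ≠ c → z b - z c ∉ lattice τ) :
    ContDiffAt ℂ 1 (betheMap τ z a) 0 := by
  have hp : ∀ j : Fin m, ContDiffAt ℂ 1 (fun u : Fin m → ℂ => u j) 0 := fun j =>
    (contDiff_apply ℂ ℂ j).contDiffAt
  refine contDiffAt_pi.2 fun j => ?_
  have h1 : ContDiffAt ℂ 1 (fun u : Fin m → ℂ => rhoMul τ (u j)) 0 :=
    ContDiffAt.comp (f := fun u : Fin m → ℂ => u j) (0 : Fin m → ℂ)
      (contDiffAt_rhoMul τ) (hp j)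
  have h2 : ∀ b ∈ Finset.univ.erase (a j),
      ContDiffAt ℂ 1 (fun u : Fin m → ℂ => rho τ (z (a j) + u j - z b)) 0 := fun b hb =>
    ContDiffAt.comp (f := fun u : Fin m → ℂ => z (a j) + u j - z b) (0 : Fin m → ℂ)
      (contDiffAt_rho (by simpa using hz _ _ (Finset.ne_of_mem_erase hb).symm))
      ((contDiffAt_const.add (hp j)).sub contDiffAt_const)
  have h3 : ∀ k ∈ Finset.univ.erase j,
      ContDiffAt ℂ 1 (fun u : Fin m → ℂ => rho τ (z (a j) + u j - (z (a k) + u k))) 0 :=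
    fun k hk => ContDiffAt.comp (f := fun u : Fin m → ℂ => z (a j) + u j - (z (a k) + u k))
      (0 : Fin m → ℂ) (contDiffAt_rho (by
        simpa using hz _ _ (ha.ne (Finset.ne_of_mem_erase hk).symm)))
      ((contDiffAt_const.add (hp j)).sub (contDiffAt_const.add (hp k)))
  exact h1.add ((hp j).mul ((ContDiffAt.sum h2).sub (contDiffAt_const.mul (ContDiffAt.sum h3))))

theorem isBetheSolution_iff_fixedPoint {τ : ℍ} {w : ℂ} {m : ℕ} {μ : ℂ} (hμ : μ ≠ 0)
    {z : Fin (2 * m) → ℂ} {δ : ℝ} (hδ : IsSeparatingRadius τ w z δ) {a : Fin m → Fin (2 * m)}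
    (ha : Function.Injective a) {u : Fin m → ℂ} (hu : ‖u‖ < δ) :
    IsBetheSolution τ μ (fun j => z (a j) + u j) z ↔
      u = (2 * Real.pi * I * μ)⁻¹ • betheMap τ z a u := by
  have h2 : 2 * Real.pi * I * μ ≠ 0 := mul_ne_zero Complex.two_pi_I_ne_zero hμ
  have huj : ∀ j, ‖z (a j) + u j - z (a j)‖ < δ := fun j => by
    rw [add_sub_cancel_left]
    exact (norm_le_pi_norm u j).trans_lt hu
  have hdist : ∀ i j, i ≠ j → (z (a i) + u i) - (z (a j) + u j) ∉ lattice τ := fun i j hij =>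
    hδ.2.1 _ _ (ha.ne hij) _ _ (huj i) (huj j)
  have hsum : ∀ j, ∑ b, rho τ (z (a j) + u j - z b) = rho τ (u j) +
      ∑ b ∈ Finset.univ.erase (a j), rho τ (z (a j) + u j - z b) := fun j => by
    rw [← Finset.add_sum_erase _ _ (Finset.mem_univ (a j)), add_sub_cancel_left]
  constructor
  · rintro ⟨-, h, hb⟩
    funext j
    have hj0 : u j ≠ 0 := fun h0 => h j (a j) (by
      simpa [h0] using zero_mem_lattice τ)
    rw [Pi.smul_apply, smul_eq_mul, eq_inv_mul_iff_mul_eq₀ h2]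
    simp only [betheMap, rhoMul_of_ne hj0]
    have := hb j
    rw [hsum] at this
    linear_combination u j * this
  · intro h
    have hj : ∀ j, 2 * Real.pi * I * μ * u j = betheMap τ z a u j := fun j => by
      have := congrFun h j
      rwa [Pi.smul_apply, smul_eq_mul, eq_inv_mul_iff_mul_eq₀ h2] at this
    -- Multiplication of the j-th equation by u_j is reversible: if u_j = 0, the j-th component of
    -- `betheMap` is `rhoMul τ 0 = 1`, not 0.
    have hj0 : ∀ j, u j ≠ 0 := by
      intro j h0
      have := hj j
      simp [betheMap, h0, rhoMul_zero] at this
    refine ⟨hdist, fun i b => ?_, fun j => ?_⟩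
    · by_cases hb : a i = b
      · subst hb
        rw [add_sub_cancel_left]
        intro hl
        refine hj0 i (hδ.2.2.2 _ hl ?_)
        refine (norm_le_pi_norm u i).trans (hu.le.trans ?_)
        have hm : (1 : ℝ) ≤ (2 * m : ℕ) := by
          have := i.pos
          exact_mod_cast (by omega : 1 ≤ 2 * m)
        have := hδ.1
        nlinarith
      · exact hδ.2.1 _ _ hb _ _ (huj i) (by simpa using hδ.1)
    · have := hj j
      simp only [betheMap, rhoMul_of_ne (hj0 j)] at this
      rw [hsum]
      refine mul_left_cancel₀ (hj0 j) ?_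
      linear_combination this

/-- There are arbitrarily small `δ` such that for all large `μ`, near each `m`-element subset of
the points `z_a` there is exactly one solution of the Bethe ansatz equations. -/
theorem exists_unique_near {τ : ℍ} {w : ℂ} {m : ℕ} {z : Fin (2 * m) → ℂ}
    (hz : ∀ a, z a ∈ openParallelogram τ w) (hinj : Function.Injective z) :
    ∃ δ, IsSeparatingRadius τ w z δ ∧ ∃ N : ℝ, ∀ μ : ℂ, N < ‖μ‖ →
      ∀ a : Fin m → Fin (2 * m), Function.Injective a →
        (∃ t, IsBetheSolution τ μ t z ∧ ∀ j, ‖t j - z (a j)‖ < δ) ∧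
        ∀ t t', IsBetheSolution τ μ t z → IsBetheSolution τ μ t' z →
          (∀ j, ‖t j - z (a j)‖ < δ) → (∀ j, ‖t' j - z (a j)‖ < δ) → t = t' := by
  classical
  obtain ⟨δ₀, hδ₀⟩ := exists_isSeparatingRadius τ w z hz hinj
  have hzz : ∀ b c, b ≠ c → z b - z c ∉ lattice τ := fun b c hbc =>
    hδ₀.2.1 b c hbc _ _ (by simpa using hδ₀.1) (by simpa using hδ₀.1)
  have key : ∀ a : Fin m → Fin (2 * m), ∃ r₀ > 0, Function.Injective a →
      ∀ r, 0 < r → r < r₀ → ∃ e₀ > 0, ∀ ε : ℂ, ‖ε‖ < e₀ →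
      (∃ u, ‖u‖ < r ∧ u = ε • betheMap τ z a u) ∧
      ∀ u v, ‖u‖ < r → ‖v‖ < r → u = ε • betheMap τ z a u → v = ε • betheMap τ z a v →
        u = v := by
    intro a
    by_cases ha : Function.Injective a
    · obtain ⟨r₀, hr₀, h⟩ := exists_unique_small_fixedPoint (contDiffAt_betheMap ha hzz)
      exact ⟨r₀, hr₀, fun _ => h⟩
    -- A dummy radius for non-injective a, so that the radii form a family over the finite type of
    -- all a and one δ can lie below all of them.
    · exact ⟨1, one_pos, fun h => absurd h ha⟩
  choose r₀ hr₀ hkey using key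
  obtain ⟨δ, hδ0, hδlt⟩ : ∃ δ > 0, δ < δ₀ ∧ ∀ a, δ < r₀ a := by
    have h1 : ∀ᶠ δ in 𝓝[>] (0 : ℝ), ∀ a, δ < r₀ a := eventually_all.2 fun a =>
      nhdsWithin_le_nhds (gt_mem_nhds (hr₀ a))
    have h2 : ∀ᶠ δ in 𝓝[>] (0 : ℝ), δ < δ₀ := nhdsWithin_le_nhds (gt_mem_nhds hδ₀.1)
    obtain ⟨δ, h⟩ := ((eventually_mem_nhdsWithin (a := (0 : ℝ)) (s := Set.Ioi 0)).and
      (h2.and h1)).exists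
    exact ⟨δ, h.1, h.2⟩
  have hδ : IsSeparatingRadius τ w z δ := by
    refine ⟨hδ0, fun b c hbc x y hx hy => hδ₀.2.1 b c hbc x y (hx.trans hδlt.1)
      (hy.trans hδlt.1), fun b x hx => hδ₀.2.2.1 b x (hx.trans hδlt.1), fun v hv hvn =>
      hδ₀.2.2.2 v hv (hvn.trans (mul_le_mul_of_nonneg_left hδlt.1.le (Nat.cast_nonneg _)))⟩
  have key2 : ∀ a : Fin m → Fin (2 * m), ∃ e₀ > 0, Function.Injective a → ∀ ε : ℂ, ‖ε‖ < e₀ →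
      (∃ u, ‖u‖ < δ ∧ u = ε • betheMap τ z a u) ∧
      ∀ u v, ‖u‖ < δ → ‖v‖ < δ → u = ε • betheMap τ z a u → v = ε • betheMap τ z a v →
        u = v := by
    intro a
    by_cases ha : Function.Injective a
    · obtain ⟨e₀, he₀, h⟩ := hkey a ha δ hδ0 (hδlt.2 a)
      exact ⟨e₀, he₀, fun _ => h⟩
    · exact ⟨1, one_pos, fun h => absurd h ha⟩
  choose e₀ he₀ hkey2 using key2
  obtain ⟨e, he, hea⟩ : ∃ e > 0, ∀ a, e < e₀ a := by
    have h1 : ∀ᶠ e in 𝓝[>] (0 : ℝ), ∀ a, e < e₀ a := eventually_all.2 fun a =>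
      nhdsWithin_le_nhds (gt_mem_nhds (he₀ a))
    obtain ⟨e, h⟩ := ((eventually_mem_nhdsWithin (a := (0 : ℝ)) (s := Set.Ioi 0)).and h1).exists
    exact ⟨e, h.1, h.2⟩
  refine ⟨δ, hδ, e⁻¹, fun μ hμ a ha => ?_⟩
  have hμpos : 0 < ‖μ‖ := (inv_pos.2 he).trans hμ
  have hμ0 : μ ≠ 0 := norm_pos_iff.1 hμpos
  have hε : ‖(2 * Real.pi * I * μ)⁻¹‖ < e₀ a := by
    refine lt_trans ?_ (hea a)
    rw [norm_inv, inv_lt_comm₀ (norm_pos_iff.2 (mul_ne_zero Complex.two_pi_I_ne_zero hμ0)) he,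
      norm_mul]
    refine hμ.trans_le ?_
    have h1 : (1 : ℝ) ≤ ‖(2 * Real.pi * I : ℂ)‖ := by
      simp [abs_of_pos Real.pi_pos]
      linarith [Real.pi_gt_three]
    nlinarith
  obtain ⟨⟨u, hu, hfix⟩, huniq⟩ := hkey2 a ha _ hε
  have hnorm : ∀ t : Fin m → ℂ, (∀ j, ‖t j - z (a j)‖ < δ) → ‖fun j => t j - z (a j)‖ < δ :=
    fun t ht => (pi_norm_lt_iff hδ0).2 ht
  have heq : ∀ t : Fin m → ℂ, (fun j => z (a j) + (t j - z (a j))) = t := fun t =>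
    funext fun j => by ring
  refine ⟨⟨fun j => z (a j) + u j, (isBetheSolution_iff_fixedPoint hμ0 hδ ha hu).2 hfix,
    fun j => by
      rw [add_sub_cancel_left]
      exact (norm_le_pi_norm u j).trans_lt hu⟩, fun t t' hb hb' ht ht' => ?_⟩
  have e1 := (isBetheSolution_iff_fixedPoint hμ0 hδ ha (hnorm t ht)).1 (by rwa [heq])
  have e2 := (isBetheSolution_iff_fixedPoint hμ0 hδ ha (hnorm t' ht')).1 (by rwa [heq])
  have := huniq _ _ (hnorm t ht) (hnorm t' ht') e1 e2
  rw [← heq t, ← heq t']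
  funext j
  have := congrFun this j
  rw [this]

/-! ### Points of projective space -/

theorem mk_eq_mk_of_smul {f g : ℂ → ℂ} (hf : f ≠ 0) (hg : g ≠ 0) {C : ℂ} (h : f = C • g) :
    Projectivization.mk ℂ f hf = Projectivization.mk ℂ g hg :=
  (Projectivization.mk_eq_mk_iff' ℂ f g hf hg).2 ⟨C, h.symm⟩

theorem exists_smul_of_mk_eq_mk {f g : ℂ → ℂ} {hf : f ≠ 0} {hg : g ≠ 0}
    (h : Projectivization.mk ℂ f hf = Projectivization.mk ℂ g hg) : ∃ C : ℂ, C ≠ 0 ∧ f = C • g := by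
  obtain ⟨C, hC⟩ := (Projectivization.mk_eq_mk_iff' ℂ f g hf hg).1 h
  refine ⟨C, ?_, hC.symm⟩
  rintro rfl
  exact hf (by rw [← hC, zero_smul])

theorem rep_mk_eq_smul {f : ℂ → ℂ} (hf : f ≠ 0) :
    ∃ C : ℂ, C ≠ 0 ∧ (Projectivization.mk ℂ f hf).rep = C • f := by
  obtain ⟨a, ha⟩ := Projectivization.exists_smul_eq_mk_rep ℂ f hf
  exact ⟨a, a.ne_zero, ha.symm⟩

theorem wronskianEq_mk_iff {f g h : ℂ → ℂ} {hf : f ≠ 0} {hg : g ≠ 0} {hh : h ≠ 0} :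
    WronskianEq (Projectivization.mk ℂ f hf) (Projectivization.mk ℂ g hg)
      (Projectivization.mk ℂ h hh) ↔ ∃ C : ℂ, C ≠ 0 ∧ wronskian f g = C • h := by
  obtain ⟨a, ha, hfa⟩ := rep_mk_eq_smul hf
  obtain ⟨b, hb, hgb⟩ := rep_mk_eq_smul hg
  rw [WronskianEq, hfa, hgb, wronskian_smul]
  have hab : a * b ≠ 0 := mul_ne_zero ha hb
  constructor
  · rintro ⟨hW, e⟩
    obtain ⟨C, hC, e⟩ := exists_smul_of_mk_eq_mk e
    refine ⟨(a * b)⁻¹ * C, mul_ne_zero (inv_ne_zero hab) hC, ?_⟩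
    rw [← smul_smul, ← e, smul_smul, inv_mul_cancel₀ hab, one_smul]
  · rintro ⟨C, hC, e⟩
    have h1 : (a * b) • wronskian f g = (a * b * C) • h := by rw [e, smul_smul]
    refine ⟨?_, mk_eq_mk_of_smul _ _ h1⟩
    rw [h1]
    exact smul_ne_zero (mul_ne_zero hab hC) hh

theorem WronskianEq.unique {p q r r' : ProjFun} (h : WronskianEq p q r)
    (h' : WronskianEq p q r') : r = r' := by
  obtain ⟨_, rfl⟩ := h
  obtain ⟨_, rfl⟩ := h'
  rfl

theorem expMul_thetaPoint (τ : ℍ) (ν κ : ℂ) {k : ℕ} (t : Fin k → ℂ) :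
    expMul ν (thetaPoint τ κ t) = thetaPoint τ (ν + κ) t := by
  rw [thetaPoint, expMul, Projectivization.map_mk, thetaPoint]
  refine mk_eq_mk_of_smul _ _ (C := 1) ?_
  rw [one_smul, thetaProd_add]
  rfl

theorem thetaPoint_comp_perm (τ : ℍ) (κ : ℂ) {k : ℕ} (t : Fin k → ℂ) (σ : Equiv.Perm (Fin k)) :
    thetaPoint τ κ (t ∘ σ) = thetaPoint τ κ t := by
  refine mk_eq_mk_of_smul _ _ (C := 1) ?_
  rw [one_smul]
  funext x
  simp only [thetaProd, Function.comp_apply]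
  rw [Equiv.prod_comp σ fun j => theta τ (x - t j)]

theorem thetaProd_update (τ : ℍ) (κ : ℂ) {k : ℕ} (t : Fin k → ℂ) (j : Fin k) (y x : ℂ) :
    thetaProd τ κ (Function.update t j y) x =
      exp (2 * Real.pi * I * κ * x) * (theta τ (x - y) * thetaCofactor τ t j x) := by
  rw [thetaProd, ← Finset.mul_prod_erase _ _ (Finset.mem_univ j), Function.update_self,
    thetaCofactor]
  congr 2
  exact Finset.prod_congr rfl fun i hi => by rw [Function.update_of_ne (Finset.ne_of_mem_erase hi)]

theorem thetaProd_eq_mul_cofactor (τ : ℍ) (κ : ℂ) {k : ℕ} (t : Fin k → ℂ) (j : Fin k) (x : ℂ) :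
    thetaProd τ κ t x =
      exp (2 * Real.pi * I * κ * x) * (theta τ (x - t j) * thetaCofactor τ t j x) := by
  rw [← thetaProd_update, Function.update_eq_self]

theorem thetaPoint_update_add_one (τ : ℍ) (κ : ℂ) {k : ℕ} (t : Fin k → ℂ) (j : Fin k) :
    thetaPoint τ κ (Function.update t j (t j + 1)) = thetaPoint τ κ t := by
  refine mk_eq_mk_of_smul _ _ (C := -1) ?_
  funext x
  have h := theta_add_one τ (x - (t j + 1))
  rw [show x - (t j + 1) + 1 = x - t j by ring] at h
  rw [thetaProd_update, Pi.smul_apply, thetaProd_eq_mul_cofactor τ κ t j, h, smul_eq_mul]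
  ring

/-- The multiplier of θ under τ is an exponential in x, so moving a zero by τ raises the label by 1.
This accounts for the changes of μ in the elementary moves. -/
theorem thetaPoint_update_add_tau (τ : ℍ) (κ : ℂ) {k : ℕ} (t : Fin k → ℂ) (j : Fin k) :
    thetaPoint τ κ (Function.update t j (t j + τ)) = thetaPoint τ (κ + 1) t := by
  refine mk_eq_mk_of_smul _ _ (C := -exp (-(Real.pi * I * τ) - 2 * Real.pi * I * t j)) ?_
  funext x
  have h := theta_add_tau τ (x - (t j + τ))
  rw [show x - (t j + τ) + τ = x - t j by ring] at h
  rw [thetaProd_update, Pi.smul_apply, thetaProd_eq_mul_cofactor τ (κ + 1) t j, h, smul_eq_mul]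
  have e : exp (2 * Real.pi * I * κ * x) = exp (-(Real.pi * I * τ) - 2 * Real.pi * I * t j) *
      (exp (2 * Real.pi * I * (κ + 1) * x) *
        exp (-(Real.pi * I * τ) - 2 * Real.pi * I * (x - (t j + τ)))) := by
    rw [← exp_add, ← exp_add]
    congr 1
    ring
  rw [e]
  ring

/-- Congruent zeros in one parallelogram are equal, so the zero sums agree. The multipliers then
give ν - ν' = n with n τ an integer, hence n = 0. -/
theorem thetaPoint_injective {τ : ℍ} {w ν ν' : ℂ} {k : ℕ} {u v : Fin k → ℂ}
    (hu : ∀ j, u j ∈ parallelogram τ w) (hv : ∀ j, v j ∈ parallelogram τ w)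
    (h : thetaPoint τ ν u = thetaPoint τ ν' v) :
    ν = ν' ∧ ∃ σ : Equiv.Perm (Fin k), u = v ∘ σ := by
  obtain ⟨C, hC, e⟩ := exists_smul_of_mk_eq_mk h
  obtain ⟨σ, hσ⟩ := exists_equiv_of_thetaProd_eq hC e
  have huv : u = v ∘ σ := funext fun i => eq_of_mem_parallelogram (hu i) (hv (σ i)) (hσ i)
  refine ⟨?_, σ, huv⟩
  have h1 := thetaProd_mem τ ν u
  have h2 := Submodule.smul_mem _ C (thetaProd_mem τ ν' v)
  rw [e] at h1
  obtain ⟨hA, hB⟩ := thetaSpace_unique (smul_ne_zero hC (thetaProd_ne_zero τ ν' v)) h1 h2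
  obtain ⟨n, hn⟩ := exp_eq_exp_int hA
  obtain ⟨l, hl⟩ := exp_eq_exp_int hB
  have hs : ∑ j, u j = ∑ j, v j := by
    rw [huv]
    exact Equiv.sum_comp σ v
  rw [hs] at hl
  have h0 := (real_add_mul_tau_inj (τ := τ) (a := 0) (b := n) (c := l) (d := 0)
    (by push_cast; linear_combination hl - hn * τ)).2
  have hn0 : n = 0 := by exact_mod_cast h0
  rw [hn, hn0, Int.cast_zero, add_zero]

theorem WronskianEq.expMul {p q r : ProjFun} (h : WronskianEq p q r)
    (hp : Differentiable ℂ p.rep) (hq : Differentiable ℂ q.rep) (ν : ℂ) :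
    WronskianEq (expMul ν p) (expMul ν q) (expMul (2 * ν) r) := by
  obtain ⟨hW, rfl⟩ := h
  conv => congr; · rw [← p.mk_rep]
          · rw [← q.mk_rep]
  simp only [EllipticBethe.expMul, Projectivization.map_mk]
  rw [wronskianEq_mk_iff]
  refine ⟨1, one_ne_zero, ?_⟩
  rw [one_smul]
  exact wronskian_exp_mul hp hq ν

/-- In a pair from `P_{m,1} × (P_m - P_{m,1})`, the second entry is determined by the first one and
by the Wronskian. -/
theorem pairDomain_snd_unique {τ : ℍ} {m : ℕ} {p q q' h : ProjFun} (hP : (p, q) ∈ pairDomain τ m)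
    (hQ : (p, q') ∈ pairDomain τ m) (h1 : WronskianEq p q h) (h2 : WronskianEq p q' h) :
    q = q' := by
  obtain ⟨⟨B, hB, hf⟩, ⟨A₁, hA₁, B₁, hB₁, hg⟩, hq1⟩ := hP
  obtain ⟨-, ⟨A₂, hA₂, B₂, hB₂, hg'⟩, -⟩ := hQ
  simp only at hf hg hg' hq1
  obtain ⟨hW1, e1⟩ := h1
  obtain ⟨hW2, e2⟩ := h2
  obtain ⟨a, ha, e⟩ := exists_smul_of_mk_eq_mk (e1.trans e2.symm)
  have hA1 : A₁ ≠ 1 := by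
    rintro rfl
    exact hq1 ⟨B₁, hB₁, hg⟩
  have hT1 := wronskian_mem hf hg
  have hT2 := Submodule.smul_mem _ a (wronskian_mem hf hg')
  rw [← e] at hT2
  have hA := (thetaSpace_unique hW1 hT1 hT2).1
  rw [one_mul, one_mul] at hA
  subst hA
  have hW : wronskian p.rep (q.rep + (-a) • q'.rep) = 0 := by
    funext x
    have h := congrFun e x
    have h' := congrFun (wronskian_smul 1 (-a) p.rep q'.rep) x
    rw [wronskian_add_right hg.1 (hg'.1.const_smul _)]
    rw [one_smul] at h'
    rw [h', h]
    simp
  obtain ⟨κ, hκ⟩ := eq_smul_of_wronskian_eq_zero hf.1 (hg.1.add (hg'.1.const_smul (-a)))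
    p.rep_nonzero hW
  -- q - a q' = κ p compares first multipliers A₁ ≠ 1 and 1, which is impossible unless κ = 0.
  have hκ0 : κ = 0 := by
    by_contra hκ0
    obtain ⟨x, hx⟩ := Function.ne_iff.1 p.rep_nonzero
    have hx' : p.rep x ≠ 0 := hx
    have h1 := congrFun hκ x
    have h2 := congrFun hκ (x + 1)
    simp only [Pi.add_apply, Pi.smul_apply, smul_eq_mul, hf.2.1, hg.2.1, hg'.2.1] at h1 h2
    have h3 : ((-1 : ℂ) ^ m) ≠ 0 := pow_ne_zero _ (by norm_num)
    refine hA1 (mul_right_cancel₀ (mul_ne_zero h3 (mul_ne_zero hκ0 hx')) ?_)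
    linear_combination h2 - A₁ * (-1) ^ m * h1
  rw [hκ0, zero_smul] at hκ
  rw [← q.mk_rep, ← q'.mk_rep]
  refine mk_eq_mk_of_smul _ _ (C := a) ?_
  rw [neg_smul, ← sub_eq_add_neg] at hκ
  exact sub_eq_zero.1 hκ

/-! ### Equivalence of solutions -/

theorem rho_add_lattice {τ : ℍ} {x : ℂ} (hx : x ∉ lattice τ) (k l : ℤ) :
    rho τ (x + (k + l * (τ : ℂ))) = rho τ x - 2 * Real.pi * I * l := by
  have h1 : ∀ (k : ℤ) (x : ℂ), rho τ (x + k) = rho τ x := by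
    intro k x
    have hper : Function.Periodic (rho τ) 1 := rho_add_one τ
    simpa using hper.int_mul k x
  have h2 : ∀ (l : ℤ) (x : ℂ), x ∉ lattice τ →
      rho τ (x + l * τ) = rho τ x - 2 * Real.pi * I * l := by
    have hmem : ∀ (l : ℤ) (x : ℂ), x ∉ lattice τ → x + l * (τ : ℂ) ∉ lattice τ :=
      fun l x hx h => hx (by
        have := lattice_sub h (⟨0, l, by simp⟩ : (l * (τ : ℂ)) ∈ lattice τ)
        rwa [add_sub_cancel_right] at this)
    intro l
    induction l using Int.induction_on with
    | zero => intro x _; simp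
    | succ n ih =>
      intro x hx
      rw [show x + ((n + 1 : ℤ) : ℂ) * τ = x + (n : ℤ) * τ + τ by push_cast; ring,
        rho_add_tau (hmem n x hx), ih x hx]
      push_cast
      ring
    | pred n ih =>
      intro x hx
      have := rho_add_tau (hmem (-n - 1) x hx)
      rw [show x + ((-n - 1 : ℤ) : ℂ) * τ + τ = x + (-n : ℤ) * τ by push_cast; ring,
        ih x hx] at this
      push_cast at this ⊢
      linear_combination -this
  rw [add_comm (k : ℂ), ← add_assoc, h1, h2 l x hx]

theorem not_mem_lattice_add {τ : ℍ} {x : ℂ} (hx : x ∉ lattice τ) (k l : ℤ) :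
    x + (k + l * (τ : ℂ)) ∉ lattice τ := fun h => hx (by
  have := lattice_sub h (⟨k, l, rfl⟩ : (k + l * (τ : ℂ)) ∈ lattice τ)
  rwa [add_sub_cancel_right] at this)

theorem BetheSolution.ext' {τ : ℍ} {m : ℕ} {S S' : BetheSolution τ m} (h1 : S.mu = S'.mu)
    (h2 : S.t = S'.t) (h3 : S.z = S'.z) : S = S' := by
  cases S
  cases S'
  simp only at h1 h2 h3
  subst h1 h2 h3
  rfl

/-- Translation of all coordinates of a solution by elements of the lattice. -/
def BetheSolution.translate {τ : ℍ} {m : ℕ} (S : BetheSolution τ m)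
    (v : (Fin m ⊕ Fin (2 * m) → ℤ) × (Fin m ⊕ Fin (2 * m) → ℤ)) : BetheSolution τ m where
  mu := S.mu - 2 * ∑ j, (v.2 (.inl j) : ℂ) + ∑ a, (v.2 (.inr a) : ℂ)
  t j := S.t j + (v.1 (.inl j) + v.2 (.inl j) * (τ : ℂ))
  z a := S.z a + (v.1 (.inr a) + v.2 (.inr a) * (τ : ℂ))
  t_distinct i j hij := by
    have := not_mem_lattice_add (S.t_distinct i j hij) (v.1 (.inl i) - v.1 (.inl j))
      (v.2 (.inl i) - v.2 (.inl j))
    convert this using 2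
    push_cast
    ring
  t_ne_z i a := by
    have := not_mem_lattice_add (S.t_ne_z i a) (v.1 (.inl i) - v.1 (.inr a))
      (v.2 (.inl i) - v.2 (.inr a))
    convert this using 2
    push_cast
    ring
  bethe j := by
    have h1 : ∀ k ∈ Finset.univ.erase j, rho τ (S.t j + (v.1 (.inl j) + v.2 (.inl j) * (τ : ℂ)) -
        (S.t k + (v.1 (.inl k) + v.2 (.inl k) * (τ : ℂ)))) = rho τ (S.t j - S.t k) -
          2 * Real.pi * I * (v.2 (.inl j) - v.2 (.inl k)) := fun k hk => by
      have := rho_add_lattice (S.t_distinct j k (Finset.ne_of_mem_erase hk).symm)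
        (v.1 (.inl j) - v.1 (.inl k)) (v.2 (.inl j) - v.2 (.inl k))
      push_cast at this
      rw [← this]
      congr 1
      ring
    have h2 : ∀ a, rho τ (S.t j + (v.1 (.inl j) + v.2 (.inl j) * (τ : ℂ)) -
        (S.z a + (v.1 (.inr a) + v.2 (.inr a) * (τ : ℂ)))) = rho τ (S.t j - S.z a) -
          2 * Real.pi * I * (v.2 (.inl j) - v.2 (.inr a)) := fun a => by
      have := rho_add_lattice (S.t_ne_z j a)
        (v.1 (.inl j) - v.1 (.inr a)) (v.2 (.inl j) - v.2 (.inr a))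
      push_cast at this
      rw [← this]
      congr 1
      ring
    -- The translation of t_j itself enters with weight 2m from the t_k (the k = j term being 0) and
    -- -2m from the 2m points z_a. It cancels, so the change of μ is independent of j.
    have h3 : ∑ k ∈ Finset.univ.erase j, ((v.2 (.inl j) : ℂ) - v.2 (.inl k)) =
        m * v.2 (.inl j) - ∑ k, (v.2 (.inl k) : ℂ) := by
      rw [Finset.sum_erase _ (sub_self _), Finset.sum_sub_distrib]
      simp
    rw [Finset.sum_congr rfl h1, Finset.sum_congr rfl fun a _ => h2 a, Finset.sum_sub_distrib,
      Finset.sum_sub_distrib, ← Finset.mul_sum, ← Finset.mul_sum, h3, Finset.sum_sub_distrib]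
    simp only [Finset.sum_const, Finset.card_univ, Fintype.card_fin, nsmul_eq_mul]
    push_cast
    linear_combination S.bethe j

theorem BetheSolution.translate_add {τ : ℍ} {m : ℕ} (S : BetheSolution τ m)
    (v v' : (Fin m ⊕ Fin (2 * m) → ℤ) × (Fin m ⊕ Fin (2 * m) → ℤ)) :
    S.translate (v + v') = (S.translate v).translate v' := by
  refine BetheSolution.ext' ?_ ?_ ?_
  · simp only [translate, Prod.snd_add, Pi.add_apply, Int.cast_add, Finset.sum_add_distrib]
    ring
  · funext j
    simp only [translate, Prod.snd_add, Prod.fst_add, Pi.add_apply, Int.cast_add]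
    ring
  · funext j
    simp only [translate, Prod.snd_add, Prod.fst_add, Pi.add_apply, Int.cast_add]
    ring

theorem BetheSolution.translate_zero {τ : ℍ} {m : ℕ} (S : BetheSolution τ m) :
    S.translate 0 = S := by
  refine BetheSolution.ext' ?_ ?_ ?_
  · simp [translate]
  · funext j; simp [translate]
  · funext j; simp [translate]

theorem eqvGen_translate {τ : ℍ} {m : ℕ} (S : BetheSolution τ m)
    (v : (Fin m ⊕ Fin (2 * m) → ℤ) × (Fin m ⊕ Fin (2 * m) → ℤ)) :
    Relation.EqvGen BetheMove S (S.translate v) := by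
  classical
  -- Requiring the equivalence for every S makes these translations a subgroup, so only the unit
  -- vectors, which are elementary moves, need checking.
  let H : AddSubgroup ((Fin m ⊕ Fin (2 * m) → ℤ) × (Fin m ⊕ Fin (2 * m) → ℤ)) :=
    { carrier := {v | ∀ S : BetheSolution τ m, Relation.EqvGen BetheMove S (S.translate v)}
      zero_mem' := fun S => by rw [S.translate_zero]; exact .refl S
      add_mem' := fun {v v'} hv hv' S => by
        rw [S.translate_add]
        exact .trans _ _ _ (hv S) (hv' _)
      neg_mem' := fun {v} hv S => by
        have := hv (S.translate (-v))
        rw [← S.translate_add, neg_add_cancel, S.translate_zero] at this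
        exact .symm _ _ this }
  have h1 : ∀ i, ((Pi.single i 1, 0) : (Fin m ⊕ Fin (2 * m) → ℤ) × (Fin m ⊕ Fin (2 * m) → ℤ)) ∈
      H := by
    intro i S
    refine .rel _ _ ?_
    rcases i with j | a
    · refine .shift_t_one j ?_ ?_ ?_
      · simp [BetheSolution.translate]
      · funext i
        by_cases hij : i = j
        · subst hij; simp [BetheSolution.translate]
        · simp [BetheSolution.translate, hij]
      · funext i; simp [BetheSolution.translate]
    · refine .shift_z_one a ?_ ?_ ?_
      · simp [BetheSolution.translate]
      · funext i; simp [BetheSolution.translate]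
      · funext i
        by_cases hij : i = a
        · subst hij; simp [BetheSolution.translate]
        · simp [BetheSolution.translate, hij]
  have h2 : ∀ i, ((0, Pi.single i 1) : (Fin m ⊕ Fin (2 * m) → ℤ) × (Fin m ⊕ Fin (2 * m) → ℤ)) ∈
      H := by
    intro i S
    refine .rel _ _ ?_
    rcases i with j | a
    · refine .shift_t_tau j ?_ ?_ ?_
      · simp [BetheSolution.translate, Pi.single_apply]
      · funext i
        by_cases hij : i = j
        · subst hij; simp [BetheSolution.translate]
        · simp [BetheSolution.translate, hij]
      · funext i; simp [BetheSolution.translate]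
    · refine .shift_z_tau a ?_ ?_ ?_
      · simp [BetheSolution.translate, Pi.single_apply]
      · funext i; simp [BetheSolution.translate]
      · funext i
        by_cases hij : i = a
        · subst hij; simp [BetheSolution.translate]
        · simp [BetheSolution.translate, hij]
  have hv : v = ∑ i, (v.1 i • ((Pi.single i 1, 0) : (Fin m ⊕ Fin (2 * m) → ℤ) ×
      (Fin m ⊕ Fin (2 * m) → ℤ)) + v.2 i • (0, Pi.single i 1)) := by
    ext i
    · rcases i with i | i <;> simp [Prod.fst_sum, Finset.sum_apply, Pi.single_apply]
    · rcases i with i | i <;> simp [Prod.snd_sum, Finset.sum_apply, Pi.single_apply]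
  have : v ∈ H := by
    rw [hv]
    exact H.sum_mem fun i _ => H.add_mem (H.zsmul_mem (h1 i) _) (H.zsmul_mem (h2 i) _)
  exact this S

/-- Every solution is equivalent to one with all coordinates in a given parallelogram. -/
theorem exists_eqvGen_mem_parallelogram {τ : ℍ} (w : ℂ) {m : ℕ} (S : BetheSolution τ m) :
    ∃ S' : BetheSolution τ m, Relation.EqvGen BetheMove S S' ∧
      (∀ j, S'.t j ∈ parallelogram τ w) ∧ ∀ a, S'.z a ∈ parallelogram τ w := by
  choose f hf hf' using exists_lattice_add_mem_parallelogram τ w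
  choose k l hkl using hf
  refine ⟨S.translate (Sum.elim (fun j => k (S.t j)) fun a => k (S.z a),
    Sum.elim (fun j => l (S.t j)) fun a => l (S.z a)), eqvGen_translate S _, fun j => ?_,
    fun a => ?_⟩
  · have := hf' (S.t j)
    rw [hkl] at this
    exact this
  · have := hf' (S.z a)
    rw [hkl] at this
    exact this

/-- The functions attached to equivalent solutions differ by an exponential factor. -/
def ThetaEquiv {τ : ℍ} {m : ℕ} (S S' : BetheSolution τ m) : Prop :=
  ∃ L : ℤ, thetaPoint τ 0 S'.t = expMul L (thetaPoint τ 0 S.t) ∧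
    thetaPoint τ (-S'.mu) S'.z = expMul (2 * L) (thetaPoint τ (-S.mu) S.z)

theorem ThetaEquiv.symm {τ : ℍ} {m : ℕ} {S S' : BetheSolution τ m} (h : ThetaEquiv S S') :
    ThetaEquiv S' S := by
  obtain ⟨L, h1, h2⟩ := h
  refine ⟨-L, ?_, ?_⟩
  · rw [h1, ← expMul_add, Int.cast_neg, neg_add_cancel, expMul_zero]
  · rw [h2, ← expMul_add, Int.cast_neg, mul_neg, neg_add_cancel, expMul_zero]

theorem ThetaEquiv.trans {τ : ℍ} {m : ℕ} {S S' S'' : BetheSolution τ m} (h : ThetaEquiv S S')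
    (h' : ThetaEquiv S' S'') : ThetaEquiv S S'' := by
  obtain ⟨L, h1, h2⟩ := h
  obtain ⟨L', h1', h2'⟩ := h'
  refine ⟨L' + L, ?_, ?_⟩
  · rw [h1', h1, ← expMul_add, Int.cast_add]
  · rw [h2', h2, ← expMul_add, Int.cast_add, mul_add]

theorem thetaEquiv_of_eqvGen {τ : ℍ} {m : ℕ} {S S' : BetheSolution τ m}
    (h : Relation.EqvGen BetheMove S S') : ThetaEquiv S S' := by
  induction h with
  | rel S S' h =>
    cases h with
    | perm σ π hmu ht hz =>
      refine ⟨0, ?_, ?_⟩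
      · rw [ht, thetaPoint_comp_perm, Int.cast_zero, expMul_zero]
      · rw [hz, hmu, thetaPoint_comp_perm, Int.cast_zero, mul_zero, expMul_zero]
    | shift_t_tau j hmu ht hz =>
      refine ⟨1, ?_, ?_⟩
      · rw [ht, thetaPoint_update_add_tau, expMul_thetaPoint, Int.cast_one, zero_add, add_zero]
      · rw [hz, hmu, expMul_thetaPoint, Int.cast_one]
        exact congrArg (fun ν => thetaPoint τ ν _) (by ring)
    | shift_t_one j hmu ht hz =>
      refine ⟨0, ?_, ?_⟩
      · rw [ht, thetaPoint_update_add_one, Int.cast_zero, expMul_zero]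
      · rw [hz, hmu, Int.cast_zero, mul_zero, expMul_zero]
    | shift_z_tau a hmu ht hz =>
      refine ⟨0, ?_, ?_⟩
      · rw [ht, Int.cast_zero, expMul_zero]
      · rw [hz, hmu, thetaPoint_update_add_tau, Int.cast_zero, mul_zero, expMul_zero]
        exact congrArg (fun ν => thetaPoint τ ν _) (by ring)
    | shift_z_one a hmu ht hz =>
      refine ⟨0, ?_, ?_⟩
      · rw [ht, Int.cast_zero, expMul_zero]
      · rw [hz, hmu, thetaPoint_update_add_one, Int.cast_zero, mul_zero, expMul_zero]
  | refl S => exact ⟨0, by rw [Int.cast_zero, expMul_zero],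
      by rw [Int.cast_zero, mul_zero, expMul_zero]⟩
  | symm S S' _ ih => exact ih.symm
  | trans S S' S'' _ _ ih ih' => exact ih.trans ih'

/-- For the converse both solutions are first translated into one parallelogram. There equality of
theta points means equality up to permutation and of labels, which forces L = 0, and a single
permutation move remains. -/
theorem eqvGen_iff_thetaEquiv {τ : ℍ} {m : ℕ} {S S' : BetheSolution τ m} :
    Relation.EqvGen BetheMove S S' ↔ ThetaEquiv S S' := by
  refine ⟨thetaEquiv_of_eqvGen, fun h => ?_⟩
  obtain ⟨T, hT, ht, hz⟩ := exists_eqvGen_mem_parallelogram 0 S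
  obtain ⟨T', hT', ht', hz'⟩ := exists_eqvGen_mem_parallelogram 0 S'
  obtain ⟨L, h1, h2⟩ := ((thetaEquiv_of_eqvGen hT).symm.trans h).trans (thetaEquiv_of_eqvGen hT')
  rw [expMul_thetaPoint] at h1 h2
  obtain ⟨hL, σ, hσ⟩ := thetaPoint_injective ht' ht h1
  obtain ⟨hmu, π, hπ⟩ := thetaPoint_injective hz' hz h2
  rw [add_zero] at hL
  rw [← hL, mul_zero, zero_add, neg_inj] at hmu
  exact .trans _ _ _ hT (.trans _ _ _ (.rel _ _ (.perm σ π hmu hσ hπ)) (.symm _ _ hT'))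

/-! ### Classes of solutions -/

theorem BetheSolution.isBetheSolution {τ : ℍ} {m : ℕ} (S : BetheSolution τ m) :
    IsBetheSolution τ S.mu S.t S.z :=
  ⟨S.t_distinct, S.t_ne_z, S.bethe⟩

/-- The solution `(μ, t, z)`. -/
def IsBetheSolution.toSolution {τ : ℍ} {m : ℕ} {μ : ℂ} {t : Fin m → ℂ} {z : Fin (2 * m) → ℂ}
    (h : IsBetheSolution τ μ t z) : BetheSolution τ m :=
  ⟨μ, t, z, h.1, h.2.1, h.2.2⟩

/-- The class of the solution `(μ, t, z)`. -/
def IsBetheSolution.toClass {τ : ℍ} {m : ℕ} {μ : ℂ} {t : Fin m → ℂ} {z : Fin (2 * m) → ℂ}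
    (h : IsBetheSolution τ μ t z) : BetheClass τ m :=
  Quotient.mk (Relation.EqvGen.setoid (BetheMove (τ := τ) (m := m))) h.toSolution

theorem contains_iff {τ : ℍ} {m : ℕ} {c : BetheClass τ m} {μ : ℂ} {t : Fin m → ℂ}
    {z : Fin (2 * m) → ℂ} :
    c.Contains μ t z ↔ ∃ h : IsBetheSolution τ μ t z, c = h.toClass := by
  constructor
  · rintro ⟨S, rfl, rfl, rfl, rfl⟩
    exact ⟨S.isBetheSolution, rfl⟩
  · rintro ⟨h, rfl⟩
    exact ⟨h.toSolution, rfl, rfl, rfl, rfl⟩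

theorem toClass_eq_iff {τ : ℍ} {m : ℕ} {μ μ' : ℂ} {t t' : Fin m → ℂ} {z z' : Fin (2 * m) → ℂ}
    {h : IsBetheSolution τ μ t z} {h' : IsBetheSolution τ μ' t' z'} :
    h.toClass = h'.toClass ↔ ∃ L : ℤ, thetaPoint τ 0 t' = expMul L (thetaPoint τ 0 t) ∧
      thetaPoint τ (-μ') z' = expMul (2 * L) (thetaPoint τ (-μ) z) :=
  Quotient.eq.trans (eqvGen_iff_thetaEquiv (S := h.toSolution) (S' := h'.toSolution))

theorem toClass_eq_of_comp_perm {τ : ℍ} {m : ℕ} {μ : ℂ} {t t' : Fin m → ℂ} {z : Fin (2 * m) → ℂ}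
    {h : IsBetheSolution τ μ t z} {h' : IsBetheSolution τ μ t' z} (σ : Equiv.Perm (Fin m))
    (e : t' = t ∘ σ) : h.toClass = h'.toClass :=
  toClass_eq_iff.2 ⟨0, by rw [e, thetaPoint_comp_perm, Int.cast_zero, expMul_zero],
    by rw [Int.cast_zero, mul_zero, expMul_zero]⟩

theorem exists_perm_of_toClass_eq {τ : ℍ} {w : ℂ} {m : ℕ} {μ : ℂ} {t t' : Fin m → ℂ}
    {z : Fin (2 * m) → ℂ} {h : IsBetheSolution τ μ t z} {h' : IsBetheSolution τ μ t' z}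
    (ht : ∀ j, t j ∈ parallelogram τ w) (ht' : ∀ j, t' j ∈ parallelogram τ w)
    (e : h.toClass = h'.toClass) : ∃ σ : Equiv.Perm (Fin m), t' = t ∘ σ := by
  obtain ⟨L, h1, -⟩ := toClass_eq_iff.1 e
  rw [expMul_thetaPoint] at h1
  exact (thetaPoint_injective ht' ht h1).2

theorem IsBetheSolution.comp_perm {τ : ℍ} {m n : ℕ} {μ : ℂ} {t : Fin m → ℂ} {z : Fin n → ℂ}
    (h : IsBetheSolution τ μ t z) (σ : Equiv.Perm (Fin m)) : IsBetheSolution τ μ (t ∘ σ) z := by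
  refine ⟨fun i j hij => h.1 _ _ (σ.injective.ne hij), fun i a => h.2.1 _ a, fun j => ?_⟩
  have h1 := h.2.2 (σ j)
  rw [Finset.sum_erase_eq_sub (Finset.mem_univ _)] at h1 ⊢
  simp only [Function.comp_apply]
  rw [Equiv.sum_comp σ fun k => rho τ (t (σ j) - t k)]
  exact h1

theorem mem_betheSet_iff {τ : ℍ} {w : ℂ} {m : ℕ} {μ : ℂ} {z : Fin (2 * m) → ℂ}
    {c : BetheClass τ m} : c ∈ betheSet τ w m μ z ↔
      ∃ (t : Fin m → ℂ) (h : IsBetheSolution τ μ t z), (∀ j, t j ∈ parallelogram τ w) ∧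
        c = h.toClass := by
  constructor
  · rintro ⟨t, ht, hc⟩
    obtain ⟨h, e⟩ := contains_iff.1 hc
    exact ⟨t, h, ht, e⟩
  · rintro ⟨t, h, ht, e⟩
    exact ⟨t, ht, contains_iff.2 ⟨h, e⟩⟩

/-! ### Counting -/

/-- Each m-element subset of the z_a is sent to the class of the unique solution near it.
Localization makes this surjective, and the separating radius recovers the subset from the solution.
-/
theorem ncard_betheSet {τ : ℍ} {w : ℂ} {m : ℕ} {μ : ℂ} {z : Fin (2 * m) → ℂ} {δ : ℝ}
    (hδ : IsSeparatingRadius τ w z δ)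
    (hloc : ∀ t : Fin m → ℂ, (∀ j, t j ∈ parallelogram τ w) → IsBetheSolution τ μ t z →
      ∃ s, IsLocalized z δ t s)
    (hnear : ∀ a : Fin m → Fin (2 * m), Function.Injective a →
        (∃ t, IsBetheSolution τ μ t z ∧ ∀ j, ‖t j - z (a j)‖ < δ) ∧
        ∀ t t', IsBetheSolution τ μ t z → IsBetheSolution τ μ t' z →
          (∀ j, ‖t j - z (a j)‖ < δ) → (∀ j, ‖t' j - z (a j)‖ < δ) → t = t') :
    (betheSet τ w m μ z).ncard = (2 * m).choose m := by
  classical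
  let e : {I : Finset (Fin (2 * m)) // I.card = m} → Fin m → Fin (2 * m) :=
    fun I => I.1.orderEmbOfFin I.2
  have he : ∀ I, Function.Injective (e I) := fun I => (I.1.orderEmbOfFin I.2).injective
  have her : ∀ I, Set.range (e I) = I.1 := fun I => I.1.range_orderEmbOfFin I.2
  choose t hb ht using fun I => (hnear (e I) (he I)).1
  have htΛ : ∀ I j, t I j ∈ parallelogram τ w := fun I j =>
    openParallelogram_subset τ w (hδ.2.2.1 _ _ (ht I j))
  have hinj : Function.Injective fun I => (hb I).toClass := by
    intro I J hIJ
    obtain ⟨σ, hσ⟩ := exists_perm_of_toClass_eq (htΛ I) (htΛ J) hIJ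
    have hJI : ∀ j, e J j = e I (σ j) := by
      intro j
      by_contra hne
      have h1 := ht J j
      rw [hσ] at h1
      exact hδ.2.1 _ _ hne _ _ h1 (ht I (σ j)) (by simpa using zero_mem_lattice τ)
    have hsub : J.1 ⊆ I.1 := by
      intro a ha
      have : a ∈ Set.range (e J) := by rw [her]; exact ha
      obtain ⟨j, rfl⟩ := this
      rw [hJI j]
      have : e I (σ j) ∈ (I.1 : Set (Fin (2 * m))) := by rw [← her]; exact ⟨_, rfl⟩
      exact this
    exact Subtype.ext (Finset.eq_of_subset_of_card_le hsub (by rw [I.2, J.2])).symm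
  have hrange : Set.range (fun I => (hb I).toClass) = betheSet τ w m μ z := by
    ext c
    rw [mem_betheSet_iff]
    constructor
    · rintro ⟨I, rfl⟩
      exact ⟨t I, hb I, htΛ I, rfl⟩
    · rintro ⟨u, hu, huΛ, rfl⟩
      obtain ⟨s, σ, hσ, -⟩ := hloc u huΛ hu
      have ha : Function.Injective fun j => σ (.inl j) := fun i j hij =>
        Sum.inl_injective (σ.injective hij)
      let I : {I : Finset (Fin (2 * m)) // I.card = m} :=
        ⟨Finset.univ.image fun j => σ (.inl j), by
          rw [Finset.card_image_of_injective _ ha, Finset.card_univ, Fintype.card_fin]⟩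
      have hπ : ∀ j, ∃ i, σ (.inl i) = e I j := fun j => by
        have : e I j ∈ (I.1 : Set (Fin (2 * m))) := by rw [← her]; exact ⟨_, rfl⟩
        simpa [I] using this
      choose π hπ using hπ
      have hπi : Function.Injective π := fun i j hij => he I (by rw [← hπ, ← hπ, hij])
      let π' : Equiv.Perm (Fin m) := Equiv.ofBijective π (Finite.injective_iff_bijective.1 hπi)
      refine ⟨I, ?_⟩
      -- Reordered by π', the solution u is close to the points of I in increasing order, where
      -- uniqueness identifies it with the chosen one.
      have h1 : t I = u ∘ π' := (hnear (e I) (he I)).2 _ _ (hb I) (hu.comp_perm π') (ht I)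
        fun j => by
          rw [← hπ j]
          exact hσ (π j)
      exact (toClass_eq_of_comp_perm π' h1).symm
  rw [← hrange, ← Nat.card_coe_set_eq,
    ← Nat.card_congr (Equiv.ofInjective _ hinj), Nat.card_eq_fintype_card,
    Fintype.card_finset_len, Fintype.card_fin]

/-! ### The correspondence -/

theorem pairDomain_thetaPoint {τ : ℍ} {m : ℕ} {μ : ℂ} (hμ : ∀ k : ℤ, μ ≠ k) (t s : Fin m → ℂ) :
    (thetaPoint τ 0 t, thetaPoint τ (-μ) s) ∈ pairDomain τ m := by
  refine ⟨?_, ⟨exp (2 * Real.pi * I * (-μ)), exp_ne_zero _, ?_⟩, fun h => ?_⟩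
  · have h := thetaProd_mem τ 0 t
    rw [mul_zero, exp_zero] at h
    exact (mk_mem_projThetaFirst _).2 ⟨_, exp_ne_zero _, h⟩
  · exact (mk_mem_projThetaFirst _).2 ⟨_, exp_ne_zero _, thetaProd_mem τ (-μ) s⟩
  · obtain ⟨B, -, h⟩ := (mk_mem_projThetaFirst _).1 h
    have h1 := (thetaSpace_unique (thetaProd_ne_zero τ (-μ) s) (thetaProd_mem τ (-μ) s) h).1
    rw [← exp_zero, ← mul_zero (2 * Real.pi * I)] at h1
    obtain ⟨n, hn⟩ := exp_eq_exp_int h1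
    exact hμ (-n) (by push_cast; linear_combination -hn)

theorem wronskianEq_thetaPoint {τ : ℍ} {m n : ℕ} {μ C : ℂ} {t s : Fin m → ℂ} {z : Fin n → ℂ}
    (hC : C ≠ 0)
    (h : wronskian (thetaProd τ 0 t) (thetaProd τ (-μ) s) = C • thetaProd τ (-μ) z) :
    WronskianEq (thetaPoint τ 0 t) (thetaPoint τ (-μ) s) (thetaPoint τ (-μ) z) :=
  wronskianEq_mk_iff.2 ⟨C, hC, h⟩

theorem pairDomain_differentiable {τ : ℍ} {m : ℕ} {P : ProjFun × ProjFun}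
    (hP : P ∈ pairDomain τ m) : Differentiable ℂ P.1.rep ∧ Differentiable ℂ P.2.rep := by
  obtain ⟨⟨_, _, h1⟩, ⟨_, _, _, _, h2⟩, _⟩ := hP
  exact ⟨h1.1, h2.1⟩

theorem pairDomain_expMul {τ : ℍ} {m : ℕ} {P : ProjFun × ProjFun} (hP : P ∈ pairDomain τ m)
    (k : ℤ) : (expMul k P.1, expMul k P.2) ∈ pairDomain τ m := by
  obtain ⟨h1, ⟨A, hA, h2⟩, h3⟩ := hP
  exact ⟨(expMul_int_mem_iff k).2 h1, ⟨A, hA, (expMul_int_mem_iff k).2 h2⟩,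
    fun h => h3 ((expMul_int_mem_iff k).1 h)⟩

/-- Equivalent solutions have f and h multiplied by exp (2πiLx) and exp (4πiLx). After the shift by
L both pairs share f and Wr(f, g), which determine g. -/
theorem Corresponds.right_unique {τ : ℍ} {m : ℕ} {c : BetheClass τ m} {p p' : PairQuot τ m}
    (h : Corresponds c p) (h' : Corresponds c p') : p = p' := by
  obtain ⟨μ, t, z, P, -, hc, rfl, hP1, hP2⟩ := h
  obtain ⟨μ', t', z', P', -, hc', rfl, hP1', hP2'⟩ := h'
  obtain ⟨hb, e⟩ := contains_iff.1 hc
  obtain ⟨hb', e'⟩ := contains_iff.1 hc'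
  obtain ⟨L, h1, h2⟩ := toClass_eq_iff.1 (e.symm.trans e')
  have hd := pairDomain_differentiable P.2
  have hW := hP2.expMul hd.1 hd.2 L
  have hfst : P'.1.1 = expMul L P.1.1 := by rw [hP1', h1, hP1]
  rw [← h2] at hW
  have hdom := pairDomain_expMul P.2 L
  have hdom' : (P'.1.1, P'.1.2) ∈ pairDomain τ m := P'.2
  rw [hfst] at hdom' hP2'
  exact Quotient.sound ⟨L, hfst, pairDomain_snd_unique hdom' hdom hP2' hW⟩

theorem Corresponds.left_unique {τ : ℍ} {m : ℕ} {c c' : BetheClass τ m} {p : PairQuot τ m}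
    (h : Corresponds c p) (h' : Corresponds c' p) : c = c' := by
  obtain ⟨μ, t, z, P, -, hc, rfl, hP1, hP2⟩ := h
  obtain ⟨μ', t', z', P', -, hc', hp, hP1', hP2'⟩ := h'
  obtain ⟨hb, rfl⟩ := contains_iff.1 hc
  obtain ⟨hb', rfl⟩ := contains_iff.1 hc'
  obtain ⟨k, hk1, hk2⟩ := Quotient.exact hp.symm
  have hd := pairDomain_differentiable P.2
  have hW := hP2.expMul hd.1 hd.2 k
  rw [← hk1, ← hk2] at hW
  exact toClass_eq_iff.2 ⟨k, by rw [← hP1', hk1, hP1], hP2'.unique hW⟩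

theorem genericBoth_thetaPoint {τ : ℍ} {m n : ℕ} {μ C : ℂ} {t s : Fin m → ℂ} {z : Fin n → ℂ}
    (h : wronskian (thetaProd τ 0 t) (thetaProd τ (-μ) s) = C • thetaProd τ (-μ) z) (hC : C ≠ 0)
    (ht : ∀ i a, t i - z a ∉ lattice τ) (hs : ∀ i a, s i - z a ∉ lattice τ) :
    GenericBoth (thetaPoint τ 0 t, thetaPoint τ (-μ) s) := by
  obtain ⟨a, ha, hfa⟩ := rep_mk_eq_smul (thetaProd_ne_zero τ 0 t)
  obtain ⟨b, hb, hgb⟩ := rep_mk_eq_smul (thetaProd_ne_zero τ (-μ) s)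
  have key : ∀ (κ : ℂ) (u : Fin m → ℂ), (∀ i a, u i - z a ∉ lattice τ) → ∀ x,
      thetaProd τ κ u x = 0 → thetaProd τ (-μ) z x ≠ 0 := by
    intro κ u hu x hx hx'
    obtain ⟨i, hi⟩ := thetaProd_eq_zero_iff.1 hx
    obtain ⟨c, hc⟩ := thetaProd_eq_zero_iff.1 hx'
    refine hu i c ?_
    have := lattice_sub hc hi
    rwa [sub_sub_sub_cancel_left] at this
  simp only [GenericBoth, thetaPoint, hfa, hgb, wronskian_smul, h, Pi.smul_apply, smul_eq_mul,
    mul_eq_zero, ha, hb, hC, false_or, ne_eq]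
  exact ⟨key 0 t ht, key (-μ) s hs⟩

/-- The exponent ν in the definition of the analytic involution can be taken to be μ, since exp
(2πiμx) g = ∏ θ(x - s_j) has first multiplier 1. Swapping then gives the flipped Wronskian equation
for -μ. -/
theorem betheInvolution_of_wronskian {τ : ℍ} {m : ℕ} {μ C : ℂ} (hμ : ∀ k : ℤ, μ ≠ k)
    {t s : Fin m → ℂ} {z : Fin (2 * m) → ℂ} (hC : C ≠ 0)
    (h : wronskian (thetaProd τ 0 t) (thetaProd τ (-μ) s) = C • thetaProd τ (-μ) z)
    (ht : IsBetheSolution τ μ t z) (hs : IsBetheSolution τ (-μ) s z) :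
    BetheInvolution ht.toClass hs.toClass := by
  have hμ' : ∀ k : ℤ, -μ ≠ k := fun k hk => hμ (-k) (by push_cast; linear_combination -hk)
  let P : pairDomain τ m := ⟨_, pairDomain_thetaPoint hμ t s⟩
  have hν : expMul μ P.1.2 ∈ projThetaFirst τ m 1 := by
    change expMul μ (thetaPoint τ (-μ) s) ∈ projThetaFirst τ m 1
    rw [expMul_thetaPoint, add_neg_cancel]
    exact (pairDomain_thetaPoint hμ s s).1
  refine ⟨Quotient.mk _ P, ⟨P, genericBoth_thetaPoint h hC ht.2.1 hs.2.1, rfl⟩,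
    ⟨μ, t, z, P, hμ, contains_iff.2 ⟨ht, rfl⟩, rfl, rfl, wronskianEq_thetaPoint hC h⟩,
    ⟨-μ, s, z, ⟨_, swap_mem P.2 hν⟩, hμ', contains_iff.2 ⟨hs, rfl⟩,
      (Quotient.sound (swapPair_eq P hν)).symm, ?_, ?_⟩⟩
  · change expMul μ (thetaPoint τ (-μ) s) = _
    rw [expMul_thetaPoint, add_neg_cancel]
  · change WronskianEq (expMul μ (thetaPoint τ (-μ) s)) (expMul μ (thetaPoint τ 0 t)) _
    rw [expMul_thetaPoint, expMul_thetaPoint, add_neg_cancel, add_zero, ← neg_neg μ]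
    have := wronskianEq_thetaPoint (neg_ne_zero.2 hC) (wronskian_flip h)
    rwa [neg_neg (-μ)]

theorem betheInvolution_iff {τ : ℍ} {m : ℕ} {c c₀ : BetheClass τ m} (h : BetheInvolution c c₀)
    {c' : BetheClass τ m} : BetheInvolution c c' ↔ c' = c₀ := by
  constructor
  · rintro ⟨p', -, h1, h2⟩
    obtain ⟨p, -, h3, h4⟩ := h
    obtain rfl := h1.right_unique h3
    exact h2.left_unique h4
  · rintro rfl
    exact h

/-- The second factor of a Wronskian equation is determined by the first one. -/
theorem exists_perm_of_wronskian {τ : ℍ} {w : ℂ} {m : ℕ} {μ C C' : ℂ} (hμ : ∀ k : ℤ, μ ≠ k)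
    {t t' s s' : Fin m → ℂ} {z : Fin (2 * m) → ℂ} (hs : ∀ j, s j ∈ parallelogram τ w)
    (hs' : ∀ j, s' j ∈ parallelogram τ w) (hC : C ≠ 0) (hC' : C' ≠ 0)
    (h : wronskian (thetaProd τ 0 t) (thetaProd τ (-μ) s) = C • thetaProd τ (-μ) z)
    (h' : wronskian (thetaProd τ 0 t') (thetaProd τ (-μ) s') = C' • thetaProd τ (-μ) z)
    {σ : Equiv.Perm (Fin m)} (e : t' = t ∘ σ) : ∃ π : Equiv.Perm (Fin m), s' = s ∘ π := by
  have h1 := wronskianEq_thetaPoint hC h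
  have h2 := wronskianEq_thetaPoint hC' h'
  have h3 := pairDomain_thetaPoint (τ := τ) hμ t s
  have h4 := pairDomain_thetaPoint (τ := τ) hμ t' s'
  rw [e, thetaPoint_comp_perm] at h2 h4
  exact (thetaPoint_injective hs' hs (pairDomain_snd_unique h4 h3 h2 h1)).2

end

end EllipticBethe

/-! ### The main theorem: count, involution and Wronski fibre -/

theorem mainTheorem5 (τ : UpperHalfPlane) (w : ℂ) (m : ℕ) (hm : 0 < m)
    (z : Fin (2 * m) → ℂ) (hz : ∀ a, z a ∈ EllipticBethe.openParallelogram τ w)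
    (hz_inj : Function.Injective z) :
    ∃ N : ℝ, 0 < N ∧ ∀ μ : ℂ, N < ‖μ‖ →
      (EllipticBethe.betheSet τ w m μ z).ncard = (2 * m).choose m ∧
      (EllipticBethe.betheSet τ w m (-μ) z).ncard = (2 * m).choose m ∧
      ((∀ k : ℤ, μ ≠ k) →
        ∃ e : EllipticBethe.betheSet τ w m μ z ≃ EllipticBethe.betheSet τ w m (-μ) z,
          (∀ (c : EllipticBethe.betheSet τ w m μ z) (c' : EllipticBethe.BetheClass τ m),
            EllipticBethe.BetheInvolution c.1 c' ↔ c' = (e c).1) ∧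
          ∃ F : EllipticBethe.betheSet τ w m μ z ≃
              EllipticBethe.labeledPreimage τ w m 0 (EllipticBethe.thetaPoint τ (-μ) z),
            ∀ c : EllipticBethe.betheSet τ w m μ z, ∃ t s : Fin m → ℂ,
              (∀ j, t j ∈ EllipticBethe.parallelogram τ w) ∧
              (∀ j, s j ∈ EllipticBethe.parallelogram τ w) ∧
              c.1.Contains μ t z ∧ (e c).1.Contains (-μ) s z ∧
              (F c).1 = (EllipticBethe.thetaPoint τ 0 t, EllipticBethe.thetaPoint τ (-μ) s)) := by
  open EllipticBethe in
  obtain ⟨δ, hδ, N₁, hnear⟩ := exists_unique_near (τ := τ) hz hz_inj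
  obtain ⟨N₂, hthr⟩ := exists_threshold (τ := τ) hz hδ
  have hcard : ∀ μ : ℂ, N₁ < ‖μ‖ → N₂ < ‖μ‖ →
      (betheSet τ w m μ z).ncard = (2 * m).choose m := by
    intro μ h1 h2
    refine ncard_betheSet hδ (fun t ht hb => ?_) (hnear μ h1)
    obtain ⟨s, C, hs, hC, hW⟩ := (hthr μ h2).1 t ht hb
    exact ⟨s, ((hthr μ h2).2 t s _ C ht hs hC hW).2.2.2⟩
  refine ⟨max 1 (max N₁ N₂), lt_max_of_lt_left one_pos, fun μ hμ => ?_⟩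
  have h1 : N₁ < ‖μ‖ := ((le_max_left _ _).trans (le_max_right _ _)).trans_lt hμ
  have h2 : N₂ < ‖μ‖ := ((le_max_right _ _).trans (le_max_right _ _)).trans_lt hμ
  refine ⟨hcard μ h1 h2, hcard (-μ) (by rwa [norm_neg]) (by rwa [norm_neg]), fun hμZ => ?_⟩
  have hμZ' : ∀ k : ℤ, -μ ≠ k := fun k hk => hμZ (-k) (by push_cast; linear_combination -hk)
  obtain ⟨hpart, hgood⟩ := hthr μ h2
  -- The threshold depends only on |μ|, so the same δ and N₂ serve for -μ; surjectivity of the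
  -- involution uses this.
  obtain ⟨hpart', hgood'⟩ := hthr (-μ) (by rwa [norm_neg])
  have hex : ∀ c : betheSet τ w m μ z, ∃ (t s : Fin m → ℂ) (C : ℂ),
      (∀ j, t j ∈ parallelogram τ w) ∧ (∀ j, s j ∈ parallelogram τ w) ∧ C ≠ 0 ∧
      wronskian (thetaProd τ 0 t) (thetaProd τ (-μ) s) = C • thetaProd τ (-μ) z ∧
      ∃ h : IsBetheSolution τ μ t z, c.1 = h.toClass := by
    rintro ⟨c, hc⟩
    obtain ⟨t, h, ht, e⟩ := mem_betheSet_iff.1 hc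
    obtain ⟨s, C, hs, hC, hW⟩ := hpart t ht h
    exact ⟨t, s, C, ht, hs, hC, hW, h, e⟩
  -- One pair (t c, s c) is fixed per class. Both bijections are built from it, so the
  -- representatives in the last clause are the same for both.
  choose t s C ht hs hC hW hb hcl using hex
  have hb' : ∀ c, IsBetheSolution τ (-μ) (s c) z := fun c =>
    (hgood (t c) (s c) _ (C c) (ht c) (hs c) (hC c) (hW c)).2.2.1
  let e₀ : betheSet τ w m μ z → betheSet τ w m (-μ) z := fun c =>
    ⟨(hb' c).toClass, mem_betheSet_iff.2 ⟨s c, hb' c, hs c, rfl⟩⟩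
  have hflip : ∀ c, wronskian (thetaProd τ 0 (s c)) (thetaProd τ (-(-μ)) (t c)) =
      (-C c) • thetaProd τ (-(-μ)) z := fun c => wronskian_flip (hW c)
  have htclass : ∀ c c', (∃ σ : Equiv.Perm (Fin m), t c' = t c ∘ σ) → c = c' := by
    rintro c c' ⟨σ, hσ⟩
    refine Subtype.ext ?_
    rw [hcl c, hcl c']
    exact toClass_eq_of_comp_perm σ hσ
  have he₀ : Function.Bijective e₀ := by
    constructor
    · intro c c' hcc
      obtain ⟨σ, hσ⟩ := exists_perm_of_toClass_eq (hs c) (hs c') (congrArg Subtype.val hcc)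
      exact htclass c c' (exists_perm_of_wronskian hμZ' (ht c) (ht c') (neg_ne_zero.2 (hC c))
        (neg_ne_zero.2 (hC c')) (hflip c) (hflip c') hσ)
    -- A solution s' for -μ has a partner t'; flipping their Wronskian equation makes t' a solution
    -- for μ. The representative chosen for its class is a permutation of t', so its partner is a
    -- permutation of s'.
    · rintro ⟨d, hd⟩
      obtain ⟨s', h, hs', rfl⟩ := mem_betheSet_iff.1 hd
      obtain ⟨t', C', ht', hC', hW'⟩ := hpart' s' hs' h
      have hbt : IsBetheSolution τ (-(-μ)) t' z := (hgood' s' t' _ C' hs' ht' hC' hW').2.2.1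
      have hW'' := wronskian_flip hW'
      rw [neg_neg] at hbt
      rw [neg_neg μ] at hW''
      let c : betheSet τ w m μ z := ⟨hbt.toClass, mem_betheSet_iff.2 ⟨t', hbt, ht', rfl⟩⟩
      obtain ⟨σ, hσ⟩ := exists_perm_of_toClass_eq ht' (ht c) (hcl c)
      obtain ⟨π, hπ⟩ := exists_perm_of_wronskian hμZ hs' (hs c) (neg_ne_zero.2 hC') (hC c) hW''
        (hW c) hσ
      exact ⟨c, Subtype.ext (toClass_eq_of_comp_perm π hπ).symm⟩
  let F₀ : betheSet τ w m μ z → labeledPreimage τ w m 0 (thetaPoint τ (-μ) z) := fun c =>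
    ⟨(thetaPoint τ 0 (t c), thetaPoint τ (-μ) (s c)), pairDomain_thetaPoint hμZ (t c) (s c),
      wronskianEq_thetaPoint (hC c) (hW c), t c, ht c, by rw [Int.cast_zero]⟩
  have hF₀ : Function.Bijective F₀ := by
    constructor
    · intro c c' hcc
      have h := congrArg (fun P => P.1.1) hcc
      exact htclass c c' (thetaPoint_injective (ht c') (ht c) h.symm).2
    · rintro ⟨⟨p, q⟩, hdom, hWr, u, hu, hpu⟩
      simp only [Int.cast_zero] at hpu hWr
      subst hpu
      obtain ⟨-, ⟨A, hA, B, hB, hq⟩, -⟩ := id hdom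
      -- The label ν of the second factor is unknown at first. With its zeros moved into the
      -- parallelogram, largeness of μ forces ν = -μ and makes u a Bethe solution.
      obtain ⟨D, ν, v, hD, hv, hqv⟩ := thetaSpace_factor w hA hB hq q.rep_nonzero
      have hqp : q = thetaPoint τ ν v := by
        rw [← q.mk_rep]
        exact mk_eq_mk_of_smul _ _ hqv
      subst hqp
      obtain ⟨C', hC', hW'⟩ := wronskianEq_mk_iff.1 hWr
      obtain ⟨rfl, hbu, -, -⟩ := hgood u v ν C' hu hv hC' hW'
      let c : betheSet τ w m μ z := ⟨hbu.toClass, mem_betheSet_iff.2 ⟨u, hbu, hu, rfl⟩⟩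
      obtain ⟨σ, hσ⟩ := exists_perm_of_toClass_eq hu (ht c) (hcl c)
      obtain ⟨π, hπ⟩ := exists_perm_of_wronskian hμZ hv (hs c) hC' (hC c) hW' (hW c) hσ
      refine ⟨c, Subtype.ext (Prod.ext ?_ ?_)⟩
      · change thetaPoint τ 0 (t c) = thetaPoint τ 0 u
        rw [hσ, thetaPoint_comp_perm]
      · change thetaPoint τ (-μ) (s c) = thetaPoint τ (-μ) v
        rw [hπ, thetaPoint_comp_perm]
  refine ⟨Equiv.ofBijective e₀ he₀, fun c c' => ?_, Equiv.ofBijective F₀ hF₀, fun c =>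
    ⟨t c, s c, ht c, hs c, contains_iff.2 ⟨hb c, hcl c⟩, contains_iff.2 ⟨hb' c, rfl⟩, rfl⟩⟩
  rw [hcl c]
  exact betheInvolution_iff (betheInvolution_of_wronskian hμZ (hC c) (hW c) (hb c) (hb' c))
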